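/- Let $d\ge 1$, let $\|\cdot\|$ be any norm on $\mathbb{R}^d$, and let $\Lambda$ be Lebesgue measure restricted to the half-open unit cube $(0,1]^d$. For a finite Borel measure $\mu$ on $(0,1]^d$, $r\in\mathbb{R}$ and $n\ge 1$ let the $n$-th quantization error of order $r$ be $$e_{n,r}(\mu)=\inf_{A}\Big(\int d(x,A)^r\,d\mu(x)\Big)^{1/r}\ (r\neq 0),\qquad e_{n,0}(\mu)=\inf_{A}\exp\int\log d(x,A)\,d\mu(x),$$ where $A$ runs over the non-empty subsets of $\mathbb{R}^d$ with at most $n$ elements, $d(x,A)=\min_{y\in A}\|x-y\|$, $0^r=\infty$ and $\infty^{1/r}=0$ for $r<0$, and $\log 0=-\infty$, $\exp(-\infty)=0$. If the limit exists in $[0,\infty]$, write $C_{r,d}(\mu)=\lim_{n\to\infty}n^{1/d}e_{n,r}(\mu)$ (the $d$-dimensional quantization coefficient of order $r$). Let $\nu=h\Lambda$ be a Borel probability measure with density $h\ge 0$. Write $\|h\|_s=(\int h^s\,d\Lambda)^{1/s}$ for $0<s<\infty$ and $\|h\|_\infty$ for the $\Lambda$-essential supremum, and let $s_h=\sup\{s>0:\|h\|_s<\infty\}\in[1,\infty]$,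 with $d/s_h=0$ if $s_h=\infty$. Put $$\Phi_r(h)=\begin{cases}\|h\|_{d/(d+r)}^{1/r}, & r>-d,\ r\ne 0,\\ \exp\!\big(-\tfrac1d\int h\log h\,d\Lambda\big), & r=0,\\ 0, & r\le -d,\end{cases}$$ where $\|h\|_{d/(d+r)}^{1/r}=0$ if $r<0$ and $h^{d/(d+r)}$ is not integrable. **Theorem.** For every real $r\ne d/s_h-d$, and also for $r=d/s_h-d$ if $\|h\|_{s_h}=\infty$, the coefficients $C_{r,d}(\Lambda)$ and $C_{r,d}(\nu)$ exist and are finite, and $$C_{r,d}(\nu)=C_{r,d}(\Lambda)\,\Phi_r(h).$$ Moreover, $C_{r,d}(\nu)>0$ if $r>d/s_h-d$, and $C_{r,d}(\nu)=0$ if $r<d/s_h-d$, or if $r=d/s_h-d$ and $\|h\|_{s_h}=\infty$. In particular, if $s_h>1$, then for the geometric mean error ($r=0$) the limit $\lim_{n\to\infty}n^{1/d}e_{n,0}(\nu)$ exists and equals $C_{0,d}(\Lambda)\exp\!\big(-\tfrac1d\int h\log h\,d\Lambda\big)$. -/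

import Mathlib

open MeasureTheory Filter Topology
open scoped ENNReal

noncomputable section

/-- The half-open unit cube `(0,1]^d`. -/
def unitCube (d : ℕ) : Set (Fin d → ℝ) :=
  Set.univ.pi fun _ => Set.Ioc 0 1

/-- Lebesgue measure restricted to the half-open unit cube. -/
def cubeMeasure (d : ℕ) : Measure (Fin d → ℝ) :=
  volume.restrict (unitCube d)

/-- The integral of an extended-real-valued function as the difference of the integrals of its
positive and negative parts. It may take the values `±∞`. -/
def extIntegral {α : Type*} [MeasurableSpace α] (μ : Measure α) (f : α → EReal) : EReal :=
  ((∫⁻ x, (f x).toENNReal ∂μ : ℝ≥0∞) : EReal) - ((∫⁻ x, (-f x).toENNReal ∂μ : ℝ≥0∞) : EReal)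

/-- The distance `d(x,A) = min_{y ∈ A} N (x - y)` of a point to a finite set, for a norm `N`. -/
def distToSet {d : ℕ} (N : Seminorm ℝ (Fin d → ℝ)) (x : Fin d → ℝ)
    (A : Finset (Fin d → ℝ)) : ℝ≥0∞ :=
  ⨅ y ∈ A, ENNReal.ofReal (N (x - y))

/-- The mean of order `r` of `x ↦ d(x,A)` under `ν`: for `r ≠ 0` it is `(∫ d(x,A)^r dν)^(1/r)`,
where `0^r = ∞` and `∞^(1/r) = 0` if `r < 0`; for `r = 0` it is the geometric mean
`exp (∫ log d(x,A) dν)`, where `log 0 = -∞` and `exp (-∞) = 0`. -/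
def meanDist {d : ℕ} (N : Seminorm ℝ (Fin d → ℝ)) (ν : Measure (Fin d → ℝ)) (r : ℝ)
    (A : Finset (Fin d → ℝ)) : ℝ≥0∞ :=
  if r = 0 then EReal.exp (extIntegral ν fun x => ENNReal.log (distToSet N x A))
  else (∫⁻ x, (distToSet N x A) ^ r ∂ν) ^ (1 / r)

/-- The `n`-th quantization error of `ν` of order `r ∈ ℝ` with respect to the norm `N`:
the infimum of the means of order `r` over all non-empty sets with at most `n` elements. -/
def quantizationError {d : ℕ} (N : Seminorm ℝ (Fin d → ℝ)) (ν : Measure (Fin d → ℝ)) (r : ℝ)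
    (n : ℕ) : ℝ≥0∞ :=
  ⨅ (A : Finset (Fin d → ℝ)) (_ : A.Nonempty) (_ : A.card ≤ n), meanDist N ν r A

/-- The `κ`-dimensional quantization coefficient of order `r` of `ν` exists and equals `c`. -/
def HasQuantizationCoeff {d : ℕ} (N : Seminorm ℝ (Fin d → ℝ)) (ν : Measure (Fin d → ℝ))
    (κ r : ℝ) (c : ℝ≥0∞) : Prop :=
  Tendsto (fun n : ℕ => (n : ℝ≥0∞) ^ (1 / κ) * quantizationError N ν r n) atTop (𝓝 c)

/-- `s_h`, the supremum in `[0,∞]` of all real `s > 0` for which the `L^s` (quasi-)norm of `h`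
on the unit cube is finite. -/
def integrabilityExponent {d : ℕ} (h : (Fin d → ℝ) → ℝ) : ℝ≥0∞ :=
  sSup {s : ℝ≥0∞ | 0 < s ∧ s ≠ ∞ ∧ eLpNorm h s (cubeMeasure d) < ∞}

/-- The critical order `d / s_h - d`, which is `-d` if `s_h = ∞`. -/
def criticalOrder {d : ℕ} (h : (Fin d → ℝ) → ℝ) : ℝ :=
  ((d : ℝ≥0∞) / integrabilityExponent h).toReal - d

/-- The functional `Φ_r`: it is `‖h‖_{d/(d+r)}^(1/r)` for `r > -d`, `r ≠ 0` (being `0` when `r < 0`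
and the norm is infinite, since `∞^(1/r) = 0`), it is `exp (-(1/d) ∫ h log h dΛ)` for `r = 0`,
and `0` for `r ≤ -d`. -/
def densityFunctional {d : ℕ} (r : ℝ) (h : (Fin d → ℝ) → ℝ) : ℝ≥0∞ :=
  if r ≤ -(d : ℝ) then 0
  else if r = 0 then
    EReal.exp (-(((1 / (d : ℝ) : ℝ) : EReal) *
      extIntegral (cubeMeasure d) fun x => ((h x * Real.log (h x) : ℝ) : EReal)))
  else (eLpNorm h (ENNReal.ofReal (d / (d + r))) (cubeMeasure d)) ^ (1 / r)

end

/-!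
Every order `r > -d` is treated by one argument, in which `d(x, A) ^ r` and `log d(x, A)` are
replaced by the Box–Cox transform `boxCox r t = (t ^ r - 1) / r`, with `boxCox 0 = log`. It is
increasing for every `r`, rescales affinely (`boxCox_mul`), and turns the minimization of the mean
of order `r` into that of the cost `∫ h(x) boxCox r (n ^ (1/d) d(x, A)) dΛ(x)`, whatever the sign
of `r`. The whole proof is about these costs; `mul_meanDist_eq` translates back.

For the unit cube, self-similarity shows that `n ^ (1/d) e_n` converges to its infimum
`c = unitCoeff N r`: the lower bound `boxCox_unitCoeff_le` holds for every finite set, and tiling one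
good set gives the upper bound `exists_near_optimal_unitCube`. Positivity of `c`, and all
integrability questions, rest on the bound `exists_negMoment_bound` for the negative moments
of `n ^ (1/d) d(x, A)` of order less than `d`, which is uniform in `A`.

For a density that is constant on separated small cubes, a fine auxiliary grid costing a small
fraction of the points makes each cube be served by points near it only. The cost is then bounded
below by a sum over the cubes, and since `boxCox r u` is a convex function of `u ^ (-d)`
(`boxCox_tangent`), the best allocation of the points is proportional to `h ^ (d / (d + r))`;
this is `costLimit_le_sum`. Placing scaled near-optimal sets in the cubes attains the bound.

A general density in `L^p` is approximated in `L^p` by step densities. Once the auxiliary grid is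
added, the rescaled distances are bounded above, and Hölder's inequality with the negative moments
(`exists_weighted_boxCox_bound`) controls the error uniformly in `n` and `A`. The exponent `p` has to
exceed `d / (d + r)` for `r ≤ 0`, and such a `p` exists exactly above the critical order; for `r > 0`
one takes `p = 1`.

At or below the critical order with `r > -d` one has `r < 0`, and truncating the density bounds the
coefficient by `c` times the powers `1 / r` of norms that tend to infinity, so it is zero. For `r ≤ -d` all errors vanish: placed
at a Lebesgue density point of a superlevel set of `h`, a single point makes the integral infinite.
-/

/-! ### The Box–Cox transform -/

/-- The Box–Cox transform of order `r`: `(t ^ r - 1) / r`, and `log t` for `r = 0`. -/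
noncomputable def boxCox (r t : ℝ) : ℝ :=
  if r = 0 then Real.log t else (t ^ r - 1) / r

lemma boxCox_zero (t : ℝ) : boxCox 0 t = Real.log t := by simp [boxCox]

lemma boxCox_of_ne {r : ℝ} (hr : r ≠ 0) (t : ℝ) : boxCox r t = (t ^ r - 1) / r := by
  simp [boxCox, hr]

lemma boxCox_one (r : ℝ) : boxCox r 1 = 0 := by
  by_cases hr : r = 0
  · subst hr; simp [boxCox_zero]
  · simp [boxCox_of_ne hr]

lemma boxCox_mul (r : ℝ) {a t : ℝ} (ha : 0 < a) (ht : 0 < t) :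
    boxCox r (a * t) = a ^ r * boxCox r t + boxCox r a := by
  by_cases hr : r = 0
  · subst hr
    rw [boxCox_zero, boxCox_zero, boxCox_zero, Real.log_mul ha.ne' ht.ne', Real.rpow_zero]
    ring
  · rw [boxCox_of_ne hr, boxCox_of_ne hr, boxCox_of_ne hr, Real.mul_rpow ha.le ht.le]
    field_simp
    ring

lemma boxCox_strictMonoOn (r : ℝ) : StrictMonoOn (boxCox r) (Set.Ioi 0) := by
  intro s hs t ht hst
  rcases lt_trichotomy r 0 with hr | hr | hr
  · rw [boxCox_of_ne hr.ne, boxCox_of_ne hr.ne]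
    apply div_lt_div_of_neg_of_lt hr
    have := Real.rpow_lt_rpow_of_neg hs hst hr
    linarith
  · subst hr
    rw [boxCox_zero, boxCox_zero]
    exact Real.log_lt_log hs hst
  · rw [boxCox_of_ne hr.ne', boxCox_of_ne hr.ne']
    have := Real.rpow_lt_rpow (le_of_lt hs) hst hr
    gcongr

lemma boxCox_mono (r : ℝ) {s t : ℝ} (hs : 0 < s) (hst : s ≤ t) : boxCox r s ≤ boxCox r t :=
  (boxCox_strictMonoOn r).monotoneOn hs (hs.trans_le hst) hst

lemma measurable_boxCox (r : ℝ) : Measurable (boxCox r) := by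
  by_cases hr : r = 0
  · subst hr
    have : boxCox 0 = Real.log := funext boxCox_zero
    rw [this]; exact Real.measurable_log
  · have : boxCox r = fun t => (t ^ r - 1) / r := funext (boxCox_of_ne hr)
    rw [this]; fun_prop

lemma continuousAt_boxCox (r : ℝ) {t : ℝ} (ht : 0 < t) : ContinuousAt (boxCox r) t := by
  by_cases hr : r = 0
  · subst hr
    have : boxCox 0 = Real.log := funext boxCox_zero
    rw [this]; exact Real.continuousAt_log ht.ne'
  · have : boxCox r = fun t => (t ^ r - 1) / r := funext (boxCox_of_ne hr)
    rw [this]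
    exact ((Real.continuousAt_rpow_const t r (Or.inl ht.ne')).sub continuousAt_const).div_const r

/-- Monotonicity in the order, in the only case needed: comparison with a negative order. It
expresses that `boxCox r` is a convex function of `boxCox (-θ)`. -/
lemma boxCox_neg_order_le {r θ : ℝ} (hθ : 0 < θ) (hr : -θ ≤ r) {t : ℝ} (ht : 0 < t) :
    (1 - t ^ (-θ)) / θ ≤ boxCox r t := by
  by_cases h0 : r = 0
  · subst h0
    rw [boxCox_zero, div_le_iff₀ hθ]
    have h1 := Real.log_le_sub_one_of_pos (Real.rpow_pos_of_pos ht (-θ))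
    rw [Real.log_rpow ht] at h1
    linarith
  rw [boxCox_of_ne h0]
  have hwpos : 0 < t ^ (-θ) := Real.rpow_pos_of_pos ht _
  set w := t ^ (-θ) with hw
  have hpow : t ^ r = (1 + (w - 1)) ^ (-r / θ) := by
    rw [add_sub_cancel, hw, ← Real.rpow_mul ht.le]
    congr 1
    field_simp
  rw [hpow]
  rcases lt_or_gt_of_ne h0 with hneg | hpos
  · have hb := rpow_one_add_le_one_add_mul_self (s := w - 1) (p := -r / θ) (by linarith)
      (div_nonneg (by linarith) hθ.le) ((div_le_one hθ).2 (by linarith))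
    rw [le_div_iff_of_neg hneg]
    calc _ ≤ -r / θ * (w - 1) := by linarith
      _ = _ := by ring
  · have hβ : -r / θ ≤ 0 := div_nonpos_of_nonpos_of_nonneg (by linarith) hθ.le
    have hb : 1 + -r / θ * (w - 1) ≤ (1 + (w - 1)) ^ (-r / θ) := by
      rw [add_sub_cancel, Real.rpow_def_of_pos hwpos]
      have h1 := Real.add_one_le_exp (Real.log w * (-r / θ))
      have h2 := mul_le_mul_of_nonpos_right (Real.log_le_sub_one_of_pos hwpos) hβ
      linarith
    rw [le_div_iff₀ hpos]
    calc _ = -r / θ * (w - 1) := by ring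
      _ ≤ _ := by linarith

/-- Tangent inequality for `boxCox r u` as a convex function of `u ^ (-θ)`. -/
lemma boxCox_tangent {r θ : ℝ} (hθ : 0 < θ) (hr : -θ ≤ r) {t u : ℝ} (ht : 0 < t) (hu : 0 < u) :
    boxCox r t + t ^ (r + θ) * ((t ^ (-θ) - u ^ (-θ)) / θ) ≤ boxCox r u := by
  have h1 := boxCox_neg_order_le hθ hr (div_pos hu ht)
  have h2 := boxCox_mul r ht (div_pos hu ht)
  rw [mul_div_cancel₀ _ ht.ne'] at h2
  rw [h2]
  have h3 : t ^ (r + θ) * ((t ^ (-θ) - u ^ (-θ)) / θ) = t ^ r * ((1 - (u / t) ^ (-θ)) / θ) := by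
    rw [Real.div_rpow hu.le ht.le, Real.rpow_add ht, Real.rpow_neg ht.le]
    have := Real.rpow_pos_of_pos ht θ
    field_simp
  rw [h3]
  have := mul_le_mul_of_nonneg_left h1 (Real.rpow_pos_of_pos ht r).le
  linarith

/-- Bound by a negative power on `(0, K]`. -/
lemma abs_boxCox_le {r θ K : ℝ} (hθ : 0 < θ) (hr : -θ ≤ r) {t : ℝ} (ht : 0 < t) (htK : t ≤ K) :
    |boxCox r t| ≤ (1 / θ + |boxCox r K| * K ^ θ) * t ^ (-θ) := by
  have hK : 0 < K := ht.trans_le htK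
  have hpos : 0 < t ^ (-θ) := Real.rpow_pos_of_pos ht _
  have h1 := boxCox_neg_order_le hθ hr ht
  have h2 := boxCox_mono r ht htK
  have h3 : 1 ≤ K ^ θ * t ^ (-θ) := by
    rw [Real.rpow_neg ht.le, ← div_eq_mul_inv, one_le_div (Real.rpow_pos_of_pos ht θ)]
    exact Real.rpow_le_rpow ht.le htK hθ.le
  have h4 : |boxCox r K| ≤ |boxCox r K| * (K ^ θ * t ^ (-θ)) :=
    le_mul_of_one_le_right (abs_nonneg _) h3
  have h5 : 0 ≤ 1 / θ * t ^ (-θ) := by positivity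
  have h6 : (1 - t ^ (-θ)) / θ = 1 / θ - 1 / θ * t ^ (-θ) := by ring
  have h7 : 0 < 1 / θ := by positivity
  have h8 := le_abs_self (boxCox r K)
  have h9 := abs_nonneg (boxCox r K)
  rw [abs_le]
  constructor <;> nlinarith

lemma abs_boxCox_le_of_pos {r K : ℝ} (hr : 0 < r) {t : ℝ} (ht : 0 < t) (htK : t ≤ K) :
    |boxCox r t| ≤ 1 / r + |boxCox r K| := by
  have h2 := boxCox_mono r ht htK
  have h1 : -(1 / r) ≤ boxCox r t := by
    rw [boxCox_of_ne hr.ne', ← neg_div]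
    have := Real.rpow_pos_of_pos ht r
    gcongr
    linarith
  have h7 : 0 < 1 / r := by positivity
  have h8 := le_abs_self (boxCox r K)
  have h9 := abs_nonneg (boxCox r K)
  rw [abs_le]
  constructor <;> linarith

/-! ### Norms, distances to finite sets and cubes -/

section Geometry

variable {d : ℕ} {N : Seminorm ℝ (Fin d → ℝ)}

lemma exists_norm_bounds (hN : ∀ x, N x = 0 → x = 0) :
    ∃ κ₁ κ₂ : ℝ, 0 < κ₁ ∧ 0 < κ₂ ∧ ∀ x, κ₁ * ‖x‖ ≤ N x ∧ N x ≤ κ₂ * ‖x‖ := by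
  set κ₂ : ℝ := ∑ i, N (Pi.single i 1) + 1 with hκ₂
  have hsum : 0 ≤ ∑ i, N (Pi.single i (1 : ℝ)) := Finset.sum_nonneg fun i _ => apply_nonneg N _
  have hκ₂pos : 0 < κ₂ := by positivity
  have hup : ∀ x, N x ≤ κ₂ * ‖x‖ := by
    intro x
    have hx : x = ∑ i, x i • (Pi.single i 1 : Fin d → ℝ) := by
      ext j; simp [Finset.sum_apply, Pi.single_apply]
    calc N x = N (∑ i, x i • (Pi.single i 1 : Fin d → ℝ)) := by rw [← hx]
      _ ≤ ∑ i, N (x i • (Pi.single i 1 : Fin d → ℝ)) :=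
          Finset.le_sum_of_subadditive N (map_zero N).le (map_add_le_add N) _ _
      _ ≤ ∑ i, N (Pi.single i (1 : ℝ)) * ‖x‖ := by
          refine Finset.sum_le_sum fun i _ => ?_
          rw [map_smul_eq_mul, mul_comm]
          exact mul_le_mul_of_nonneg_left (norm_le_pi_norm x i) (apply_nonneg N _)
      _ = (∑ i, N (Pi.single i (1 : ℝ))) * ‖x‖ := by rw [Finset.sum_mul]
      _ ≤ κ₂ * ‖x‖ := by
          apply mul_le_mul_of_nonneg_right _ (norm_nonneg _); linarith
  have hcont : Continuous N := by
    refine (LipschitzWith.of_dist_le_mul (K := κ₂.toNNReal) fun x y => ?_).continuous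
    rw [Real.dist_eq, dist_eq_norm, Real.coe_toNNReal _ hκ₂pos.le]
    exact (abs_sub_map_le_sub N x y).trans (hup _)
  rcases (Metric.sphere (0 : Fin d → ℝ) 1).eq_empty_or_nonempty with he | hne
  · refine ⟨1, κ₂, one_pos, hκ₂pos, fun x => ⟨?_, hup x⟩⟩
    have hx : x = 0 := by
      by_contra hx
      have : (‖x‖⁻¹ • x) ∈ Metric.sphere (0 : Fin d → ℝ) 1 := by
        simp [norm_smul, hx]
      rw [he] at this; exact this
    simp [hx]
  · obtain ⟨x₀, hx₀, hmin⟩ := (isCompact_sphere (0 : Fin d → ℝ) 1).exists_isMinOn hne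
      hcont.continuousOn
    have hx₀ne : x₀ ≠ 0 := by rintro rfl; simp at hx₀
    have hpos : 0 < N x₀ := lt_of_le_of_ne (apply_nonneg N _) fun h => hx₀ne (hN _ h.symm)
    refine ⟨N x₀, κ₂, hpos, hκ₂pos, fun x => ⟨?_, hup x⟩⟩
    by_cases hx : x = 0
    · simp [hx]
    have hmem : (‖x‖⁻¹ • x) ∈ Metric.sphere (0 : Fin d → ℝ) 1 := by
      simp [norm_smul, hx]
    have h1 : N x₀ ≤ N (‖x‖⁻¹ • x) := hmin hmem
    rw [map_smul_eq_mul, norm_inv, norm_norm, inv_mul_eq_div,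
      le_div_iff₀ (norm_pos_iff.2 hx)] at h1
    exact h1

lemma continuous_of_norm_bounds {κ₂ : ℝ} (hup : ∀ x, N x ≤ κ₂ * ‖x‖) : Continuous N := by
  refine (LipschitzWith.of_dist_le_mul (K := κ₂.toNNReal) fun x y => ?_).continuous
  rw [Real.dist_eq, dist_eq_norm]
  refine (abs_sub_map_le_sub N x y).trans ((hup _).trans ?_)
  exact mul_le_mul_of_nonneg_right (Real.le_coe_toNNReal _) (norm_nonneg _)

lemma continuous_of_definite (hN : ∀ x, N x = 0 → x = 0) : Continuous N := by
  obtain ⟨_, _, _, _, h⟩ := exists_norm_bounds hN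
  exact continuous_of_norm_bounds fun x => (h x).2

/-- The real-valued distance to a finite set; the value at the empty set is `0`. -/
noncomputable def finDist (N : Seminorm ℝ (Fin d → ℝ)) (A : Finset (Fin d → ℝ))
    (x : Fin d → ℝ) : ℝ :=
  (distToSet N x A).toReal

lemma distToSet_exists {A : Finset (Fin d → ℝ)} (hA : A.Nonempty) (x : Fin d → ℝ) :
    ∃ a ∈ A, distToSet N x A = ENNReal.ofReal (N (x - a)) := by
  obtain ⟨a, ha, hmin⟩ := A.exists_min_image (fun y => ENNReal.ofReal (N (x - y))) hA
  refine ⟨a, ha, le_antisymm (iInf₂_le a ha) (le_iInf₂ hmin)⟩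

lemma finDist_exists {A : Finset (Fin d → ℝ)} (hA : A.Nonempty) (x : Fin d → ℝ) :
    ∃ a ∈ A, finDist N A x = N (x - a) := by
  obtain ⟨a, ha, h⟩ := distToSet_exists (N := N) hA x
  exact ⟨a, ha, by rw [finDist, h, ENNReal.toReal_ofReal (apply_nonneg N _)]⟩

lemma ofReal_finDist {A : Finset (Fin d → ℝ)} (hA : A.Nonempty) (x : Fin d → ℝ) :
    ENNReal.ofReal (finDist N A x) = distToSet N x A := by
  obtain ⟨a, ha, h⟩ := distToSet_exists (N := N) hA x
  rw [finDist, h, ENNReal.toReal_ofReal (apply_nonneg N _)]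

lemma finDist_nonneg (A : Finset (Fin d → ℝ)) (x : Fin d → ℝ) : 0 ≤ finDist N A x :=
  ENNReal.toReal_nonneg

lemma finDist_le {A : Finset (Fin d → ℝ)} {a : Fin d → ℝ} (ha : a ∈ A) (x : Fin d → ℝ) :
    finDist N A x ≤ N (x - a) := by
  rw [finDist]
  refine ENNReal.toReal_le_of_le_ofReal (apply_nonneg N _) (iInf₂_le a ha)

lemma finDist_pos (hN : ∀ x, N x = 0 → x = 0) {A : Finset (Fin d → ℝ)} (hA : A.Nonempty)
    {x : Fin d → ℝ} (hx : x ∉ A) : 0 < finDist N A x := by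
  obtain ⟨a, ha, h⟩ := finDist_exists (N := N) hA x
  rw [h]
  refine lt_of_le_of_ne (apply_nonneg N _) fun h0 => hx ?_
  rw [sub_eq_zero.1 (hN _ h0.symm)]; exact ha

lemma finDist_anti {A B : Finset (Fin d → ℝ)} (hA : A.Nonempty) (h : A ⊆ B) (x : Fin d → ℝ) :
    finDist N B x ≤ finDist N A x := by
  obtain ⟨a, ha, h'⟩ := finDist_exists (N := N) hA x
  rw [h']; exact finDist_le (h ha) x

lemma measurable_finDist (hN : ∀ x, N x = 0 → x = 0) (A : Finset (Fin d → ℝ)) :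
    Measurable (finDist N A) := by
  refine Measurable.ennreal_toReal ?_
  refine Measurable.biInf (A : Set (Fin d → ℝ)) A.countable_toSet fun a _ => ?_
  exact ((continuous_of_definite hN).comp
    (continuous_id.sub continuous_const)).measurable.ennreal_ofReal

/-- The half-open cube `z + (0, ℓ]^d`. -/
def cell (z : Fin d → ℝ) (ℓ : ℝ) : Set (Fin d → ℝ) := {x | ∀ i, z i < x i ∧ x i ≤ z i + ℓ}

lemma cell_eq_pi (z : Fin d → ℝ) (ℓ : ℝ) :
    cell z ℓ = Set.univ.pi fun i => Set.Ioc (z i) (z i + ℓ) := by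
  ext x; simp [cell]

lemma mem_unitCube {x : Fin d → ℝ} : x ∈ unitCube d ↔ ∀ i, 0 < x i ∧ x i ≤ 1 := by
  simp [unitCube]

lemma measurableSet_cell (z : Fin d → ℝ) (ℓ : ℝ) : MeasurableSet (cell z ℓ) := by
  rw [cell_eq_pi]; exact MeasurableSet.univ_pi fun _ => measurableSet_Ioc

lemma measurableSet_unitCube : MeasurableSet (unitCube d) :=
  MeasurableSet.univ_pi fun _ => measurableSet_Ioc

lemma volume_cell (z : Fin d → ℝ) {ℓ : ℝ} (hℓ : 0 ≤ ℓ) :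
    volume.real (cell z ℓ) = ℓ ^ d := by
  rw [Measure.real, cell_eq_pi, volume_pi_pi]
  simp [hℓ]

lemma volume_unitCube : volume (unitCube d) = 1 := by
  simp [unitCube, volume_pi_pi]

instance isProbabilityMeasure_cubeMeasure : IsProbabilityMeasure (cubeMeasure d) :=
  ⟨by rw [cubeMeasure, Measure.restrict_apply_univ, volume_unitCube]⟩

lemma mem_cell_affine {z y : Fin d → ℝ} {ℓ : ℝ} (hℓ : 0 < ℓ) :
    z + ℓ • y ∈ cell z ℓ ↔ y ∈ unitCube d := by
  rw [mem_unitCube]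
  refine forall_congr' fun i => ?_
  simp only [Pi.add_apply, Pi.smul_apply, smul_eq_mul, lt_add_iff_pos_right, add_le_add_iff_left]
  rw [mul_pos_iff_of_pos_left hℓ, mul_le_iff_le_one_right hℓ]

/-- Change of variables from a cube to the unit cube. -/
lemma setIntegral_cell (f : (Fin d → ℝ) → ℝ) (z : Fin d → ℝ) {ℓ : ℝ} (hℓ : 0 < ℓ) :
    ∫ x in cell z ℓ, f x = ℓ ^ d * ∫ y, f (z + ℓ • y) ∂(cubeMeasure d) := by
  have h1 : ∫ y, f (z + ℓ • y) ∂(cubeMeasure d)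
      = ∫ y, (cell z ℓ).indicator f (z + ℓ • y) := by
    rw [cubeMeasure, ← integral_indicator measurableSet_unitCube]
    congr 1; ext y
    by_cases hy : y ∈ unitCube d
    · rw [Set.indicator_of_mem hy, Set.indicator_of_mem ((mem_cell_affine hℓ).2 hy)]
    · rw [Set.indicator_of_notMem hy, Set.indicator_of_notMem (mt (mem_cell_affine hℓ).1 hy)]
  rw [h1, Measure.integral_comp_smul volume (fun y => (cell z ℓ).indicator f (z + y)) ℓ,
    integral_add_left_eq_self (fun y => (cell z ℓ).indicator f y) z,
    integral_indicator (measurableSet_cell z ℓ)]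
  have : 0 < ℓ ^ d := by positivity
  simp only [Module.finrank_fintype_fun_eq_card, Fintype.card_fin, smul_eq_mul]
  rw [abs_of_pos (by positivity)]
  field_simp

/-- The lower corner of the grid cube with index `j` in the partition of the unit cube into `m ^ d`
cubes. -/
noncomputable def corner (m : ℕ) (j : Fin d → Fin m) : Fin d → ℝ := fun i => ((j i : ℕ) : ℝ) / m

lemma exists_mem_cell_corner {m : ℕ} {x : Fin d → ℝ} (hm : 0 < m) (hx : x ∈ unitCube d) :
    ∃ j : Fin d → Fin m, x ∈ cell (corner m j) (1 / m) := by
  have hm' : (0 : ℝ) < m := by exact_mod_cast hm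
  rw [mem_unitCube] at hx
  have hpos : ∀ i, 0 < ⌈(m : ℝ) * x i⌉₊ := fun i => Nat.ceil_pos.2 (mul_pos hm' (hx i).1)
  have hle : ∀ i, ⌈(m : ℝ) * x i⌉₊ ≤ m := fun i => by
    refine Nat.ceil_le.2 ?_
    exact mul_le_of_le_one_right hm'.le (hx i).2
  refine ⟨fun i => ⟨⌈(m : ℝ) * x i⌉₊ - 1, by have := hpos i; have := hle i; omega⟩, fun i => ?_⟩
  have hc : ((⌈(m : ℝ) * x i⌉₊ - 1 : ℕ) : ℝ) = (⌈(m : ℝ) * x i⌉₊ : ℝ) - 1 := by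
    rw [Nat.cast_sub (hpos i)]; simp
  simp only [corner, hc]
  rw [← add_div, sub_add_cancel, div_lt_iff₀ hm', le_div_iff₀ hm']
  have h1 := Nat.ceil_lt_add_one (mul_pos hm' (hx i).1).le
  have h2 := Nat.le_ceil ((m : ℝ) * x i)
  constructor <;> nlinarith

lemma cell_corner_subset {m : ℕ} (j : Fin d → Fin m) :
    cell (corner m j) (1 / m) ⊆ unitCube d := by
  intro x hx
  rw [mem_unitCube]
  intro i
  have hm : 0 < m := (j i).pos
  have hm' : (0 : ℝ) < m := by exact_mod_cast hm
  have hj : ((j i : ℕ) : ℝ) + 1 ≤ m := by exact_mod_cast (j i).2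
  obtain ⟨h1, h2⟩ := hx i
  simp only [corner] at h1 h2
  refine ⟨lt_of_le_of_lt (by positivity) h1, h2.trans ?_⟩
  rw [← add_div]
  exact (div_le_one hm').2 hj

lemma cell_corner_index_unique {m : ℕ} {j j' : Fin d → Fin m} {x : Fin d → ℝ}
    (h : x ∈ cell (corner m j) (1 / m)) (h' : x ∈ cell (corner m j') (1 / m)) : j = j' := by
  ext i
  have hm' : (0 : ℝ) < m := by exact_mod_cast (j i).pos
  obtain ⟨h1, h2⟩ := h i
  obtain ⟨h3, h4⟩ := h' i
  simp only [corner] at h1 h2 h3 h4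
  rw [← add_div] at h2 h4
  have h5 := h1.trans_le h4
  have h6 := h3.trans_le h2
  rw [div_lt_div_iff_of_pos_right hm'] at h5 h6
  have h7 : ((j i : ℕ)) < (j' i : ℕ) + 1 := by exact_mod_cast h5
  have h8 : ((j' i : ℕ)) < (j i : ℕ) + 1 := by exact_mod_cast h6
  omega

lemma pairwise_disjoint_cell_corner (m : ℕ) :
    Pairwise (Function.onFun Disjoint fun j : Fin d → Fin m => cell (corner m j) (1 / m)) := by
  intro j j' hne
  exact Set.disjoint_left.2 fun x h h' => hne (cell_corner_index_unique h h')

lemma iUnion_cell_corner {m : ℕ} (hm : 0 < m) :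
    ⋃ j : Fin d → Fin m, cell (corner m j) (1 / m) = unitCube d := by
  refine Set.Subset.antisymm (Set.iUnion_subset fun j => cell_corner_subset j) fun x hx => ?_
  exact Set.mem_iUnion.2 (exists_mem_cell_corner hm hx)

lemma integral_cube_eq_sum {m : ℕ} (hm : 0 < m) {f : (Fin d → ℝ) → ℝ}
    (hf : Integrable f (cubeMeasure d)) :
    ∫ x, f x ∂(cubeMeasure d) = ∑ j : Fin d → Fin m, ∫ x in cell (corner m j) (1 / m), f x := by
  rw [cubeMeasure, ← iUnion_cell_corner hm]
  refine integral_iUnion_fintype (fun j => measurableSet_cell _ _)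
    (pairwise_disjoint_cell_corner m) fun j => ?_
  exact IntegrableOn.mono_set (t := unitCube d) hf (cell_corner_subset j)

/-- The corners of the grid cubes. -/
noncomputable def gridPoints (d m : ℕ) : Finset (Fin d → ℝ) :=
  Finset.univ.image (corner (d := d) m)

lemma card_gridPoints_le (m : ℕ) : (gridPoints d m).card ≤ m ^ d := by
  refine Finset.card_image_le.trans ?_
  simp

lemma gridPoints_nonempty {m : ℕ} (hm : 0 < m) : (gridPoints d m).Nonempty :=
  ⟨corner m fun _ => ⟨0, hm⟩, Finset.mem_image_of_mem _ (Finset.mem_univ _)⟩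

lemma finDist_gridPoints_le {κ₂ : ℝ} (hκ₂ : 0 ≤ κ₂) (hup : ∀ x, N x ≤ κ₂ * ‖x‖) {m : ℕ}
    (hm : 0 < m) {x : Fin d → ℝ} (hx : x ∈ unitCube d) :
    finDist N (gridPoints d m) x ≤ κ₂ / m := by
  obtain ⟨j, hj⟩ := exists_mem_cell_corner hm hx
  refine (finDist_le (Finset.mem_image_of_mem _ (Finset.mem_univ j)) x).trans ((hup _).trans ?_)
  rw [div_eq_mul_one_div]
  refine mul_le_mul_of_nonneg_left ?_ hκ₂
  refine (pi_norm_le_iff_of_nonneg (by positivity)).2 fun i => ?_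
  obtain ⟨h1, h2⟩ := hj i
  rw [Pi.sub_apply, Real.norm_eq_abs, abs_le]
  constructor <;> linarith

end Geometry

/-! ### Negative moments of the distance -/

section NegativeMoments

variable {d : ℕ} {N : Seminorm ℝ (Fin d → ℝ)}

lemma ae_notMem_finset (hd : 1 ≤ d) (A : Finset (Fin d → ℝ)) :
    ∀ᵐ x ∂(cubeMeasure d), x ∉ A := by
  have : Nonempty (Fin d) := ⟨⟨0, hd⟩⟩
  refine ae_restrict_of_ae ?_
  have : volume (A : Set (Fin d → ℝ)) = 0 := A.finite_toSet.measure_zero _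
  exact measure_eq_zero_iff_ae_notMem.1 this

/-- The singularity `N y ^ (-θ)`, cut off outside the unit ball of `N`. -/
noncomputable def cutoffPower (N : Seminorm ℝ (Fin d → ℝ)) (θ : ℝ) (y : Fin d → ℝ) : ℝ :=
  {y | N y < 1}.indicator (fun y => N y ^ (-θ)) y

lemma cutoffPower_nonneg (θ : ℝ) (y : Fin d → ℝ) : 0 ≤ cutoffPower N θ y :=
  Set.indicator_nonneg (fun _ _ => Real.rpow_nonneg (apply_nonneg N _) _) _

lemma integrable_cutoffPower (hd : 1 ≤ d) (hN : ∀ x, N x = 0 → x = 0) {θ : ℝ} (hθ : 0 < θ)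
    (hθd : θ < d) : Integrable (cutoffPower N θ) volume := by
  obtain ⟨κ₁, κ₂, h1, h2, hb⟩ := exists_norm_bounds hN
  have hc := continuous_of_definite hN
  have hms : MeasurableSet {y | N y < 1} := measurableSet_lt hc.measurable measurable_const
  have hmeas : Measurable fun y => N y ^ (-θ) := hc.measurable.pow_const _
  have hloc : IntegrableOn (fun y => N y ^ (-θ)) (Metric.ball 0 (1 / κ₁)) volume := by
    refine integrableOn_ball_of_norm_le_rpow (C := κ₁ ^ (-θ)) (α := θ) (by simpa using hd)
      (by simpa using hθd) (ae_of_all _ fun x => ?_) hmeas.aestronglyMeasurable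
    rw [Real.norm_of_nonneg (Real.rpow_nonneg (apply_nonneg N _) _)]
    rcases eq_or_ne x 0 with rfl | hx
    · simp [Real.zero_rpow (neg_ne_zero.2 hθ.ne')]
    rw [← Real.mul_rpow h1.le (norm_nonneg _)]
    exact Real.rpow_le_rpow_of_nonpos (mul_pos h1 (norm_pos_iff.2 hx)) (hb x).1 (by linarith)
  have : IntegrableOn (fun y => N y ^ (-θ)) {y | N y < 1} volume := by
    refine hloc.mono_set fun y hy => ?_
    rw [mem_ball_zero_iff, lt_div_iff₀ h1, mul_comm]
    exact (hb y).1.trans_lt hy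
  exact (integrable_indicator_iff hms).2 this

/-- A set of `n` points cannot be much closer than `n ^ (-1/d)` to a typical point: the
negative moments of order less than `d` of the rescaled distance are bounded, uniformly in the
finite set. The power of the distance is at most `1` plus the sum of the singularities at the
points of the set. -/
lemma exists_negMoment_bound (hd : 1 ≤ d) (hN : ∀ x, N x = 0 → x = 0) {θ : ℝ} (hθ : 0 < θ)
    (hθd : θ < d) {R : ℝ} (hR : 0 < R) :
    ∃ K : ℝ, 0 ≤ K ∧ ∀ T : ℝ, 0 < T → ∀ A : Finset (Fin d → ℝ), A.Nonempty →
      (A.card : ℝ) ≤ R * T →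
      Integrable (fun x => (T ^ (1 / d : ℝ) * finDist N A x) ^ (-θ)) (cubeMeasure d) ∧
      ∫ x, (T ^ (1 / d : ℝ) * finDist N A x) ^ (-θ) ∂(cubeMeasure d) ≤ K := by
  have hI := integrable_cutoffPower hd hN hθ hθd
  set I := ∫ y, cutoffPower N θ y with hIdef
  have hI0 : 0 ≤ I := integral_nonneg fun y => cutoffPower_nonneg θ y
  refine ⟨1 + R * I, by positivity, fun T hT A hA hcard => ?_⟩
  set lam := T ^ (1 / d : ℝ) with hlam
  have hlam0 : 0 < lam := Real.rpow_pos_of_pos hT _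
  have hd' : (d : ℝ) ≠ 0 := by positivity
  have hlamd : lam ^ d = T := by
    rw [hlam, ← Real.rpow_natCast, ← Real.rpow_mul hT.le, one_div_mul_cancel hd', Real.rpow_one]
  have hterm : ∀ a : Fin d → ℝ, Integrable (fun x => cutoffPower N θ (lam • (x - a))) volume := by
    intro a
    exact ((integrable_comp_smul_iff volume (cutoffPower N θ) hlam0.ne').2 hI).comp_sub_right a
  have hval : ∀ a : Fin d → ℝ, ∫ x, cutoffPower N θ (lam • (x - a)) = I / T := by
    intro a
    rw [integral_sub_right_eq_self (fun x => cutoffPower N θ (lam • x)) a,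
      Measure.integral_comp_smul]
    simp only [Module.finrank_fintype_fun_eq_card, Fintype.card_fin, smul_eq_mul, hlamd]
    rw [abs_of_pos (by positivity), ← hIdef]
    field_simp
  have hpt : ∀ x, (lam * finDist N A x) ^ (-θ) ≤
      1 + ∑ a ∈ A, cutoffPower N θ (lam • (x - a)) := by
    intro x
    obtain ⟨a, ha, hax⟩ := finDist_exists (N := N) hA x
    have hNl : lam * finDist N A x = N (lam • (x - a)) := by
      rw [hax, map_smul_eq_mul, Real.norm_of_nonneg hlam0.le]
    have hsum : cutoffPower N θ (lam • (x - a)) ≤ ∑ a ∈ A, cutoffPower N θ (lam • (x - a)) :=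
      Finset.single_le_sum (f := fun a => cutoffPower N θ (lam • (x - a)))
        (fun b _ => cutoffPower_nonneg θ _) ha
    rw [hNl]
    rcases lt_or_ge (N (lam • (x - a))) 1 with hlt | hge
    · have : cutoffPower N θ (lam • (x - a)) = N (lam • (x - a)) ^ (-θ) :=
        Set.indicator_of_mem (s := {y | N y < 1}) hlt _
      linarith
    · have h1 := Real.rpow_le_one_of_one_le_of_nonpos hge (show -θ ≤ 0 by linarith)
      have h2 := cutoffPower_nonneg (N := N) θ (lam • (x - a))
      linarith
  have hnn : ∀ x, 0 ≤ (lam * finDist N A x) ^ (-θ) := fun x =>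
    Real.rpow_nonneg (mul_nonneg hlam0.le (finDist_nonneg A x)) _
  have hmeas : Measurable fun x => (lam * finDist N A x) ^ (-θ) :=
    ((measurable_finDist hN A).const_mul lam).pow_const _
  have hsumint : Integrable (fun x => ∑ a ∈ A, cutoffPower N θ (lam • (x - a))) volume :=
    integrable_finsetSum _ fun a _ => hterm a
  have hsumint' : Integrable (fun x => ∑ a ∈ A, cutoffPower N θ (lam • (x - a)))
      (cubeMeasure d) := hsumint.restrict
  have hmaj : Integrable (fun x => 1 + ∑ a ∈ A, cutoffPower N θ (lam • (x - a)))
      (cubeMeasure d) := (integrable_const 1).add hsumint'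
  have hint : Integrable (fun x => (lam * finDist N A x) ^ (-θ)) (cubeMeasure d) := by
    refine hmaj.mono' hmeas.aestronglyMeasurable (ae_of_all _ fun x => ?_)
    rw [Real.norm_of_nonneg (hnn x)]; exact hpt x
  refine ⟨hint, ?_⟩
  calc ∫ x, (lam * finDist N A x) ^ (-θ) ∂(cubeMeasure d)
      ≤ ∫ x, (1 + ∑ a ∈ A, cutoffPower N θ (lam • (x - a))) ∂(cubeMeasure d) :=
        integral_mono hint hmaj hpt
    _ = 1 + ∫ x, ∑ a ∈ A, cutoffPower N θ (lam • (x - a)) ∂(cubeMeasure d) := by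
        rw [integral_add (integrable_const 1) hsumint']; simp
    _ ≤ 1 + ∫ x, ∑ a ∈ A, cutoffPower N θ (lam • (x - a)) := by
        refine add_le_add_right ?_ 1
        exact setIntegral_le_integral hsumint
          (ae_of_all _ fun x => Finset.sum_nonneg fun a _ => cutoffPower_nonneg θ _)
    _ = 1 + A.card * (I / T) := by
        rw [integral_finsetSum _ fun a _ => hterm a]; simp [hval]
    _ ≤ 1 + R * I := by
        have h3 : A.card * (I / T) ≤ (R * T) * (I / T) := by gcongr
        have h4 : (R * T) * (I / T) = R * I := by field_simp
        linarith

lemma scaled_finDist_pos (hN : ∀ x, N x = 0 → x = 0) {lam : ℝ} (hlam : 0 < lam)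
    {A : Finset (Fin d → ℝ)} (hA : A.Nonempty) {x : Fin d → ℝ} (hx : x ∉ A) :
    0 < lam * finDist N A x :=
  mul_pos hlam (finDist_pos hN hA hx)

/-- Uniform Hölder bound for the integral of a weight `g` against the transformed rescaled
distance. It makes the normalized costs equicontinuous with respect to the density. -/
lemma exists_weighted_boxCox_bound (hd : 1 ≤ d) (hN : ∀ x, N x = 0 → x = 0) {r p : ℝ}
    (hr : -(d : ℝ) < r) (hpr : (0 < r ∧ p = 1) ∨ (1 < p ∧ d / (d + r) < p)) {K R : ℝ}
    (hR : 0 < R) :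
    ∃ B : ℝ, 0 ≤ B ∧ ∀ T : ℝ, 0 < T → ∀ A : Finset (Fin d → ℝ), A.Nonempty →
      (A.card : ℝ) ≤ R * T → (∀ x ∈ unitCube d, T ^ (1 / d : ℝ) * finDist N A x ≤ K) →
      ∀ g : (Fin d → ℝ) → ℝ, Measurable g → (∀ x, 0 ≤ g x) →
        Integrable (fun x => g x ^ p) (cubeMeasure d) →
        Integrable (fun x => g x * boxCox r (T ^ (1 / d : ℝ) * finDist N A x)) (cubeMeasure d) ∧
        ∫ x, g x * |boxCox r (T ^ (1 / d : ℝ) * finDist N A x)| ∂(cubeMeasure d)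
          ≤ B * (∫ x, g x ^ p ∂(cubeMeasure d)) ^ (1 / p) := by
  have hcube : ∀ᵐ x ∂(cubeMeasure d), x ∈ unitCube d :=
    ae_restrict_mem measurableSet_unitCube
  rcases hpr with ⟨hr0, rfl⟩ | ⟨hp1, hpd⟩
  · refine ⟨1 / r + |boxCox r K|, by positivity, fun T hT A hA _ hK g hg hg0 hgi => ?_⟩
    simp only [Real.rpow_one, div_one] at hgi ⊢
    have hlam0 : 0 < T ^ (1 / d : ℝ) := Real.rpow_pos_of_pos hT _
    set u : (Fin d → ℝ) → ℝ := fun x => T ^ (1 / d : ℝ) * finDist N A x with hu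
    have hum : Measurable fun x => boxCox r (u x) :=
      (measurable_boxCox r).comp ((measurable_finDist hN A).const_mul _)
    have hae : ∀ᵐ x ∂(cubeMeasure d), |boxCox r (u x)| ≤ 1 / r + |boxCox r K| := by
      filter_upwards [hcube, ae_notMem_finset hd A] with x hx hxA
      exact abs_boxCox_le_of_pos hr0 (scaled_finDist_pos hN hlam0 hA hxA) (hK x hx)
    have hint : Integrable (fun x => g x * boxCox r (u x)) (cubeMeasure d) := by
      refine hgi.mul_bdd (c := 1 / r + |boxCox r K|) hum.aestronglyMeasurable ?_
      filter_upwards [hae] with x hx using hx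
    refine ⟨hint, ?_⟩
    rw [← integral_const_mul]
    refine integral_mono_ae ?_ (hgi.const_mul _) ?_
    · refine hint.abs.congr (ae_of_all _ fun x => ?_)
      simp only [abs_mul, abs_of_nonneg (hg0 x), hu]
    · filter_upwards [hae] with x hx
      rw [mul_comm]
      exact mul_le_mul_of_nonneg_right hx (hg0 x)
  · have hdpos : (0 : ℝ) < d := by exact_mod_cast hd
    have hdr : 0 < d + r := by linarith
    have hpq : p.HolderConjugate (Real.conjExponent p) := Real.HolderConjugate.conjExponent hp1
    set q := Real.conjExponent p with hq
    have hq0 : 0 < q := hpq.symm.pos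
    have hp0 : 0 < p := hpq.pos
    -- any `θ ≥ -r` with `θ q < d` works; the second entry only makes `θ` positive
    set θ := max (-r) (d / (2 * q)) with hθ
    have hθ0 : 0 < θ := lt_max_of_lt_right (by positivity)
    have hθr : -θ ≤ r := by have := le_max_left (-r) (d / (2 * q)); linarith
    have hθq : θ * q < d := by
      rw [← lt_div_iff₀ hq0]
      refine max_lt ?_ ?_
      · rw [lt_div_iff₀ hq0, hq, Real.conjExponent, mul_div_assoc', div_lt_iff₀ (by linarith)]
        rw [div_lt_iff₀ hdr] at hpd
        nlinarith
      · rw [div_lt_div_iff₀ (by positivity) hq0]; nlinarith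
    obtain ⟨K', hK'0, hK'⟩ := exists_negMoment_bound (N := N) hd hN (mul_pos hθ0 hq0) hθq hR
    set C := 1 / θ + |boxCox r K| * K ^ θ with hC
    refine ⟨(|C| ^ q * K') ^ (1 / q), by positivity, fun T hT A hA hcard hK g hg hg0 hgi => ?_⟩
    have hlam0 : 0 < T ^ (1 / d : ℝ) := Real.rpow_pos_of_pos hT _
    obtain ⟨hmi, hmb⟩ := hK' T hT A hA hcard
    set u : (Fin d → ℝ) → ℝ := fun x => T ^ (1 / d : ℝ) * finDist N A x with hu
    have hum : Measurable fun x => boxCox r (u x) :=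
      (measurable_boxCox r).comp ((measurable_finDist hN A).const_mul _)
    have hae : ∀ᵐ x ∂(cubeMeasure d), |boxCox r (u x)| ^ q ≤ |C| ^ q * u x ^ (-(θ * q)) := by
      filter_upwards [hcube, ae_notMem_finset hd A] with x hx hxA
      have hupos : 0 < u x := scaled_finDist_pos hN hlam0 hA hxA
      have h1 := abs_boxCox_le hθ0 hθr hupos (hK x hx)
      have h2 : |boxCox r (u x)| ≤ |C| * u x ^ (-θ) :=
        h1.trans (mul_le_mul_of_nonneg_right (le_abs_self C) (Real.rpow_nonneg hupos.le _))
      calc |boxCox r (u x)| ^ q ≤ (|C| * u x ^ (-θ)) ^ q :=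
            Real.rpow_le_rpow (abs_nonneg _) h2 hq0.le
        _ = |C| ^ q * u x ^ (-(θ * q)) := by
            rw [Real.mul_rpow (abs_nonneg _) (Real.rpow_nonneg hupos.le _),
              ← Real.rpow_mul hupos.le, neg_mul]
    have hqi : Integrable (fun x => |boxCox r (u x)| ^ q) (cubeMeasure d) := by
      refine (hmi.const_mul (|C| ^ q)).mono' (hum.abs.pow_const q).aestronglyMeasurable ?_
      filter_upwards [hae] with x hx
      rw [Real.norm_of_nonneg (Real.rpow_nonneg (abs_nonneg _) _)]; exact hx
    have hqb : ∫ x, |boxCox r (u x)| ^ q ∂(cubeMeasure d) ≤ |C| ^ q * K' := by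
      calc _ ≤ ∫ x, |C| ^ q * u x ^ (-(θ * q)) ∂(cubeMeasure d) :=
            integral_mono_ae hqi (hmi.const_mul _) hae
        _ = |C| ^ q * ∫ x, u x ^ (-(θ * q)) ∂(cubeMeasure d) := integral_const_mul _ _
        _ ≤ |C| ^ q * K' := by gcongr
    have hgL : MemLp g (ENNReal.ofReal p) (cubeMeasure d) := by
      refine (integrable_norm_rpow_iff hg.aestronglyMeasurable (by simpa using hp0) (by simp)).1 ?_
      refine hgi.congr (ae_of_all _ fun x => ?_)
      simp only [ENNReal.toReal_ofReal hp0.le, Real.norm_of_nonneg (hg0 x)]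
    have hφL : MemLp (fun x => boxCox r (u x)) (ENNReal.ofReal q) (cubeMeasure d) := by
      refine (integrable_norm_rpow_iff hum.aestronglyMeasurable (by simpa using hq0) (by simp)).1 ?_
      simpa only [ENNReal.toReal_ofReal hq0.le, Real.norm_eq_abs] using hqi
    have : (ENNReal.ofReal p).HolderConjugate (ENNReal.ofReal q) := hpq.ennrealOfReal
    refine ⟨hgL.integrable_mul hφL, ?_⟩
    have h3 := integral_mul_le_Lp_mul_Lq_of_nonneg hpq (ae_of_all _ hg0)
      (ae_of_all _ fun x => abs_nonneg (boxCox r (u x))) hgL hφL.abs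
    refine h3.trans ?_
    rw [mul_comm]
    have h4 : 0 ≤ ∫ x, g x ^ p ∂(cubeMeasure d) :=
      integral_nonneg fun x => Real.rpow_nonneg (hg0 x) _
    have h5 : 0 ≤ ∫ x, |boxCox r (u x)| ^ q ∂(cubeMeasure d) :=
      integral_nonneg fun x => Real.rpow_nonneg (abs_nonneg _) _
    refine mul_le_mul_of_nonneg_right ?_ (Real.rpow_nonneg h4 _)
    exact Real.rpow_le_rpow h5 hqb (by positivity)

end NegativeMoments

/-! ### The coefficient of the unit cube -/

section UnitCoefficient

variable {d : ℕ} {N : Seminorm ℝ (Fin d → ℝ)}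

lemma exists_finDist_le_on_unitCube (hN : ∀ x, N x = 0 → x = 0) {A : Finset (Fin d → ℝ)}
    (hA : A.Nonempty) : ∃ K : ℝ, 0 < K ∧ ∀ x ∈ unitCube d, finDist N A x ≤ K := by
  obtain ⟨a, ha⟩ := hA
  obtain ⟨κ₁, κ₂, h1, h2, hb⟩ := exists_norm_bounds hN
  refine ⟨κ₂ * (1 + ‖a‖), by positivity, fun x hx => ?_⟩
  refine (finDist_le ha x).trans ((hb _).2.trans (mul_le_mul_of_nonneg_left ?_ h2.le))
  refine (norm_sub_le _ _).trans (add_le_add_left ?_ _)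
  refine (pi_norm_le_iff_of_nonneg zero_le_one).2 fun i => ?_
  rw [mem_unitCube] at hx
  rw [Real.norm_of_nonneg (hx i).1.le]
  exact (hx i).2

lemma integrable_mul_boxCox_finDist (hd : 1 ≤ d) (hN : ∀ x, N x = 0 → x = 0) {r p : ℝ}
    (hr : -(d : ℝ) < r) (hpr : (0 < r ∧ p = 1) ∨ (1 < p ∧ d / (d + r) < p))
    {A : Finset (Fin d → ℝ)} (hA : A.Nonempty) {lam : ℝ} (hlam : 0 < lam)
    {g : (Fin d → ℝ) → ℝ} (hg : Measurable g) (hg0 : ∀ x, 0 ≤ g x)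
    (hgi : Integrable (fun x => g x ^ p) (cubeMeasure d)) :
    Integrable (fun x => g x * boxCox r (lam * finDist N A x)) (cubeMeasure d) := by
  obtain ⟨K, hK0, hK⟩ := exists_finDist_le_on_unitCube hN hA
  have hT : 0 < lam ^ d := by positivity
  have hcard : (0 : ℝ) < A.card := by exact_mod_cast hA.card_pos
  have hlamd : (lam ^ d) ^ (1 / d : ℝ) = lam := by
    rw [one_div, Real.pow_rpow_inv_natCast hlam.le (by omega)]
  obtain ⟨B, -, hB⟩ := exists_weighted_boxCox_bound (N := N) hd hN hr hpr (K := lam * K)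
    (R := A.card / lam ^ d) (by positivity)
  have := (hB (lam ^ d) hT A hA (by rw [div_mul_cancel₀ _ hT.ne']) (fun x hx => by
    rw [hlamd]; exact mul_le_mul_of_nonneg_left (hK x hx) hlam.le) g hg hg0 hgi).1
  rwa [hlamd] at this

/-- An exponent that is admissible for bounded densities. -/
lemma exists_exponent (d : ℕ) (r : ℝ) :
    ∃ p : ℝ, 1 < p ∧ d / (d + r) < p := by
  refine ⟨max 1 (d / (d + r)) + 1, ?_, ?_⟩
  · have := le_max_left (1 : ℝ) (d / (d + r)); linarith
  · have := le_max_right (1 : ℝ) (d / (d + r)); linarith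

lemma integrable_boxCox_finDist (hd : 1 ≤ d) (hN : ∀ x, N x = 0 → x = 0) {r : ℝ}
    (hr : -(d : ℝ) < r) {A : Finset (Fin d → ℝ)} (hA : A.Nonempty) {lam : ℝ} (hlam : 0 < lam) :
    Integrable (fun x => boxCox r (lam * finDist N A x)) (cubeMeasure d) := by
  obtain ⟨p, hp⟩ := exists_exponent d r
  have := integrable_mul_boxCox_finDist (N := N) hd hN hr (Or.inr hp) hA hlam (g := fun _ => 1)
    measurable_const (fun _ => zero_le_one) (by simp)
  simpa using this

lemma integral_mul_boxCox_scale (hd : 1 ≤ d) (hN : ∀ x, N x = 0 → x = 0) {r : ℝ}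
    {A : Finset (Fin d → ℝ)} (hA : A.Nonempty) {lam a : ℝ} (hlam : 0 < lam) (ha : 0 < a)
    {g : (Fin d → ℝ) → ℝ} (hgi : Integrable g (cubeMeasure d))
    (hgφ : Integrable (fun x => g x * boxCox r (lam * finDist N A x)) (cubeMeasure d)) :
    ∫ x, g x * boxCox r (a * lam * finDist N A x) ∂(cubeMeasure d)
      = a ^ r * ∫ x, g x * boxCox r (lam * finDist N A x) ∂(cubeMeasure d)
        + boxCox r a * ∫ x, g x ∂(cubeMeasure d) := by
  rw [← integral_const_mul, ← integral_const_mul, ← integral_add (hgφ.const_mul _)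
    (hgi.const_mul _)]
  refine integral_congr_ae ?_
  filter_upwards [ae_notMem_finset hd A] with x hx
  rw [mul_assoc, boxCox_mul r ha (scaled_finDist_pos hN hlam hA hx)]
  ring

lemma integral_boxCox_scale (hd : 1 ≤ d) (hN : ∀ x, N x = 0 → x = 0) {r : ℝ}
    (hr : -(d : ℝ) < r) {A : Finset (Fin d → ℝ)} (hA : A.Nonempty) {lam a : ℝ} (hlam : 0 < lam)
    (ha : 0 < a) :
    ∫ x, boxCox r (a * lam * finDist N A x) ∂(cubeMeasure d)
      = a ^ r * ∫ x, boxCox r (lam * finDist N A x) ∂(cubeMeasure d) + boxCox r a := by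
  have := integral_mul_boxCox_scale (N := N) (r := r) hd hN hA hlam ha (g := fun _ => 1)
    (integrable_const 1) (by simpa using integrable_boxCox_finDist hd hN hr hA hlam)
  simpa using this

lemma finDist_affine (A : Finset (Fin d → ℝ)) (hA : A.Nonempty) (z y : Fin d → ℝ) {ℓ : ℝ}
    (hℓ : 0 < ℓ) :
    finDist N A (z + ℓ • y) = ℓ * finDist N (A.image fun x => ℓ⁻¹ • (x - z)) y := by
  have key : ∀ a, N (z + ℓ • y - a) = ℓ * N (y - ℓ⁻¹ • (a - z)) := by
    intro a
    have : z + ℓ • y - a = ℓ • (y - ℓ⁻¹ • (a - z)) := by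
      rw [smul_sub, smul_smul, mul_inv_cancel₀ hℓ.ne', one_smul]; abel
    rw [this, map_smul_eq_mul, Real.norm_of_nonneg hℓ.le]
  apply le_antisymm
  · obtain ⟨b, hb, hb'⟩ := finDist_exists (N := N) (hA.image fun x => ℓ⁻¹ • (x - z)) y
    obtain ⟨a, ha, rfl⟩ := Finset.mem_image.1 hb
    rw [hb', ← key]
    exact finDist_le ha _
  · obtain ⟨a, ha, ha'⟩ := finDist_exists (N := N) hA (z + ℓ • y)
    rw [ha', key]
    exact mul_le_mul_of_nonneg_left (finDist_le (Finset.mem_image_of_mem _ ha) _) hℓ.le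

lemma setIntegral_cell_boxCox (r : ℝ) {B : Finset (Fin d → ℝ)} (hB : B.Nonempty)
    (z : Fin d → ℝ) {ℓ : ℝ} (hℓ : 0 < ℓ) (lam : ℝ) :
    ∫ x in cell z ℓ, boxCox r (lam * finDist N B x) =
      ℓ ^ d * ∫ y, boxCox r (lam * ℓ * finDist N (B.image fun x => ℓ⁻¹ • (x - z)) y)
        ∂(cubeMeasure d) := by
  rw [setIntegral_cell _ z hℓ]
  simp_rw [finDist_affine B hB z _ hℓ, mul_assoc]

/-- The cost of a cube is at most that of a scaled copy of any set of points for the unit cube. -/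
lemma setIntegral_cell_le (hd : 1 ≤ d) (hN : ∀ x, N x = 0 → x = 0) {r : ℝ}
    (hr : -(d : ℝ) < r) {A B : Finset (Fin d → ℝ)} (hA : A.Nonempty) (z : Fin d → ℝ) {ℓ lam : ℝ}
    (hℓ : 0 < ℓ) (hlam : 0 < lam) (hAB : (A.image fun y => z + ℓ • y) ⊆ B) :
    ∫ x in cell z ℓ, boxCox r (lam * finDist N B x) ≤
      ℓ ^ d * ∫ y, boxCox r (lam * ℓ * finDist N A y) ∂(cubeMeasure d) := by
  have hB : B.Nonempty := (hA.image _).mono hAB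
  rw [setIntegral_cell_boxCox r hB z hℓ]
  have hB' := hB.image fun x => ℓ⁻¹ • (x - z)
  have hlℓ : 0 < lam * ℓ := mul_pos hlam hℓ
  refine mul_le_mul_of_nonneg_left ?_ (by positivity)
  refine integral_mono_ae (integrable_boxCox_finDist hd hN hr hB' hlℓ)
    (integrable_boxCox_finDist hd hN hr hA hlℓ) ?_
  filter_upwards [ae_notMem_finset hd (B.image fun x => ℓ⁻¹ • (x - z))] with y hy
  refine boxCox_mono r (scaled_finDist_pos hN hlℓ hB' hy) ?_
  refine mul_le_mul_of_nonneg_left (finDist_anti hA ?_ y) hlℓ.le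
  intro a ha
  refine Finset.mem_image.2 ⟨z + ℓ • a, hAB (Finset.mem_image_of_mem _ ha), ?_⟩
  rw [add_sub_cancel_left, smul_smul, inv_mul_cancel₀ hℓ.ne', one_smul]

/-- The levels `t` such that `t * n ^ (-1/d)` is a lower bound for all quantization errors of the
unit cube. -/
def unitLevels (N : Seminorm ℝ (Fin d → ℝ)) (r : ℝ) : Set ℝ :=
  {t | 0 < t ∧ ∀ A : Finset (Fin d → ℝ), A.Nonempty →
    boxCox r (t * (A.card : ℝ) ^ (-(1 / d : ℝ))) ≤
      ∫ x, boxCox r (finDist N A x) ∂(cubeMeasure d)}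

/-- The quantization coefficient of order `r` of the unit cube. By self-similarity of the cube it is
the infimum of `n ^ (1/d)` times the `n`-th quantization error, so it can be defined as the largest
of the levels. -/
noncomputable def unitCoeff (N : Seminorm ℝ (Fin d → ℝ)) (r : ℝ) : ℝ :=
  sSup (unitLevels N r)

lemma unitLevels_nonempty (hd : 1 ≤ d) (hN : ∀ x, N x = 0 → x = 0) {r : ℝ}
    (hr : -(d : ℝ) < r) : (unitLevels N r).Nonempty := by
  have hdpos : (0 : ℝ) < d := by exact_mod_cast hd
  set θ := max (-r) (d / 2 : ℝ) with hθ
  have hθ0 : 0 < θ := lt_max_of_lt_right (by positivity)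
  have hθr : -θ ≤ r := by have := le_max_left (-r) (d / 2 : ℝ); linarith
  have hθd : θ < d := max_lt (by linarith) (by linarith)
  obtain ⟨K, hK0, hK⟩ := exists_negMoment_bound (N := N) hd hN hθ0 hθd one_pos
  have hM : 0 < max K 1 := lt_max_of_lt_right one_pos
  set t := (max K 1) ^ (-(1 / θ)) with ht
  have ht0 : 0 < t := Real.rpow_pos_of_pos hM _
  have htθ : t ^ (-θ) = max K 1 := by
    rw [ht, ← Real.rpow_mul hM.le]
    have : -(1 / θ) * -θ = 1 := by field_simp
    rw [this, Real.rpow_one]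
  refine ⟨t, ht0, fun A hA => ?_⟩
  have hk : (0 : ℝ) < A.card := by exact_mod_cast hA.card_pos
  obtain ⟨hi, hb⟩ := hK A.card hk A hA (by simp)
  set lam := (A.card : ℝ) ^ (1 / d : ℝ) with hlam
  have hlam0 : 0 < lam := Real.rpow_pos_of_pos hk _
  have hinv : (A.card : ℝ) ^ (-(1 / d : ℝ)) = lam⁻¹ := Real.rpow_neg hk.le _
  have hφi := integrable_boxCox_finDist (N := N) hd hN hr hA hlam0
  have hti : Integrable (fun x => t ^ (r + θ) * ((t ^ (-θ) - (lam * finDist N A x) ^ (-θ)) / θ))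
      (cubeMeasure d) := (((integrable_const _).sub hi).div_const θ).const_mul _
  have h1 : boxCox r t ≤ ∫ x, boxCox r (lam * finDist N A x) ∂(cubeMeasure d) := by
    have hlow : ∫ x, (boxCox r t + t ^ (r + θ) * ((t ^ (-θ)
        - (lam * finDist N A x) ^ (-θ)) / θ)) ∂(cubeMeasure d)
        ≤ ∫ x, boxCox r (lam * finDist N A x) ∂(cubeMeasure d) := by
      refine integral_mono_ae ((integrable_const _).add hti) hφi ?_
      filter_upwards [ae_notMem_finset hd A] with x hx
      exact boxCox_tangent hθ0 hθr ht0 (scaled_finDist_pos hN hlam0 hA hx)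
    rw [integral_add (integrable_const _) hti, integral_const_mul,
      integral_div, integral_sub (integrable_const _) hi] at hlow
    simp only [integral_const, probReal_univ, one_smul] at hlow
    refine le_trans ?_ hlow
    refine le_add_of_nonneg_right (mul_nonneg (Real.rpow_nonneg ht0.le _) (div_nonneg ?_ hθ0.le))
    rw [htθ]
    have := le_max_left K 1
    linarith
  have h2 := integral_boxCox_scale (N := N) hd hN hr hA hlam0 (inv_pos.2 hlam0)
  rw [inv_mul_cancel₀ hlam0.ne'] at h2
  simp only [one_mul] at h2
  rw [h2, hinv, mul_comm, boxCox_mul r (inv_pos.2 hlam0) ht0]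
  have := mul_le_mul_of_nonneg_left h1 (Real.rpow_nonneg (inv_pos.2 hlam0).le r)
  linarith

lemma bddAbove_unitLevels (hd : 1 ≤ d) (hN : ∀ x, N x = 0 → x = 0) {r : ℝ}
    (hr : -(d : ℝ) < r) : BddAbove (unitLevels N r) := by
  have hA : ({0} : Finset (Fin d → ℝ)).Nonempty := Finset.singleton_nonempty 0
  obtain ⟨K, hK0, hK⟩ := exists_finDist_le_on_unitCube hN hA
  refine ⟨K, fun t ht => ?_⟩
  obtain ⟨ht0, ht⟩ := ht
  have h1 := ht {0} hA
  simp only [Finset.card_singleton, Nat.cast_one, Real.one_rpow, mul_one] at h1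
  have hi : Integrable (fun x => boxCox r (finDist N {0} x)) (cubeMeasure d) := by
    simpa using integrable_boxCox_finDist (N := N) hd hN hr hA one_pos
  have h2 : ∫ x, boxCox r (finDist N {0} x) ∂(cubeMeasure d)
      ≤ ∫ _, boxCox r K ∂(cubeMeasure d) := by
    refine integral_mono_ae hi (integrable_const _) ?_
    filter_upwards [ae_restrict_mem measurableSet_unitCube, ae_notMem_finset hd {0}] with x hx hx0
    exact boxCox_mono r (finDist_pos hN hA hx0) (hK x hx)
  simp only [integral_const, probReal_univ, one_smul] at h2
  by_contra hlt
  exact absurd (boxCox_strictMonoOn r hK0 ht0 (not_le.1 hlt)) (not_lt.2 (h1.trans h2))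

lemma unitCoeff_pos (hd : 1 ≤ d) (hN : ∀ x, N x = 0 → x = 0) {r : ℝ} (hr : -(d : ℝ) < r) :
    0 < unitCoeff N r := by
  obtain ⟨t, ht⟩ := unitLevels_nonempty (N := N) hd hN hr
  exact ht.1.trans_le (le_csSup (bddAbove_unitLevels hd hN hr) ht)

/-- The lower bound for the unit cube, valid for every finite set of points and every scale. -/
lemma boxCox_unitCoeff_le (hd : 1 ≤ d) (hN : ∀ x, N x = 0 → x = 0) {r : ℝ}
    (hr : -(d : ℝ) < r) {A : Finset (Fin d → ℝ)} (hA : A.Nonempty) {lam : ℝ} (hlam : 0 < lam) :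
    boxCox r (lam * (unitCoeff N r * (A.card : ℝ) ^ (-(1 / d : ℝ)))) ≤
      ∫ x, boxCox r (lam * finDist N A x) ∂(cubeMeasure d) := by
  have hk : (0 : ℝ) < A.card := by exact_mod_cast hA.card_pos
  have hkp : 0 < (A.card : ℝ) ^ (-(1 / d : ℝ)) := Real.rpow_pos_of_pos hk _
  have hc := unitCoeff_pos (N := N) hd hN hr
  have h1 : boxCox r (unitCoeff N r * (A.card : ℝ) ^ (-(1 / d : ℝ))) ≤
      ∫ x, boxCox r (finDist N A x) ∂(cubeMeasure d) := by
    have hcont : ContinuousAt (fun t => boxCox r (t * (A.card : ℝ) ^ (-(1 / d : ℝ))))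
        (unitCoeff N r) :=
      ContinuousAt.comp (f := fun t : ℝ => t * (A.card : ℝ) ^ (-(1 / d : ℝ)))
        (continuousAt_boxCox r (mul_pos hc hkp)) (by fun_prop)
    refine le_of_tendsto (hcont.tendsto.mono_left (nhdsWithin_le_nhds (s := Set.Iio (unitCoeff N r)))) ?_
    filter_upwards [Ioo_mem_nhdsLT hc] with t ht
    obtain ⟨s, hs, hts⟩ := exists_lt_of_lt_csSup (unitLevels_nonempty hd hN hr) ht.2
    refine (boxCox_mono r (mul_pos ht.1 hkp) ?_).trans (hs.2 A hA)
    exact mul_le_mul_of_nonneg_right hts.le hkp.le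
  have h2 := integral_boxCox_scale (N := N) hd hN hr hA one_pos hlam
  simp only [mul_one, one_mul] at h2
  rw [h2, boxCox_mul r hlam (mul_pos hc hkp)]
  have := mul_le_mul_of_nonneg_left h1 (Real.rpow_nonneg hlam.le r)
  linarith

/-- The lower bound for a cube. -/
lemma le_setIntegral_cell (hd : 1 ≤ d) (hN : ∀ x, N x = 0 → x = 0) {r : ℝ}
    (hr : -(d : ℝ) < r) {B : Finset (Fin d → ℝ)} (hB : B.Nonempty) (z : Fin d → ℝ) {ℓ lam : ℝ}
    (hℓ : 0 < ℓ) (hlam : 0 < lam) :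
    ℓ ^ d * boxCox r (lam * ℓ * (unitCoeff N r * (B.card : ℝ) ^ (-(1 / d : ℝ)))) ≤
      ∫ x in cell z ℓ, boxCox r (lam * finDist N B x) := by
  rw [setIntegral_cell_boxCox r hB z hℓ]
  refine mul_le_mul_of_nonneg_left ?_ (by positivity)
  have hB' := hB.image fun x => ℓ⁻¹ • (x - z)
  refine le_trans ?_ (boxCox_unitCoeff_le hd hN hr hB' (mul_pos hlam hℓ))
  have hc := unitCoeff_pos (N := N) hd hN hr
  have hk : (0 : ℝ) < B.card := by exact_mod_cast hB.card_pos
  have hk' : (0 : ℝ) < (B.image fun x => ℓ⁻¹ • (x - z)).card := by exact_mod_cast hB'.card_pos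
  have hkk : ((B.image fun x => ℓ⁻¹ • (x - z)).card : ℝ) ≤ B.card := by
    exact_mod_cast Finset.card_image_le
  have hkp := Real.rpow_pos_of_pos hk (-(1 / d : ℝ))
  refine boxCox_mono r (by positivity) ?_
  refine mul_le_mul_of_nonneg_left ?_ (by positivity)
  refine mul_le_mul_of_nonneg_left ?_ hc.le
  exact Real.rpow_le_rpow_of_nonpos hk' hkk (by simp)

/-- The copies of a finite set in the cubes of the grid. -/
noncomputable def tiling (m : ℕ) (A : Finset (Fin d → ℝ)) : Finset (Fin d → ℝ) :=
  Finset.univ.biUnion fun j : Fin d → Fin m => A.image fun y => corner m j + (1 / m : ℝ) • y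

lemma card_tiling_le (m : ℕ) (A : Finset (Fin d → ℝ)) : (tiling m A).card ≤ m ^ d * A.card := by
  refine (Finset.card_biUnion_le_card_mul _ _ A.card fun j _ => Finset.card_image_le).trans ?_
  simp

lemma integral_tiling_le (hd : 1 ≤ d) (hN : ∀ x, N x = 0 → x = 0) {r : ℝ}
    (hr : -(d : ℝ) < r) {A : Finset (Fin d → ℝ)} (hA : A.Nonempty) {m : ℕ} (hm : 0 < m)
    {lam : ℝ} (hlam : 0 < lam) :
    ∫ x, boxCox r (lam * finDist N (tiling m A) x) ∂(cubeMeasure d) ≤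
      ∫ x, boxCox r (lam * (1 / m) * finDist N A x) ∂(cubeMeasure d) := by
  have hm' : (0 : ℝ) < m := by exact_mod_cast hm
  have hsub : ∀ j : Fin d → Fin m,
      (A.image fun y => corner m j + (1 / m : ℝ) • y) ⊆ tiling m A := fun j =>
    Finset.subset_biUnion_of_mem (fun j : Fin d → Fin m =>
      A.image fun y => corner m j + (1 / m : ℝ) • y) (Finset.mem_univ j)
  have hne : (tiling m A).Nonempty := (hA.image _).mono (hsub fun _ => ⟨0, hm⟩)
  rw [integral_cube_eq_sum hm (integrable_boxCox_finDist hd hN hr hne hlam)]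
  calc _ ≤ ∑ _j : Fin d → Fin m, (1 / m : ℝ) ^ d *
        ∫ x, boxCox r (lam * (1 / m) * finDist N A x) ∂(cubeMeasure d) :=
        Finset.sum_le_sum fun j _ =>
          setIntegral_cell_le hd hN hr hA (corner m j) (by positivity) hlam (hsub j)
    _ = _ := by
        rw [Finset.sum_const, Finset.card_univ, Fintype.card_pi_const, Fintype.card_fin,
          nsmul_eq_mul]
        push_cast
        rw [← mul_assoc, ← mul_pow, mul_one_div_cancel hm'.ne', one_pow, one_mul]

/-- The upper bound for the unit cube: by tiling, a good set of points for one cardinality gives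
good sets for all large cardinalities. -/
lemma exists_near_optimal_unitCube (hd : 1 ≤ d) (hN : ∀ x, N x = 0 → x = 0) {r : ℝ}
    (hr : -(d : ℝ) < r) {c : ℝ} (hc : unitCoeff N r < c) :
    ∃ k₀ : ℕ, ∀ n : ℕ, k₀ ≤ n → ∃ A : Finset (Fin d → ℝ), A.Nonempty ∧ A.card ≤ n ∧
      ∀ lam : ℝ, 0 < lam → ∫ x, boxCox r (lam * finDist N A x) ∂(cubeMeasure d) ≤
        boxCox r (lam * (c * (n : ℝ) ^ (-(1 / d : ℝ)))) := by
  have hc0 := unitCoeff_pos (N := N) hd hN hr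
  have hd' : (d : ℝ) ≠ 0 := by positivity
  obtain ⟨b, hb, hbc⟩ := exists_between hc
  have hb0 : 0 < b := hc0.trans hb
  have hc0' : 0 < c := hb0.trans hbc
  have hnot : b ∉ unitLevels N r := fun h =>
    absurd (le_csSup (bddAbove_unitLevels hd hN hr) h) (not_le.2 hb)
  obtain ⟨A, hA, hAb⟩ : ∃ A : Finset (Fin d → ℝ), A.Nonempty ∧
      ∫ x, boxCox r (finDist N A x) ∂(cubeMeasure d)
        < boxCox r (b * (A.card : ℝ) ^ (-(1 / d : ℝ))) := by
    by_contra! hcon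
    exact hnot ⟨hb0, hcon⟩
  have hk : (0 : ℝ) < A.card := by exact_mod_cast hA.card_pos
  set y : ℕ → ℝ := fun n => ((n : ℝ) / A.card) ^ (1 / d : ℝ) with hy
  have hylim : Tendsto y atTop atTop :=
    (tendsto_rpow_atTop (by positivity)).comp
      ((tendsto_natCast_atTop_atTop).atTop_div_const hk)
  obtain ⟨k₀, hk₀⟩ := eventually_atTop.1 (hylim.eventually_ge_atTop (max 1 (c / (c - b))))
  refine ⟨max k₀ 1, fun n hn => ?_⟩
  have hyn := hk₀ n ((le_max_left _ _).trans hn)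
  have hn0 : (0 : ℝ) < n := by exact_mod_cast (le_max_right k₀ 1).trans hn
  have hy1 : 1 ≤ y n := (le_max_left _ _).trans hyn
  have hy2 : c / (c - b) ≤ y n := (le_max_right _ _).trans hyn
  set m := ⌊y n⌋₊ with hm
  have hm1 : 1 ≤ m := Nat.le_floor (by simpa using hy1)
  have hm0 : (0 : ℝ) < m := by exact_mod_cast hm1
  have hmy : (m : ℝ) ≤ y n := Nat.floor_le (by linarith)
  have hym : y n < m + 1 := Nat.lt_floor_add_one _
  have hyd : y n ^ d = n / A.card := by
    rw [hy]; simp only [one_div]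
    rw [Real.rpow_inv_natCast_pow (by positivity) (by omega)]
  have hne : (tiling m A).Nonempty := by
    refine (hA.image _).mono (Finset.subset_biUnion_of_mem (fun j : Fin d → Fin m =>
      A.image fun y => corner m j + (1 / m : ℝ) • y) (Finset.mem_univ fun _ => ⟨0, hm1⟩))
  refine ⟨tiling m A, hne, ?_, fun lam hlam => ?_⟩
  · have h1 : (m : ℝ) ^ d * A.card ≤ n := by
      rw [← le_div_iff₀ hk, ← hyd]
      gcongr
    exact (card_tiling_le m A).trans (by exact_mod_cast h1)
  · refine (integral_tiling_le hd hN hr hA hm1 hlam).trans ?_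
    have h2 := integral_boxCox_scale (N := N) hd hN hr hA one_pos
      (show 0 < lam * (1 / m) by positivity)
    simp only [mul_one, one_mul] at h2
    have hkp : 0 < b * (A.card : ℝ) ^ (-(1 / d : ℝ)) := mul_pos hb0 (Real.rpow_pos_of_pos hk _)
    have h3 : ∫ x, boxCox r (lam * (1 / m) * finDist N A x) ∂(cubeMeasure d) ≤
        boxCox r (lam * (1 / m) * (b * (A.card : ℝ) ^ (-(1 / d : ℝ)))) := by
      rw [h2, boxCox_mul r (by positivity) hkp]
      have := mul_le_mul_of_nonneg_left hAb.le
        (Real.rpow_nonneg (show 0 ≤ lam * (1 / m) by positivity) r)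
      linarith
    refine h3.trans (boxCox_mono r (by positivity) ?_)
    rw [mul_assoc]
    refine mul_le_mul_of_nonneg_left ?_ hlam.le
    have hynk : y n = (n : ℝ) ^ (1 / d : ℝ) / (A.card : ℝ) ^ (1 / d : ℝ) :=
      Real.div_rpow hn0.le hk.le _
    have hnp := Real.rpow_pos_of_pos hn0 (1 / d : ℝ)
    have hkp' := Real.rpow_pos_of_pos hk (1 / d : ℝ)
    have hby : b * y n ≤ c * m := by
      rw [div_le_iff₀ (by linarith)] at hy2
      nlinarith
    rw [Real.rpow_neg hk.le, Real.rpow_neg hn0.le, ← div_eq_mul_inv, ← div_eq_mul_inv,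
      one_div_mul_eq_div, div_div, div_le_div_iff₀ (by positivity) hnp]
    rw [hynk, mul_div_assoc', div_le_iff₀ hkp'] at hby
    linarith

end UnitCoefficient

/-! ### Approximation by step densities -/

section StepDensities

variable {d : ℕ}

/-- The grid cube with index `j`, shrunk by a layer of relative width `η` along its boundary. -/
def innerCell (m : ℕ) (η : ℝ) (j : Fin d → Fin m) : Set (Fin d → ℝ) :=
  cell (fun i => corner m j i + η / m) ((1 - 2 * η) / m)

/-- The density with the value `w j` on the shrunk grid cube with index `j`, and `0` on the layers
between these cubes. The layers separate the points that serve different cubes. -/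
noncomputable def stepDensity (m : ℕ) (η : ℝ) (w : (Fin d → Fin m) → ℝ) (x : Fin d → ℝ) : ℝ :=
  ∑ j, (innerCell m η j).indicator (fun _ => w j) x

lemma measurableSet_innerCell (m : ℕ) (η : ℝ) (j : Fin d → Fin m) :
    MeasurableSet (innerCell m η j) := measurableSet_cell _ _

/-- The points within distance `η / m` of a shrunk cube belong to the original one. -/
lemma mem_cell_of_near_innerCell {m : ℕ} {η : ℝ} {j : Fin d → Fin m} {x y : Fin d → ℝ}
    (hx : x ∈ innerCell m η j) (hxy : ‖x - y‖ < η / m) : y ∈ cell (corner m j) (1 / m) := by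
  intro i
  obtain ⟨h1, h2⟩ := hx i
  simp only at h1 h2
  have h3 := abs_lt.1 ((norm_le_pi_norm (x - y) i).trans_lt hxy)
  simp only [Pi.sub_apply] at h3
  have h4 : (1 - 2 * η) / m = 1 / m - η / m - η / m := by ring
  rw [h4] at h2
  constructor <;> linarith

lemma innerCell_subset_cell {m : ℕ} {η : ℝ} (hη : 0 < η) (j : Fin d → Fin m) (hm : 0 < m) :
    innerCell m η j ⊆ cell (corner m j) (1 / m) := fun x hx =>
  mem_cell_of_near_innerCell hx (by
    have : (0 : ℝ) < m := by exact_mod_cast hm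
    simpa using div_pos hη this)

lemma innerCell_subset_unitCube {m : ℕ} {η : ℝ} (hη : 0 < η) (j : Fin d → Fin m) (hm : 0 < m) :
    innerCell m η j ⊆ unitCube d :=
  (innerCell_subset_cell hη j hm).trans (cell_corner_subset j)

lemma sum_indicator_innerCell {m : ℕ} {η : ℝ} (hη : 0 < η) (hm : 0 < m)
    (v : (Fin d → Fin m) → ℝ) {j : Fin d → Fin m} {x : Fin d → ℝ} (hx : x ∈ innerCell m η j) :
    ∑ j, (innerCell m η j).indicator (fun _ => v j) x = v j := by
  rw [Finset.sum_eq_single j, Set.indicator_of_mem hx]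
  · intro j' _ hne
    refine Set.indicator_of_notMem (fun hx' => hne ?_) _
    exact cell_corner_index_unique (innerCell_subset_cell hη j' hm hx')
      (innerCell_subset_cell hη j hm hx)
  · simp

lemma stepDensity_of_mem {m : ℕ} {η : ℝ} (hη : 0 < η) (hm : 0 < m)
    (w : (Fin d → Fin m) → ℝ) {j : Fin d → Fin m} {x : Fin d → ℝ} (hx : x ∈ innerCell m η j) :
    stepDensity m η w x = w j :=
  sum_indicator_innerCell hη hm w hx

lemma stepDensity_of_notMem {m : ℕ} {η : ℝ} (w : (Fin d → Fin m) → ℝ) {x : Fin d → ℝ}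
    (hx : ∀ j, x ∉ innerCell m η j) : stepDensity m η w x = 0 :=
  Finset.sum_eq_zero fun j _ => Set.indicator_of_notMem (hx j) _

lemma measurable_stepDensity (m : ℕ) (η : ℝ) (w : (Fin d → Fin m) → ℝ) :
    Measurable (stepDensity m η w) :=
  Finset.measurable_sum _ fun j _ => measurable_const.indicator (measurableSet_innerCell m η j)

lemma stepDensity_mem_Icc {m : ℕ} {η M : ℝ} (hη : 0 < η) (hm : 0 < m) (hM : 0 ≤ M)
    {w : (Fin d → Fin m) → ℝ} (hw : ∀ j, 0 < w j ∧ w j ≤ M) (x : Fin d → ℝ) :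
    stepDensity m η w x ∈ Set.Icc 0 M := by
  by_cases hx : ∃ j, x ∈ innerCell m η j
  · obtain ⟨j, hj⟩ := hx
    rw [stepDensity_of_mem hη hm w hj]
    exact ⟨(hw j).1.le, (hw j).2⟩
  · push Not at hx
    rw [stepDensity_of_notMem w hx]
    exact ⟨le_rfl, hM⟩

lemma stepDensity_nonneg {m : ℕ} {η : ℝ} {w : (Fin d → Fin m) → ℝ} (hw : ∀ j, 0 < w j)
    (x : Fin d → ℝ) : 0 ≤ stepDensity m η w x :=
  Finset.sum_nonneg fun j _ => Set.indicator_nonneg (fun _ _ => (hw j).le) _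

lemma stepDensity_le_sum {m : ℕ} {η : ℝ} {w : (Fin d → Fin m) → ℝ} (hw : ∀ j, 0 < w j)
    (x : Fin d → ℝ) : stepDensity m η w x ≤ ∑ j, w j :=
  Finset.sum_le_sum fun j _ => Set.indicator_le_self' (fun _ _ => (hw j).le) x

lemma integral_stepDensity_mul {m : ℕ} {η : ℝ} (hη : 0 < η) (hm : 0 < m)
    (w : (Fin d → Fin m) → ℝ) {f : (Fin d → ℝ) → ℝ} (hf : Integrable f (cubeMeasure d)) :
    ∫ x, stepDensity m η w x * f x ∂(cubeMeasure d) = ∑ j, w j * ∫ x in innerCell m η j, f x := by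
  have h1 : ∀ x, stepDensity m η w x * f x =
      ∑ j, (innerCell m η j).indicator (fun x => w j * f x) x := by
    intro x
    rw [stepDensity, Finset.sum_mul]
    refine Finset.sum_congr rfl fun j _ => ?_
    by_cases hx : x ∈ innerCell m η j
    · rw [Set.indicator_of_mem hx, Set.indicator_of_mem hx]
    · rw [Set.indicator_of_notMem hx, Set.indicator_of_notMem hx, zero_mul]
  simp_rw [h1]
  rw [integral_finsetSum _ fun j _ => (hf.const_mul (w j)).indicator (measurableSet_innerCell m η j)]
  refine Finset.sum_congr rfl fun j _ => ?_
  rw [integral_indicator (measurableSet_innerCell m η j), integral_const_mul, cubeMeasure,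
    Measure.restrict_restrict (measurableSet_innerCell m η j),
    Set.inter_eq_self_of_subset_left (innerCell_subset_unitCube hη j hm)]

lemma volume_innerCell {m : ℕ} {η : ℝ} (hη : η < 1 / 2) (j : Fin d → Fin m) :
    volume.real (innerCell m η j) = ((1 - 2 * η) / m) ^ d :=
  volume_cell _ (div_nonneg (by linarith) (Nat.cast_nonneg m))

lemma integral_comp_stepDensity {m : ℕ} {η : ℝ} (hη : 0 < η) (hη' : η < 1 / 2) (hm : 0 < m)
    (w : (Fin d → Fin m) → ℝ) {F : ℝ → ℝ} (hF : F 0 = 0) :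
    ∫ x, F (stepDensity m η w x) ∂(cubeMeasure d) = ∑ j, ((1 - 2 * η) / m) ^ d * F (w j) := by
  have h1 : ∀ x, F (stepDensity m η w x) = stepDensity m η (fun j => F (w j)) x * 1 := by
    intro x
    rw [mul_one]
    by_cases hx : ∃ j, x ∈ innerCell m η j
    · obtain ⟨j, hj⟩ := hx
      rw [stepDensity_of_mem hη hm w hj, stepDensity_of_mem hη hm _ hj]
    · push Not at hx
      rw [stepDensity_of_notMem w hx, stepDensity_of_notMem _ hx, hF]
  simp_rw [h1]
  rw [integral_stepDensity_mul hη hm _ (integrable_const 1)]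
  refine Finset.sum_congr rfl fun j _ => ?_
  simp only [integral_const, smul_eq_mul, mul_one, measureReal_restrict_apply_univ]
  rw [volume_innerCell hη', mul_comm]

lemma abs_sub_clip_le {a b δ M : ℝ} (ha : 0 ≤ a) (haM : a ≤ M) (hδ : 0 ≤ δ) :
    |a - max δ (min b M)| ≤ |a - b| + δ := by
  rcases le_total b M with h1 | h1
  · rw [min_eq_left h1]
    rcases le_total δ b with h2 | h2
    · rw [max_eq_right h2]; linarith
    · rw [max_eq_left h2, abs_le]
      have := neg_abs_le (a - b)
      have := le_abs_self (a - b)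
      constructor <;> linarith
  · rw [min_eq_right h1]
    have := neg_abs_le (a - b)
    rcases le_total δ M with h2 | h2
    · rw [max_eq_right h2, abs_le]
      constructor <;> linarith
    · rw [max_eq_left h2, abs_le]
      constructor <;> linarith [abs_nonneg (a - b)]

lemma abs_clip_sub_clip_le (a b δ M : ℝ) :
    |max δ (min a M) - max δ (min b M)| ≤ |a - b| := by
  have h1 := abs_max_sub_max_le_max δ (min a M) δ (min b M)
  have h2 := abs_min_sub_min_le_max a M b M
  rw [sub_self, abs_zero] at h1 h2
  rw [max_eq_right (abs_nonneg (min a M - min b M))] at h1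
  rw [max_eq_left (abs_nonneg (a - b))] at h2
  exact h1.trans h2

lemma exists_stepDensity_integral_sub_le {f : (Fin d → ℝ) → ℝ} (hf : Measurable f) {M : ℝ}
    (hM : 0 < M) (hf0 : ∀ x, 0 ≤ f x) (hfM : ∀ x, f x ≤ M) {ε : ℝ} (hε : 0 < ε) :
    ∃ (m : ℕ) (η : ℝ) (w : (Fin d → Fin m) → ℝ), 0 < m ∧ 0 < η ∧ η < 1 / 2 ∧
      (∀ j, 0 < w j ∧ w j ≤ M) ∧
      ∫ x, |f x - stepDensity m η w x| ∂(cubeMeasure d) ≤ ε := by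
  have hfi : Integrable f (cubeMeasure d) :=
    Integrable.of_bound hf.aestronglyMeasurable M (ae_of_all _ fun x => by
      rw [Real.norm_of_nonneg (hf0 x)]; exact hfM x)
  obtain ⟨g, hgc, hgε, hgcont, hgi⟩ :=
    hfi.exists_hasCompactSupport_integral_sub_le (ε := ε / 4) (by positivity)
  set δ := min (ε / 4) M with hδ
  have hδ0 : 0 < δ := lt_min (by positivity) hM
  have hδM : δ ≤ M := min_le_right _ _
  have hδε : δ ≤ ε / 4 := min_le_left _ _
  obtain ⟨ρ, hρ, hunif⟩ := Metric.uniformContinuous_iff.1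
    (hgc.uniformContinuous_of_continuous hgcont) (ε / 4) (by positivity)
  obtain ⟨m, hm⟩ := exists_nat_one_div_lt hρ
  set η := min (1 / 4) (ε / (8 * (d + 1) * M)) with hη
  have hη0 : 0 < η := lt_min (by norm_num) (by positivity)
  have hη2 : η < 1 / 2 := (min_le_left _ _).trans_lt (by norm_num)
  have hηM : M * (1 - (1 - 2 * η) ^ d) ≤ ε / 4 := by
    have h1 : 1 + (d : ℝ) * (-(2 * η)) ≤ (1 + -(2 * η)) ^ d :=
      one_add_mul_le_pow (by linarith) d
    have h2 : η * (8 * (d + 1) * M) ≤ ε := by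
      rw [← le_div_iff₀ (by positivity)]; exact min_le_right _ _
    have h3 : 1 - (1 - 2 * η) ^ d ≤ 2 * d * η := by
      have : (1 + -(2 * η)) = 1 - 2 * η := by ring
      rw [this] at h1; linarith
    have h4 := mul_le_mul_of_nonneg_left h3 hM.le
    have h5 : 0 ≤ η * M := by positivity
    nlinarith
  refine ⟨m + 1, η, fun j => max δ (min (g (corner (m + 1) j)) M), Nat.succ_pos m, hη0, hη2,
    fun j => ⟨hδ0.trans_le (le_max_left _ _), max_le hδM (min_le_right _ _)⟩, ?_⟩
  set w : (Fin d → Fin (m + 1)) → ℝ := fun j => max δ (min (g (corner (m + 1) j)) M) with hw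
  have hpt : ∀ x ∈ unitCube d, |f x - stepDensity (m + 1) η w x| ≤
      ‖f x - g x‖ + ε / 2 + M * (1 - stepDensity (m + 1) η (fun _ => 1) x) := by
    intro x hx
    by_cases hxj : ∃ j, x ∈ innerCell (m + 1) η j
    · obtain ⟨j, hj⟩ := hxj
      rw [stepDensity_of_mem hη0 (Nat.succ_pos m) w hj,
        stepDensity_of_mem hη0 (Nat.succ_pos m) _ hj, sub_self, mul_zero, add_zero]
      have hQ := innerCell_subset_cell hη0 j (Nat.succ_pos m) hj
      have hdist : dist x (corner (m + 1) j) < ρ := by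
        refine lt_of_le_of_lt ?_ hm
        rw [dist_eq_norm]
        refine (pi_norm_le_iff_of_nonneg (by positivity)).2 fun i => ?_
        obtain ⟨h1, h2⟩ := hQ i
        push_cast at h2
        rw [Pi.sub_apply, Real.norm_eq_abs, abs_le]
        have : (0 : ℝ) < 1 / (m + 1) := by positivity
        constructor <;> linarith
      have h1 := hunif hdist
      rw [Real.dist_eq] at h1
      have h2 := abs_sub_clip_le (b := g x) (hf0 x) (hfM x) hδ0.le
      have h3 := abs_clip_sub_clip_le (g x) (g (corner (m + 1) j)) δ M
      have h4 := abs_sub_le (f x) (max δ (min (g x) M)) (w j)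
      rw [Real.norm_eq_abs]
      simp only [hw] at h4 ⊢
      linarith
    · push Not at hxj
      rw [stepDensity_of_notMem w hxj, stepDensity_of_notMem _ hxj, sub_zero, sub_zero, mul_one,
        abs_of_nonneg (hf0 x)]
      have := norm_nonneg (f x - g x)
      have := hfM x
      linarith
  have hst : ∀ v : (Fin d → Fin (m + 1)) → ℝ, (∀ j, 0 < v j ∧ v j ≤ max M 1) →
      Integrable (stepDensity (m + 1) η v) (cubeMeasure d) := fun v hv =>
    Integrable.of_bound (measurable_stepDensity _ _ _).aestronglyMeasurable (max M 1)
      (ae_of_all _ fun x => by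
        have := stepDensity_mem_Icc hη0 (Nat.succ_pos m) (by positivity) hv x
        rw [Real.norm_of_nonneg this.1]; exact this.2)
  have h1i := hst (fun _ => 1) (fun _ => ⟨one_pos, le_max_right _ _⟩)
  have hwi := hst w (fun j => ⟨hδ0.trans_le (le_max_left _ _),
    (max_le hδM (min_le_right _ _)).trans (le_max_left _ _)⟩)
  have hone : ∫ x, stepDensity (m + 1) η (fun _ => 1) x ∂(cubeMeasure d) = (1 - 2 * η) ^ d := by
    have := integral_comp_stepDensity (d := d) hη0 hη2 (Nat.succ_pos m) (fun _ => 1)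
      (F := fun t => t) rfl
    rw [this, Finset.sum_const, Finset.card_univ, Fintype.card_pi_const, Fintype.card_fin,
      nsmul_eq_mul, mul_one]
    push_cast
    rw [← mul_pow, mul_div_cancel₀]
    positivity
  have hsubi : Integrable (fun x => ‖f x - g x‖) (cubeMeasure d) := (hfi.sub hgi).norm
  have hsubi' : Integrable (fun x => ‖f x - g x‖ + ε / 2) (cubeMeasure d) :=
    hsubi.add (integrable_const _)
  have hlayer : Integrable (fun x => M * (1 - stepDensity (m + 1) η (fun _ => 1) x))
      (cubeMeasure d) := ((integrable_const _).sub h1i).const_mul M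
  calc ∫ x, |f x - stepDensity (m + 1) η w x| ∂(cubeMeasure d)
      ≤ ∫ x, (‖f x - g x‖ + ε / 2 + M * (1 - stepDensity (m + 1) η (fun _ => 1) x))
          ∂(cubeMeasure d) := by
        refine integral_mono_ae (hfi.sub hwi).abs
          (hsubi'.add hlayer) ?_
        filter_upwards [ae_restrict_mem measurableSet_unitCube] with x hx using hpt x hx
    _ = ∫ x, ‖f x - g x‖ ∂(cubeMeasure d) + ε / 2 + M * (1 - (1 - 2 * η) ^ d) := by
        rw [integral_add hsubi' hlayer, integral_add hsubi (integrable_const _),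
          integral_const_mul, integral_sub (integrable_const _) h1i, hone]
        simp
    _ ≤ ε := by linarith

lemma exists_modulus {F : ℝ → ℝ} (hF : Continuous F) {M ε : ℝ} (hε : 0 < ε) :
    ∃ C : ℝ, 0 ≤ C ∧ ∀ a ∈ Set.Icc 0 M, ∀ b ∈ Set.Icc 0 M, |F a - F b| ≤ ε + C * |a - b| := by
  obtain ⟨B, hB⟩ := isCompact_Icc.exists_bound_of_continuousOn (hF.continuousOn (s := Set.Icc 0 M))
  obtain ⟨δ, hδ, hu⟩ := Metric.uniformContinuousOn_iff.1
    (isCompact_Icc.uniformContinuousOn_of_continuous (hF.continuousOn (s := Set.Icc 0 M))) ε hε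
  refine ⟨2 * |B| / δ, by positivity, fun a ha b hb => ?_⟩
  rcases lt_or_ge (dist a b) δ with h | h
  · have := hu a ha b hb h
    rw [Real.dist_eq] at this
    have h2 : 0 ≤ 2 * |B| / δ * |a - b| := by positivity
    linarith
  · rw [Real.dist_eq] at h
    have h1 : |F a - F b| ≤ 2 * |B| := by
      have h3 := (hB a ha).trans (le_abs_self B)
      have h4 := (hB b hb).trans (le_abs_self B)
      rw [Real.norm_eq_abs] at h3 h4
      have := abs_sub (F a) (F b)
      linarith
    have h2 : 2 * |B| ≤ 2 * |B| / δ * |a - b| := by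
      rw [div_mul_eq_mul_div, le_div_iff₀ hδ]
      exact mul_le_mul_of_nonneg_left h (by positivity)
    linarith

lemma rpow_add_le_two_rpow_mul {a b p : ℝ} (ha : 0 ≤ a) (hb : 0 ≤ b) (hp : 0 ≤ p) :
    (a + b) ^ p ≤ 2 ^ p * (a ^ p + b ^ p) := by
  have h1 : a + b ≤ 2 * max a b := by
    have := le_max_left a b; have := le_max_right a b; linarith
  have hm : 0 ≤ max a b := ha.trans (le_max_left a b)
  calc (a + b) ^ p ≤ (2 * max a b) ^ p := Real.rpow_le_rpow (by positivity) h1 hp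
    _ = 2 ^ p * (max a b) ^ p := Real.mul_rpow (by norm_num) hm
    _ ≤ 2 ^ p * (a ^ p + b ^ p) := by
        gcongr
        rcases max_cases a b with ⟨h, _⟩ | ⟨h, _⟩ <;> rw [h]
        · linarith [Real.rpow_nonneg hb p]
        · linarith [Real.rpow_nonneg ha p]

lemma integrable_of_rpow {p : ℝ} (hp : 1 ≤ p) {h : (Fin d → ℝ) → ℝ} (hh : Measurable h)
    (h0 : ∀ x, 0 ≤ h x) (hi : Integrable (fun x => h x ^ p) (cubeMeasure d)) :
    Integrable h (cubeMeasure d) := by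
  refine ((integrable_const (1 : ℝ)).add hi).mono' hh.aestronglyMeasurable (ae_of_all _ fun x => ?_)
  rw [Real.norm_of_nonneg (h0 x)]
  simp only [Pi.add_apply]
  rcases le_total (h x) 1 with h1 | h1
  · linarith [Real.rpow_nonneg (h0 x) p]
  · have := Real.rpow_le_rpow_of_exponent_le h1 hp
    rw [Real.rpow_one] at this
    linarith

/-- A density in `L^p` is approximated by its truncations, in `L^p` and in the integrals of a
continuous function of at most the growth of `t ^ p`. -/
lemma tendsto_truncation {p : ℝ} (hp : 1 ≤ p) {h : (Fin d → ℝ) → ℝ}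
    (hh : Measurable h) (h0 : ∀ x, 0 ≤ h x) (hi : Integrable (fun x => h x ^ p) (cubeMeasure d))
    {F : ℝ → ℝ} (hF : Continuous F) {C : ℝ} (hFC : ∀ t, 0 ≤ t → |F t| ≤ C * (1 + t ^ p)) :
    Tendsto (fun M : ℕ => ∫ x, F (min (h x) M) ∂(cubeMeasure d)) atTop
      (𝓝 (∫ x, F (h x) ∂(cubeMeasure d))) := by
  have hC : 0 ≤ C := by
    have := (abs_nonneg _).trans (hFC 0 le_rfl)
    have h1 : (0 : ℝ) ≤ 0 ^ p := Real.rpow_nonneg le_rfl p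
    by_contra hneg
    nlinarith
  refine tendsto_integral_of_dominated_convergence (fun x => C * (1 + h x ^ p)) (fun M => ?_)
    (((integrable_const _).add hi).const_mul C) (fun M => ae_of_all _ fun x => ?_)
    (ae_of_all _ fun x => ?_)
  · exact (hF.measurable.comp (hh.min measurable_const)).aestronglyMeasurable
  · have hmin : 0 ≤ min (h x) M := le_min (h0 x) (Nat.cast_nonneg M)
    refine (hFC _ hmin).trans (mul_le_mul_of_nonneg_left ?_ hC)
    gcongr
    exact min_le_left _ _
  · refine tendsto_const_nhds.congr' ?_
    filter_upwards [eventually_ge_atTop ⌈h x⌉₊] with M hM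
    rw [min_eq_left ((Nat.le_ceil (h x)).trans (by exact_mod_cast hM))]

lemma tendsto_truncation_sub {p : ℝ} (hp : 1 ≤ p) {h : (Fin d → ℝ) → ℝ}
    (hh : Measurable h) (h0 : ∀ x, 0 ≤ h x) (hi : Integrable (fun x => h x ^ p) (cubeMeasure d)) :
    Tendsto (fun M : ℕ => ∫ x, |h x - min (h x) M| ^ p ∂(cubeMeasure d)) atTop (𝓝 0) := by
  have hp0 : 0 < p := by linarith
  have : (0 : ℝ) = ∫ _ : Fin d → ℝ, (0 : ℝ) ∂(cubeMeasure d) := by simp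
  rw [this]
  refine tendsto_integral_of_dominated_convergence (fun x => h x ^ p) (fun M => ?_)
    hi (fun M => ae_of_all _ fun x => ?_) (ae_of_all _ fun x => ?_)
  · exact ((hh.sub (hh.min measurable_const)).abs.pow_const p).aestronglyMeasurable
  · rw [Real.norm_of_nonneg (Real.rpow_nonneg (abs_nonneg _) _)]
    have hmin : 0 ≤ min (h x) M := le_min (h0 x) (Nat.cast_nonneg M)
    refine Real.rpow_le_rpow (abs_nonneg _) ?_ hp0.le
    rw [abs_of_nonneg (sub_nonneg.2 (min_le_left _ _))]
    linarith
  · refine tendsto_const_nhds.congr' ?_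
    filter_upwards [eventually_ge_atTop ⌈h x⌉₊] with M hM
    rw [min_eq_left ((Nat.le_ceil (h x)).trans (by exact_mod_cast hM)), sub_self, abs_zero,
      Real.zero_rpow hp0.ne']

/-- A density in `L^p` is approximated by step densities, in `L^p` and in the integrals of
a continuous function of at most the growth of `t ^ p`. -/
lemma exists_stepDensity_approx {p : ℝ} (hp : 1 ≤ p) {h : (Fin d → ℝ) → ℝ}
    (hh : Measurable h) (h0 : ∀ x, 0 ≤ h x) (hi : Integrable (fun x => h x ^ p) (cubeMeasure d))
    {F : ℝ → ℝ} (hF : Continuous F) {C : ℝ} (hFC : ∀ t, 0 ≤ t → |F t| ≤ C * (1 + t ^ p))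
    {ε : ℝ} (hε : 0 < ε) :
    ∃ (m : ℕ) (η : ℝ) (w : (Fin d → Fin m) → ℝ), 0 < m ∧ 0 < η ∧ η < 1 / 2 ∧ (∀ j, 0 < w j) ∧
      Integrable (fun x => |h x - stepDensity m η w x| ^ p) (cubeMeasure d) ∧
      ∫ x, |h x - stepDensity m η w x| ^ p ∂(cubeMeasure d) < ε ∧
      |∫ x, stepDensity m η w x ∂(cubeMeasure d) - ∫ x, h x ∂(cubeMeasure d)| < ε ∧
      |∫ x, F (stepDensity m η w x) ∂(cubeMeasure d) - ∫ x, F (h x) ∂(cubeMeasure d)| < ε := by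
  have hp0 : 0 < p := by linarith
  have hid : ∀ t : ℝ, 0 ≤ t → |t| ≤ 1 * (1 + t ^ p) := by
    intro t ht
    rw [abs_of_nonneg ht, one_mul]
    rcases le_total t 1 with h1 | h1
    · linarith [Real.rpow_nonneg ht p]
    · have := Real.rpow_le_rpow_of_exponent_le h1 hp
      rw [Real.rpow_one] at this
      linarith
  have hε' : 0 < ε / (2 * 2 ^ p) := by positivity
  have e1 := (tendsto_truncation_sub hp hh h0 hi).eventually_lt_const hε'
  have e2 := (tendsto_truncation hp hh h0 hi continuous_id hid).eventually
    (Metric.ball_mem_nhds _ (half_pos hε))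
  have e3 := (tendsto_truncation hp hh h0 hi hF hFC).eventually
    (Metric.ball_mem_nhds _ (half_pos hε))
  obtain ⟨M, ⟨⟨hM1, hM2⟩, hM3⟩, hM0⟩ := (((e1.and e2).and e3).and (eventually_gt_atTop 0)).exists
  have hM0' : (0 : ℝ) < M := by exact_mod_cast hM0
  simp only [id, Real.dist_eq] at hM2 hM3
  set f : (Fin d → ℝ) → ℝ := fun x => min (h x) M with hf
  have hfm : Measurable f := hh.min measurable_const
  have hf0 : ∀ x, 0 ≤ f x := fun x => le_min (h0 x) hM0'.le
  have hfM : ∀ x, f x ≤ M := fun x => min_le_right _ _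
  obtain ⟨C', hC'0, hC'⟩ := exists_modulus hF (M := (M : ℝ)) (ε := ε / 4) (by positivity)
  set κ := min (ε / 4) (min (ε / (4 * (C' + 1))) (ε / (4 * 2 ^ p * (M : ℝ) ^ (p - 1)))) with hκ
  have hMp : 0 < (M : ℝ) ^ (p - 1) := Real.rpow_pos_of_pos hM0' _
  have hκ0 : 0 < κ := by positivity
  obtain ⟨m, η, w, hm, hη, hη', hw, hint⟩ :=
    exists_stepDensity_integral_sub_le hfm hM0' hf0 hfM hκ0
  have hκ1 : κ ≤ ε / 4 := min_le_left _ _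
  have hκ2 : C' * κ ≤ ε / 4 := by
    have h1 : κ ≤ ε / (4 * (C' + 1)) := (min_le_right _ _).trans (min_le_left _ _)
    rw [le_div_iff₀ (by positivity)] at h1
    nlinarith
  have hκ3 : 2 ^ p * ((M : ℝ) ^ (p - 1) * κ) ≤ ε / 4 := by
    have h1 : κ ≤ ε / (4 * 2 ^ p * (M : ℝ) ^ (p - 1)) := (min_le_right _ _).trans (min_le_right _ _)
    rw [le_div_iff₀ (by positivity)] at h1
    linarith
  have hs := stepDensity_mem_Icc hη hm hM0'.le hw
  have hsm := measurable_stepDensity m η w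
  have hbdd : ∀ u : (Fin d → ℝ) → ℝ, Measurable u → ∀ B : ℝ, (∀ x, |u x| ≤ B) →
      Integrable u (cubeMeasure d) := fun u hu B hB =>
    Integrable.of_bound hu.aestronglyMeasurable B (ae_of_all _ hB)
  have hfi : Integrable f (cubeMeasure d) :=
    hbdd f hfm M fun x => by rw [abs_of_nonneg (hf0 x)]; exact hfM x
  have hsi : Integrable (stepDensity m η w) (cubeMeasure d) :=
    hbdd _ hsm M fun x => by rw [abs_of_nonneg (hs x).1]; exact (hs x).2
  have hdi : Integrable (fun x => |f x - stepDensity m η w x|) (cubeMeasure d) :=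
    (hfi.sub hsi).abs
  have hdM : ∀ x, |f x - stepDensity m η w x| ≤ M := fun x => by
    rw [abs_le]
    have := hs x
    constructor <;> linarith [hf0 x, hfM x, this.1, this.2]
  have hhfi : Integrable (fun x => |h x - f x| ^ p) (cubeMeasure d) := by
    refine hi.mono' ((hh.sub hfm).abs.pow_const p).aestronglyMeasurable (ae_of_all _ fun x => ?_)
    rw [Real.norm_of_nonneg (Real.rpow_nonneg (abs_nonneg _) _)]
    refine Real.rpow_le_rpow (abs_nonneg _) ?_ hp0.le
    rw [abs_of_nonneg (sub_nonneg.2 (min_le_left _ _))]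
    linarith [hf0 x]
  have hpt : ∀ x, |h x - stepDensity m η w x| ^ p ≤
      2 ^ p * (|h x - f x| ^ p + (M : ℝ) ^ (p - 1) * |f x - stepDensity m η w x|) := by
    intro x
    have h1 := abs_sub_le (h x) (f x) (stepDensity m η w x)
    refine (Real.rpow_le_rpow (abs_nonneg _) h1 hp0.le).trans
      ((rpow_add_le_two_rpow_mul (abs_nonneg _) (abs_nonneg _) hp0.le).trans ?_)
    gcongr
    rcases (abs_nonneg (f x - stepDensity m η w x)).eq_or_lt with h2 | h2
    · rw [← h2, Real.zero_rpow hp0.ne', mul_zero]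
    · calc |f x - stepDensity m η w x| ^ p
          = |f x - stepDensity m η w x| ^ (p - 1) * |f x - stepDensity m η w x| := by
            rw [← Real.rpow_add_one h2.ne', sub_add_cancel]
        _ ≤ _ := by
            gcongr
            exact hdM x
  have hmaj : Integrable (fun x => 2 ^ p * (|h x - f x| ^ p +
      (M : ℝ) ^ (p - 1) * |f x - stepDensity m η w x|)) (cubeMeasure d) :=
    (hhfi.add (hdi.const_mul _)).const_mul _
  have hpi : Integrable (fun x => |h x - stepDensity m η w x| ^ p) (cubeMeasure d) := by
    refine hmaj.mono' ((hh.sub hsm).abs.pow_const p).aestronglyMeasurable (ae_of_all _ fun x => ?_)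
    rw [Real.norm_of_nonneg (Real.rpow_nonneg (abs_nonneg _) _)]
    exact hpt x
  refine ⟨m, η, w, hm, hη, hη', fun j => (hw j).1, hpi, ?_, ?_, ?_⟩
  · have h1 := integral_mono hpi hmaj hpt
    rw [integral_const_mul, integral_add hhfi (hdi.const_mul _), integral_const_mul] at h1
    rw [lt_div_iff₀ (by positivity)] at hM1
    have h2 : 2 ^ p * ((M : ℝ) ^ (p - 1) * ∫ x, |f x - stepDensity m η w x| ∂(cubeMeasure d))
        ≤ 2 ^ p * ((M : ℝ) ^ (p - 1) * κ) := by gcongr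
    rw [mul_add] at h1
    linarith
  · have h1 : |∫ x, f x ∂(cubeMeasure d) - ∫ x, stepDensity m η w x ∂(cubeMeasure d)| ≤ κ := by
      rw [← integral_sub hfi hsi]
      exact abs_integral_le_integral_abs.trans hint
    rw [abs_le] at h1
    rw [abs_lt] at hM2 ⊢
    constructor <;> linarith
  · have hFb : ∀ u : (Fin d → ℝ) → ℝ, Measurable u → (∀ x, u x ∈ Set.Icc 0 (M : ℝ)) →
        Integrable (fun x => F (u x)) (cubeMeasure d) := by
      intro u hu huM
      obtain ⟨B, hB⟩ :=
        isCompact_Icc.exists_bound_of_continuousOn (hF.continuousOn (s := Set.Icc 0 (M : ℝ)))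
      exact hbdd _ (hF.measurable.comp hu) B fun x => hB _ (huM x)
    have hFf := hFb f hfm fun x => ⟨hf0 x, hfM x⟩
    have hFs := hFb _ hsm hs
    have h1 : |∫ x, F (f x) ∂(cubeMeasure d) - ∫ x, F (stepDensity m η w x) ∂(cubeMeasure d)|
        ≤ ε / 4 + C' * κ := by
      rw [← integral_sub hFf hFs]
      refine abs_integral_le_integral_abs.trans ?_
      have h2 : ∫ x, |F (f x) - F (stepDensity m η w x)| ∂(cubeMeasure d) ≤
          ∫ x, (ε / 4 + C' * |f x - stepDensity m η w x|) ∂(cubeMeasure d) :=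
        integral_mono (hFf.sub hFs).abs ((integrable_const _).add (hdi.const_mul _))
          fun x => hC' _ ⟨hf0 x, hfM x⟩ _ (hs x)
      rw [integral_add (integrable_const _) (hdi.const_mul _), integral_const_mul] at h2
      simp only [integral_const, probReal_univ, one_smul] at h2
      refine h2.trans ?_
      gcongr
    rw [abs_le] at h1
    rw [abs_lt] at hM3 ⊢
    constructor <;> linarith

end StepDensities

/-! ### The cost of a step density -/

section StepCosts

variable {d : ℕ} {N : Seminorm ℝ (Fin d → ℝ)}

/-- The integrand of the functional of the density that governs the asymptotics of order `r`:
`t ^ (d / (d + r))`, and `t log t` for `r = 0`. -/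
noncomputable def densityIntegrand (d : ℕ) (r t : ℝ) : ℝ :=
  if r = 0 then t * Real.log t else t ^ ((d : ℝ) / (d + r))

/-- The limit of the normalized minimal costs of a density with integral `H` and with integral `U`
of its `densityIntegrand`, where `c` is the coefficient of the unit cube. -/
noncomputable def costLimit (d : ℕ) (r c H U : ℝ) : ℝ :=
  if r = 0 then H * Real.log c + (H * Real.log H - U) / d
  else (c ^ r * U ^ (1 + r / d) - H) / r

lemma continuous_densityIntegrand (hd : 1 ≤ d) {r : ℝ} (hr : -(d : ℝ) < r) :
    Continuous (densityIntegrand d r) := by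
  have hdpos : (0 : ℝ) < d := by exact_mod_cast hd
  unfold densityIntegrand
  split_ifs
  · exact Real.continuous_mul_log
  · exact Real.continuous_rpow_const (div_nonneg hdpos.le (by linarith))

lemma densityIntegrand_zero (hd : 1 ≤ d) {r : ℝ} (hr : -(d : ℝ) < r) :
    densityIntegrand d r 0 = 0 := by
  have hdpos : (0 : ℝ) < d := by exact_mod_cast hd
  unfold densityIntegrand
  split_ifs
  · simp
  · exact Real.zero_rpow (div_pos hdpos (by linarith)).ne'

lemma exists_densityIntegrand_bound (hd : 1 ≤ d) {r p : ℝ} (hr : -(d : ℝ) < r)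
    (hpr : (0 < r ∧ p = 1) ∨ (1 < p ∧ d / (d + r) < p)) :
    ∃ C : ℝ, ∀ t, 0 ≤ t → |densityIntegrand d r t| ≤ C * (1 + t ^ p) := by
  have hdpos : (0 : ℝ) < d := by exact_mod_cast hd
  have hdr : 0 < d + r := by linarith
  unfold densityIntegrand
  split_ifs with h0
  · subst h0
    have hp : 1 < p := by
      rcases hpr with h | h
      · exact absurd h.1 (lt_irrefl _)
      · exact h.1
    refine ⟨1 + 1 / (p - 1), fun t ht => ?_⟩
    have hq : 0 < 1 / (p - 1) := by
      have : 0 < p - 1 := by linarith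
      positivity
    have htp : 0 ≤ t ^ p := Real.rpow_nonneg ht p
    rcases ht.eq_or_lt with rfl | ht0
    · simp only [zero_mul, abs_zero]; positivity
    rcases le_total t 1 with h1 | h1
    · have := Real.abs_log_mul_self_lt t ht0 h1
      rw [mul_comm] at this
      nlinarith [mul_nonneg hq.le htp]
    · have hl := Real.log_nonneg h1
      rw [abs_of_nonneg (mul_nonneg ht hl)]
      have h2 := Real.log_le_rpow_div ht (show 0 < p - 1 by linarith)
      have h3 : t * (t ^ (p - 1) / (p - 1)) = 1 / (p - 1) * t ^ p := by
        have h4 : t ^ (p - 1) * t = t ^ p := by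
          rw [← Real.rpow_add_one ht0.ne', sub_add_cancel]
        rw [← h4]; ring
      have h5 := mul_le_mul_of_nonneg_left h2 ht
      rw [h3] at h5
      nlinarith
  · have hsp : d / (d + r) ≤ p := by
      rcases hpr with ⟨h1, rfl⟩ | h
      · rw [div_le_one hdr]; linarith
      · exact h.2.le
    refine ⟨1, fun t ht => ?_⟩
    have hs : 0 ≤ (d : ℝ) / (d + r) := div_nonneg hdpos.le hdr.le
    rw [one_mul, abs_of_nonneg (Real.rpow_nonneg ht _)]
    rcases le_total t 1 with h1 | h1
    · linarith [Real.rpow_le_one ht h1 hs, Real.rpow_nonneg ht p]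
    · linarith [Real.rpow_le_rpow_of_exponent_le h1 hsp]

lemma continuous_costLimit (hd : 1 ≤ d) {r : ℝ} (hr : -(d : ℝ) < r) (c : ℝ) :
    Continuous fun x : ℝ × ℝ => costLimit d r c x.1 x.2 := by
  have hdpos : (0 : ℝ) < d := by exact_mod_cast hd
  unfold costLimit
  split_ifs
  · exact (continuous_fst.mul continuous_const).add
      (((Real.continuous_mul_log.comp continuous_fst).sub continuous_snd).div_const _)
  · have hpos : 0 ≤ 1 + r / d := by
      have h1 : 1 + r / d = (d + r) / d := by field_simp
      rw [h1]
      exact div_nonneg (by linarith) hdpos.le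
    exact ((continuous_const.mul
      ((Real.continuous_rpow_const hpos).comp continuous_snd)).sub continuous_fst).div_const _

/-- The share of the points allotted to a cell with density value `w`, per unit volume, is
proportional to `w ^ (d / (d + r))`; with this choice the cost is the predicted limit. -/
lemma sum_boxCox_eq_costLimit {ι : Type*} [Fintype ι] (hd : 1 ≤ d) {r c v : ℝ}
    (hr : -(d : ℝ) < r) (hc : 0 < c) {w : ι → ℝ} (hw : ∀ j, 0 < w j) {S : ℝ}
    (hS : S = ∑ j, v * w j ^ ((d : ℝ) / (d + r))) (hS0 : 0 < S) :
    ∑ j, v * w j * boxCox r (c * (w j ^ ((d : ℝ) / (d + r)) / S) ^ (-(1 / d : ℝ))) =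
      costLimit d r c (∑ j, v * w j) (∑ j, v * densityIntegrand d r (w j)) := by
  have hdpos : (0 : ℝ) < d := by exact_mod_cast hd
  have hdr : 0 < d + r := by linarith
  unfold costLimit densityIntegrand
  split_ifs with h0
  · subst h0
    simp only [add_zero, div_self hdpos.ne', Real.rpow_one, boxCox_zero] at hS ⊢
    have hterm : ∀ j, v * w j * Real.log (c * (w j / S) ^ (-(1 / d : ℝ))) =
        v * w j * Real.log c + ((v * w j) * Real.log S - v * (w j * Real.log (w j))) / d := by
      intro j
      have hq : 0 < w j / S := div_pos (hw j) hS0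
      rw [Real.log_mul hc.ne' (Real.rpow_pos_of_pos hq _).ne', Real.log_rpow hq,
        Real.log_div (hw j).ne' hS0.ne']
      ring
    simp_rw [hterm]
    rw [Finset.sum_add_distrib, ← Finset.sum_mul, ← Finset.sum_div, Finset.sum_sub_distrib,
      ← Finset.sum_mul, ← hS]
  · have hterm : ∀ j, v * w j * boxCox r (c * (w j ^ ((d : ℝ) / (d + r)) / S) ^ (-(1 / d : ℝ))) =
        (c ^ r * S ^ (r / d) * (v * w j ^ ((d : ℝ) / (d + r))) - v * w j) / r := by
      intro j
      have hws : 0 < w j ^ ((d : ℝ) / (d + r)) := Real.rpow_pos_of_pos (hw j) _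
      have hq : 0 < w j ^ ((d : ℝ) / (d + r)) / S := div_pos hws hS0
      rw [boxCox_of_ne h0, Real.mul_rpow hc.le (Real.rpow_nonneg hq.le _), ← Real.rpow_mul hq.le,
        Real.div_rpow hws.le hS0.le, ← Real.rpow_mul (hw j).le]
      have e1 : -(1 / (d : ℝ)) * r = -(r / d) := by ring
      have e2 : w j * w j ^ ((d : ℝ) / (d + r) * -(r / d)) = w j ^ ((d : ℝ) / (d + r)) := by
        rw [← Real.rpow_one_add' (hw j).le]
        · congr 1; field_simp; ring
        · have : 1 + (d : ℝ) / (d + r) * -(r / d) = d / (d + r) := by field_simp; ring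
          rw [this]; positivity
      rw [e1, Real.rpow_neg hS0.le, ← e2]
      field_simp
    simp_rw [hterm]
    rw [← Finset.sum_div, Finset.sum_sub_distrib, ← Finset.mul_sum, ← hS, Real.rpow_add hS0,
      Real.rpow_one]
    ring

/-- The optimal allocation of points to cells, by convexity: no distribution of at most `T` points
over the cells has a smaller cost than the predicted limit. -/
lemma costLimit_le_sum {ι : Type*} [Fintype ι] [Nonempty ι] (hd : 1 ≤ d) {r c ℓ T : ℝ}
    (hr : -(d : ℝ) < r) (hc : 0 < c) (hℓ : 0 < ℓ) (hT : 0 < T) {w : ι → ℝ} (hw : ∀ j, 0 < w j)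
    {k : ι → ℕ} (hk : ∀ j, 0 < k j) (hkT : (∑ j, (k j : ℝ)) ≤ T) :
    costLimit d r c (∑ j, ℓ ^ d * w j) (∑ j, ℓ ^ d * densityIntegrand d r (w j)) ≤
      ∑ j, ℓ ^ d * w j *
        boxCox r (T ^ (1 / d : ℝ) * ℓ * (c * (k j : ℝ) ^ (-(1 / d : ℝ)))) := by
  have hdpos : (0 : ℝ) < d := by exact_mod_cast hd
  have hdr : 0 < d + r := by linarith
  set v := ℓ ^ d with hv
  have hv0 : 0 < v := by positivity
  set S := ∑ j, v * w j ^ ((d : ℝ) / (d + r)) with hS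
  have hws : ∀ j, 0 < w j ^ ((d : ℝ) / (d + r)) := fun j => Real.rpow_pos_of_pos (hw j) _
  have hS0 : 0 < S := Finset.sum_pos (fun j _ => mul_pos hv0 (hws j)) Finset.univ_nonempty
  rw [← sum_boxCox_eq_costLimit hd hr hc hw hS hS0]
  set ρ : ι → ℝ := fun j => w j ^ ((d : ℝ) / (d + r)) / S with hρ
  have hρ0 : ∀ j, 0 < ρ j := fun j => div_pos (hws j) hS0
  have hρsum : ∑ j, v * ρ j = 1 := by
    simp only [hρ, mul_div_assoc']
    rw [← Finset.sum_div, ← hS, div_self hS0.ne']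
  set κ := c ^ r * S ^ ((d + r) / d) / d with hκ
  have hκ0 : 0 ≤ κ := by positivity
  have hterm : ∀ j, v * w j * boxCox r (c * ρ j ^ (-(1 / d : ℝ)))
      + κ * (v * ρ j - k j / T) ≤ v * w j *
        boxCox r (T ^ (1 / d : ℝ) * ℓ * (c * (k j : ℝ) ^ (-(1 / d : ℝ)))) := by
    intro j
    have hkj : (0 : ℝ) < k j := by exact_mod_cast hk j
    set t := c * ρ j ^ (-(1 / d : ℝ)) with ht
    set u := T ^ (1 / d : ℝ) * ℓ * (c * (k j : ℝ) ^ (-(1 / d : ℝ))) with hu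
    have hρp := Real.rpow_pos_of_pos (hρ0 j) (-(1 / d : ℝ))
    have hkp := Real.rpow_pos_of_pos hkj (-(1 / d : ℝ))
    have hTp := Real.rpow_pos_of_pos hT (1 / d : ℝ)
    have ht0 : 0 < t := mul_pos hc hρp
    have hu0 : 0 < u := by positivity
    have htan := boxCox_tangent hdpos hr.le ht0 hu0
    have hpow : ∀ x : ℝ, 0 < x → (x ^ (-(1 / d : ℝ))) ^ (-(d : ℝ)) = x := by
      intro x hx
      rw [← Real.rpow_mul hx.le]
      have : -(1 / (d : ℝ)) * -(d : ℝ) = 1 := by field_simp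
      rw [this, Real.rpow_one]
    have e1 : t ^ (-(d : ℝ)) = c ^ (-(d : ℝ)) * ρ j := by
      rw [ht, Real.mul_rpow hc.le hρp.le, hpow _ (hρ0 j)]
    have e2 : u ^ (-(d : ℝ)) = c ^ (-(d : ℝ)) * (k j / (v * T)) := by
      rw [hu, Real.mul_rpow (by positivity) (by positivity), Real.mul_rpow hTp.le hℓ.le,
        Real.mul_rpow hc.le hkp.le, hpow _ hkj, ← Real.rpow_mul hT.le, Real.rpow_neg hℓ.le,
        Real.rpow_natCast, ← hv]
      have : 1 / (d : ℝ) * -(d : ℝ) = -1 := by field_simp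
      rw [this, Real.rpow_neg_one]
      field_simp
    have e3 : w j * (t ^ (r + d) * c ^ (-(d : ℝ))) = c ^ r * S ^ ((d + r) / d) := by
      rw [ht, Real.mul_rpow hc.le hρp.le, ← Real.rpow_mul (hρ0 j).le, hρ]
      simp only
      rw [Real.div_rpow (hws j).le hS0.le, ← Real.rpow_mul (hw j).le]
      have h1 : (d : ℝ) / (d + r) * (-(1 / d) * (r + d)) = -1 := by field_simp; ring
      have h2 : -(1 / (d : ℝ)) * (r + d) = -((d + r) / d) := by ring
      rw [h1, h2, Real.rpow_neg_one, Real.rpow_neg hS0.le, Real.rpow_add hc, Real.rpow_neg hc.le]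
      have hwj := hw j
      have := Real.rpow_pos_of_pos hS0 ((d + r) / d)
      have := Real.rpow_pos_of_pos hc d
      field_simp
    rw [e1, e2] at htan
    have h3 := mul_le_mul_of_nonneg_left htan (mul_pos hv0 (hw j)).le
    refine le_trans (le_of_eq ?_) h3
    rw [mul_add]
    congr 1
    have : v * w j * (t ^ (r + d) *
        ((c ^ (-(d : ℝ)) * ρ j - c ^ (-(d : ℝ)) * (k j / (v * T))) / d))
        = (w j * (t ^ (r + d) * c ^ (-(d : ℝ)))) / d * (v * (ρ j - k j / (v * T))) := by ring
    rw [this, e3, hκ]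
    congr 1
    field_simp
  have hsum := Finset.sum_le_sum fun j (_ : j ∈ Finset.univ) => hterm j
  rw [Finset.sum_add_distrib, ← Finset.mul_sum, Finset.sum_sub_distrib, hρsum,
    ← Finset.sum_div] at hsum
  have h4 : 0 ≤ κ * (1 - (∑ j, (k j : ℝ)) / T) :=
    mul_nonneg hκ0 (sub_nonneg.2 ((div_le_one hT).2 hkT))
  linarith

/-- Lower bound for the cost of a step density, for sets of points that cover the unit cube so finely
that a shrunk grid cube is served by points of its own grid cube only. -/
lemma costLimit_le_integral_stepDensity (hd : 1 ≤ d) (hN : ∀ x, N x = 0 → x = 0) {r : ℝ}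
    (hr : -(d : ℝ) < r) {κ₁ : ℝ} (hκ₁ : 0 < κ₁) (hlow : ∀ x, κ₁ * ‖x‖ ≤ N x)
    {m : ℕ} {η : ℝ} (hm : 0 < m) (hη : 0 < η) (hη' : η < 1 / 2) {w : (Fin d → Fin m) → ℝ}
    (hw : ∀ j, 0 < w j) {A : Finset (Fin d → ℝ)} (hA : A.Nonempty) {T : ℝ}
    (hT : (A.card : ℝ) ≤ T) (hcov : ∀ x ∈ unitCube d, finDist N A x < κ₁ * (η / m)) :
    costLimit d r (unitCoeff N r) (∫ x, stepDensity m η w x ∂(cubeMeasure d))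
        (∫ x, densityIntegrand d r (stepDensity m η w x) ∂(cubeMeasure d)) ≤
      ∫ x, stepDensity m η w x * boxCox r (T ^ (1 / d : ℝ) * finDist N A x)
        ∂(cubeMeasure d) := by
  have hm' : (0 : ℝ) < m := by exact_mod_cast hm
  have hT0 : 0 < T := lt_of_lt_of_le (by exact_mod_cast hA.card_pos) hT
  have hlam : 0 < T ^ (1 / d : ℝ) := Real.rpow_pos_of_pos hT0 _
  have hℓ : 0 < (1 - 2 * η) / m := div_pos (by linarith) hm'
  have : Nonempty (Fin d → Fin m) := ⟨fun _ => ⟨0, hm⟩⟩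
  classical
  set B : (Fin d → Fin m) → Finset (Fin d → ℝ) := fun j =>
    A.filter (· ∈ cell (corner m j) (1 / m)) with hB
  have hnear : ∀ j, ∀ x ∈ innerCell m η j, ∃ a ∈ B j, finDist N A x = N (x - a) := by
    intro j x hx
    obtain ⟨a, ha, hax⟩ := finDist_exists (N := N) hA x
    have h1 := hcov x (innerCell_subset_unitCube hη j hm hx)
    rw [hax] at h1
    have h2 : ‖x - a‖ < η / m := lt_of_mul_lt_mul_left ((hlow _).trans_lt h1) hκ₁.le
    exact ⟨a, Finset.mem_filter.2 ⟨ha, mem_cell_of_near_innerCell hx h2⟩, hax⟩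
  have hBne : ∀ j, (B j).Nonempty := by
    intro j
    have hmem : (fun i => corner m j i + η / m) + ((1 - 2 * η) / m) • (fun _ => 1)
        ∈ innerCell m η j := (mem_cell_affine hℓ).2 (by rw [mem_unitCube]; simp)
    obtain ⟨a, ha, -⟩ := hnear j _ hmem
    exact ⟨a, ha⟩
  have hdist : ∀ j, ∀ x ∈ innerCell m η j, finDist N A x = finDist N (B j) x := by
    intro j x hx
    obtain ⟨a, ha, hax⟩ := hnear j x hx
    refine le_antisymm (finDist_anti (hBne j) (Finset.filter_subset _ _) x) ?_
    rw [hax]; exact finDist_le ha x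
  have hcardsum : (∑ j, ((B j).card : ℝ)) ≤ T := by
    refine le_trans ?_ hT
    have : ∑ j, (B j).card ≤ A.card := by
      rw [← Finset.card_biUnion]
      · exact Finset.card_le_card (Finset.biUnion_subset.2 fun j _ => Finset.filter_subset _ _)
      · intro j _ j' _ hne
        refine Finset.disjoint_left.2 fun a ha ha' => hne ?_
        exact cell_corner_index_unique (Finset.mem_filter.1 ha).2 (Finset.mem_filter.1 ha').2
    exact_mod_cast this
  rw [integral_comp_stepDensity hη hη' hm w (densityIntegrand_zero hd hr),
    integral_comp_stepDensity hη hη' hm w (F := fun t => t) rfl,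
    integral_stepDensity_mul hη hm w (integrable_boxCox_finDist hd hN hr hA hlam)]
  refine (costLimit_le_sum hd hr (unitCoeff_pos (N := N) hd hN hr) hℓ hT0 hw
    (fun j => (hBne j).card_pos) hcardsum).trans ?_
  refine Finset.sum_le_sum fun j _ => ?_
  rw [mul_comm _ (w j), mul_assoc (w j)]
  refine mul_le_mul_of_nonneg_left ?_ (hw j).le
  refine (le_setIntegral_cell hd hN hr (hBne j) (fun i => corner m j i + η / m) hℓ hlam).trans
    (le_of_eq ?_)
  refine setIntegral_congr_fun (measurableSet_innerCell m η j) fun x hx => ?_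
  simp only [hdist j x hx]

/-- Upper bound for the cost of a step density, attained by near-optimal sets in the shrunk cubes,
where a cube receives a share of the points proportional to the power `d / (d + r)` of
the density. -/
lemma exists_integral_stepDensity_le (hd : 1 ≤ d) (hN : ∀ x, N x = 0 → x = 0) {r : ℝ}
    (hr : -(d : ℝ) < r) {m : ℕ} {η : ℝ} (hm : 0 < m) (hη : 0 < η) (hη' : η < 1 / 2)
    {w : (Fin d → Fin m) → ℝ} (hw : ∀ j, 0 < w j) {a τ : ℝ} (ha : 0 < a) (hτ : 0 < τ)
    (haτ : 1 < a ^ d * τ) :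
    ∀ᶠ n : ℕ in atTop, ∃ A : Finset (Fin d → ℝ), A.Nonempty ∧ (A.card : ℝ) ≤ τ * n ∧
      ∀ A', A ⊆ A' →
        ∫ x, stepDensity m η w x * boxCox r ((n : ℝ) ^ (1 / d : ℝ) * finDist N A' x)
          ∂(cubeMeasure d) ≤
        a ^ r * costLimit d r (unitCoeff N r) (∫ x, stepDensity m η w x ∂(cubeMeasure d))
          (∫ x, densityIntegrand d r (stepDensity m η w x) ∂(cubeMeasure d))
        + boxCox r a * ∫ x, stepDensity m η w x ∂(cubeMeasure d) := by
  have hm' : (0 : ℝ) < m := by exact_mod_cast hm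
  have hdpos : (0 : ℝ) < d := by exact_mod_cast hd
  have : Nonempty (Fin d → Fin m) := ⟨fun _ => ⟨0, hm⟩⟩
  set ℓ := (1 - 2 * η) / m with hℓdef
  have hℓ : 0 < ℓ := div_pos (by linarith) hm'
  set v := ℓ ^ d with hv
  have hv0 : 0 < v := by positivity
  set c := unitCoeff N r with hcdef
  have hc : 0 < c := unitCoeff_pos (N := N) hd hN hr
  set S := ∑ j, v * w j ^ ((d : ℝ) / (d + r)) with hS
  have hws : ∀ j, 0 < w j ^ ((d : ℝ) / (d + r)) := fun j => Real.rpow_pos_of_pos (hw j) _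
  have hS0 : 0 < S := Finset.sum_pos (fun j _ => mul_pos hv0 (hws j)) Finset.univ_nonempty
  set ρ : (Fin d → Fin m) → ℝ := fun j => w j ^ ((d : ℝ) / (d + r)) / S with hρ
  have hρ0 : ∀ j, 0 < ρ j := fun j => div_pos (hws j) hS0
  have hρsum : ∑ j, v * ρ j = 1 := by
    simp only [hρ, mul_div_assoc']
    rw [← Finset.sum_div, ← hS, div_self hS0.ne']
  -- split the slack `1 < a ^ d * τ` between the unit cube constant and the rounding
  set b := (√(a ^ d * τ)) ^ (1 / d : ℝ) with hb
  have hq1 : 1 < √(a ^ d * τ) := by rw [Real.lt_sqrt zero_le_one]; simpa using haτ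
  have hb1 : 1 < b := Real.one_lt_rpow hq1 (by positivity)
  have hbd : b ^ d = √(a ^ d * τ) := by
    rw [hb, one_div, Real.rpow_inv_natCast_pow (Real.sqrt_nonneg _) (by omega)]
  have hbd' : b ^ d < a ^ d * τ := by
    rw [hbd]
    have h1 := Real.sq_sqrt (show 0 ≤ a ^ d * τ by positivity)
    nlinarith
  have hcb : c < c * b := by nlinarith
  obtain ⟨k₀, hk₀⟩ := exists_near_optimal_unitCube (N := N) hd hN hr hcb
  set q : (Fin d → Fin m) → ℕ → ℕ := fun j n => ⌊τ * ρ j * v * n⌋₊ with hq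
  have hq_tendsto : ∀ j, Tendsto (fun n : ℕ => τ * ρ j * v * n) atTop atTop := fun j =>
    Tendsto.const_mul_atTop (by have := hρ0 j; positivity) tendsto_natCast_atTop_atTop
  have hev : ∀ j, ∀ᶠ n : ℕ in atTop, k₀ ≤ q j n ∧ 1 ≤ q j n ∧
      b ^ d * (ρ j * v * n) ≤ a ^ d * q j n := by
    intro j
    have h1 := (tendsto_nat_floor_atTop.comp (hq_tendsto j)).eventually_ge_atTop (max k₀ 1)
    have h2 := ((hq_tendsto j).const_mul_atTop
      (show 0 < (a ^ d * τ - b ^ d) / τ by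
        have : 0 < a ^ d * τ - b ^ d := by linarith
        positivity)).eventually_ge_atTop (a ^ d)
    filter_upwards [h1, h2] with n hn1 hn2
    refine ⟨(le_max_left _ _).trans hn1, (le_max_right _ _).trans hn1, ?_⟩
    have h3 : τ * ρ j * v * n < q j n + 1 := Nat.lt_floor_add_one _
    have h4 : (a ^ d * τ - b ^ d) / τ * (τ * ρ j * v * n)
        = (a ^ d * τ - b ^ d) * (ρ j * v * n) := by field_simp
    rw [h4] at hn2
    have h5 := mul_le_mul_of_nonneg_left h3.le (show 0 ≤ a ^ d by positivity)
    nlinarith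
  filter_upwards [eventually_all.2 hev, eventually_gt_atTop 0] with n hn hn0
  have hn0' : (0 : ℝ) < n := by exact_mod_cast hn0
  have hlam : 0 < (n : ℝ) ^ (1 / d : ℝ) := Real.rpow_pos_of_pos hn0' _
  choose E hE hEcard hEint using fun j => hk₀ (q j n) (hn j).1
  set z : (Fin d → Fin m) → (Fin d → ℝ) := fun j i => corner m j i + η / m with hz
  set A : Finset (Fin d → ℝ) :=
    Finset.univ.biUnion fun j => (E j).image fun y => z j + ℓ • y with hA
  have hsub : ∀ j, ((E j).image fun y => z j + ℓ • y) ⊆ A := fun j =>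
    Finset.subset_biUnion_of_mem (fun j => (E j).image fun y => z j + ℓ • y) (Finset.mem_univ j)
  have hAne : A.Nonempty := ((hE (Classical.arbitrary _)).image _).mono (hsub _)
  refine ⟨A, hAne, ?_, fun A' hAA' => ?_⟩
  · calc (A.card : ℝ) ≤ ∑ j, (q j n : ℝ) := by
          exact_mod_cast Finset.card_biUnion_le.trans
            (Finset.sum_le_sum fun j _ => Finset.card_image_le.trans (hEcard j))
      _ ≤ ∑ j, τ * n * (v * ρ j) := by
          refine Finset.sum_le_sum fun j _ => ?_
          refine (Nat.floor_le (by have := hρ0 j; positivity)).trans (le_of_eq (by ring))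
      _ = τ * n := by rw [← Finset.mul_sum, hρsum, mul_one]
  · have hA'ne := hAne.mono hAA'
    rw [integral_comp_stepDensity hη hη' hm w (densityIntegrand_zero hd hr),
      integral_comp_stepDensity hη hη' hm w (F := fun t => t) rfl,
      integral_stepDensity_mul hη hm w (integrable_boxCox_finDist hd hN hr hA'ne hlam),
      ← sum_boxCox_eq_costLimit hd hr hc hw hS hS0, Finset.mul_sum, Finset.mul_sum,
      ← Finset.sum_add_distrib]
    refine Finset.sum_le_sum fun j _ => ?_
    have hρp := Real.rpow_pos_of_pos (hρ0 j) (-(1 / d : ℝ))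
    have hqj : (0 : ℝ) < q j n := by exact_mod_cast (hn j).2.1
    have hqp := Real.rpow_pos_of_pos hqj (-(1 / d : ℝ))
    have h1 := setIntegral_cell_le (N := N) hd hN hr (hE j) (z j) hℓ hlam ((hsub j).trans hAA')
    have h2 := hEint j ((n : ℝ) ^ (1 / d : ℝ) * ℓ) (by positivity)
    have h3 : (n : ℝ) ^ (1 / d : ℝ) * ℓ * (c * b * (q j n : ℝ) ^ (-(1 / d : ℝ)))
        ≤ a * (c * ρ j ^ (-(1 / d : ℝ))) := by
      have hpow : ∀ x : ℝ, 0 < x → (x ^ (-(1 / d : ℝ))) ^ d = x⁻¹ := by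
        intro x hx
        rw [← Real.rpow_natCast, ← Real.rpow_mul hx.le, ← Real.rpow_neg_one]
        congr 1; field_simp
      have hpown : ((n : ℝ) ^ (1 / d : ℝ)) ^ d = n := by
        rw [one_div, Real.rpow_inv_natCast_pow hn0'.le (by omega)]
      have hb0 : 0 < b := by linarith
      refine le_of_pow_le_pow_left₀ (n := d) (by omega) (by positivity) ?_
      simp only [mul_pow]
      rw [hpow _ hqj, hpow _ (hρ0 j), hpown, ← hv]
      have h4 := (hn j).2.2
      have hρj := hρ0 j
      have hcd : 0 < c ^ d := by positivity
      rw [show (n : ℝ) * v * (c ^ d * b ^ d * (q j n : ℝ)⁻¹)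
        = c ^ d * (b ^ d * (ρ j * v * n)) / (q j n * ρ j) by field_simp,
        show a ^ d * (c ^ d * (ρ j)⁻¹) = c ^ d * (a ^ d * q j n) / (q j n * ρ j) by field_simp]
      gcongr
    have h5 : boxCox r ((n : ℝ) ^ (1 / d : ℝ) * ℓ * (c * b * (q j n : ℝ) ^ (-(1 / d : ℝ))))
        ≤ a ^ r * boxCox r (c * ρ j ^ (-(1 / d : ℝ))) + boxCox r a := by
      rw [← boxCox_mul r ha (mul_pos hc hρp)]
      exact boxCox_mono r (by positivity) h3
    have h6 := mul_le_mul_of_nonneg_left (h1.trans (mul_le_mul_of_nonneg_left (h2.trans h5)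
      hv0.le)) (hw j).le
    refine h6.trans (le_of_eq ?_)
    ring

end StepCosts

/-! ### The limit of the costs for a general density -/

section CostLimits

variable {d : ℕ} {N : Seminorm ℝ (Fin d → ℝ)}

/-- A fraction `σ` of `n` points suffices to cover the unit cube at the scale `n ^ (-1/d)`. -/
lemma exists_covering (hd : 1 ≤ d) (hN : ∀ x, N x = 0 → x = 0) {σ : ℝ} (hσ : 0 < σ) :
    ∃ K : ℝ, 0 < K ∧ ∀ᶠ n : ℕ in atTop, ∃ G : Finset (Fin d → ℝ), G.Nonempty ∧
      (G.card : ℝ) ≤ σ * n ∧ ∀ x ∈ unitCube d, (n : ℝ) ^ (1 / d : ℝ) * finDist N G x ≤ K := by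
  obtain ⟨κ₁, κ₂, h1, h2, hb⟩ := exists_norm_bounds hN
  have hσp := Real.rpow_pos_of_pos hσ (1 / d : ℝ)
  refine ⟨2 * κ₂ / σ ^ (1 / d : ℝ), by positivity, ?_⟩
  filter_upwards [(tendsto_natCast_atTop_atTop.const_mul_atTop hσ).eventually_ge_atTop (1 : ℝ)]
    with n hn
  have hn0 : (0 : ℝ) < n := by
    by_contra hneg
    have : (n : ℝ) = 0 := le_antisymm (not_lt.1 hneg) (Nat.cast_nonneg n)
    rw [this] at hn
    linarith
  have hnp := Real.rpow_pos_of_pos hn0 (1 / d : ℝ)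
  set y := (σ * n) ^ (1 / d : ℝ) with hy
  have hy1 : 1 ≤ y := Real.one_le_rpow hn (by positivity)
  set m := ⌊y⌋₊ with hm
  have hm1 : 1 ≤ m := Nat.le_floor (by simpa using hy1)
  have hm0 : (0 : ℝ) < m := by exact_mod_cast hm1
  have hmy : (m : ℝ) ≤ y := Nat.floor_le (by linarith)
  have hym : y < m + 1 := Nat.lt_floor_add_one _
  refine ⟨gridPoints d m, gridPoints_nonempty hm1, ?_, fun x hx => ?_⟩
  · have hyd : y ^ d = σ * n := by
      rw [hy, one_div, Real.rpow_inv_natCast_pow (by positivity) (by omega)]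
    rw [← hyd]
    have h3 : ((gridPoints d m).card : ℝ) ≤ (m : ℝ) ^ d := by exact_mod_cast card_gridPoints_le m
    refine h3.trans ?_
    gcongr
  · have h3 := finDist_gridPoints_le h2.le (fun x => (hb x).2) hm1 hx
    have hm2 : y ≤ 2 * m := by
      have : (1 : ℝ) ≤ m := by exact_mod_cast hm1
      linarith
    rw [hy, Real.mul_rpow hσ.le hn0.le] at hm2
    calc (n : ℝ) ^ (1 / d : ℝ) * finDist N (gridPoints d m) x
        ≤ (n : ℝ) ^ (1 / d : ℝ) * (κ₂ / m) := by gcongr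
      _ ≤ 2 * κ₂ / σ ^ (1 / d : ℝ) := by
          rw [mul_div_assoc', div_le_div_iff₀ hm0 hσp]
          nlinarith

/-- Replacing the density changes the cost by at most a multiple of the `L^p` distance. -/
lemma abs_cost_sub_cost_le {p B K : ℝ} {f φ : (Fin d → ℝ) → ℝ} {g : (Fin d → ℝ) → ℝ}
    (hf : Integrable (fun x => f x * φ x) (cubeMeasure d))
    (hg : Integrable (fun x => g x * φ x) (cubeMeasure d))
    (hB : ∫ x, |f x - g x| * |φ x| ∂(cubeMeasure d)
      ≤ B * (∫ x, |f x - g x| ^ p ∂(cubeMeasure d)) ^ (1 / p))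
    (hK : B * (∫ x, |f x - g x| ^ p ∂(cubeMeasure d)) ^ (1 / p) ≤ K) :
    |∫ x, f x * φ x ∂(cubeMeasure d) - ∫ x, g x * φ x ∂(cubeMeasure d)| ≤ K := by
  rw [← integral_sub hf hg]
  refine abs_integral_le_integral_abs.trans (le_trans (le_of_eq ?_) (hB.trans hK))
  refine integral_congr_ae (ae_of_all _ fun x => ?_)
  simp only
  rw [← sub_mul, abs_mul]

/-- Enlarging the set of points decreases the cost. -/
lemma cost_anti (hd : 1 ≤ d) (hN : ∀ x, N x = 0 → x = 0) {r : ℝ} {h : (Fin d → ℝ) → ℝ}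
    (h0 : ∀ x, 0 ≤ h x) {A A' : Finset (Fin d → ℝ)} (hA : A.Nonempty) (hAA' : A ⊆ A') {lam : ℝ}
    (hlam : 0 < lam)
    (hi : Integrable (fun x => h x * boxCox r (lam * finDist N A x)) (cubeMeasure d))
    (hi' : Integrable (fun x => h x * boxCox r (lam * finDist N A' x)) (cubeMeasure d)) :
    ∫ x, h x * boxCox r (lam * finDist N A' x) ∂(cubeMeasure d) ≤
      ∫ x, h x * boxCox r (lam * finDist N A x) ∂(cubeMeasure d) := by
  refine integral_mono_ae hi' hi ?_
  filter_upwards [ae_notMem_finset hd A'] with x hx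
  refine mul_le_mul_of_nonneg_left ?_ (h0 x)
  exact boxCox_mono r (scaled_finDist_pos hN hlam (hA.mono hAA') hx)
    (mul_le_mul_of_nonneg_left (finDist_anti hA hAA' x) hlam.le)

/-- The predicted limit for the density `h`. -/
noncomputable def densityCostLimit (N : Seminorm ℝ (Fin d → ℝ)) (r : ℝ)
    (h : (Fin d → ℝ) → ℝ) : ℝ :=
  costLimit d r (unitCoeff N r) (∫ x, h x ∂(cubeMeasure d))
    (∫ x, densityIntegrand d r (h x) ∂(cubeMeasure d))

/-- Step densities that are close to `h` in `L^p`, in mass and in the predicted limit. -/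
lemma exists_stepDensity_near (hd : 1 ≤ d) {r p : ℝ}
    (hr : -(d : ℝ) < r) (hp : 1 ≤ p) (hpr : (0 < r ∧ p = 1) ∨ (1 < p ∧ d / (d + r) < p))
    {h : (Fin d → ℝ) → ℝ} (hh : Measurable h) (h0 : ∀ x, 0 ≤ h x)
    (hi : Integrable (fun x => h x ^ p) (cubeMeasure d)) {B : ℝ}
    (hB : 0 ≤ B) {ε : ℝ} (hε : 0 < ε) :
    ∃ (m : ℕ) (η : ℝ) (w : (Fin d → Fin m) → ℝ), 0 < m ∧ 0 < η ∧ η < 1 / 2 ∧ (∀ j, 0 < w j) ∧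
      Integrable (fun x => |h x - stepDensity m η w x| ^ p) (cubeMeasure d) ∧
      B * (∫ x, |h x - stepDensity m η w x| ^ p ∂(cubeMeasure d)) ^ (1 / p) ≤ ε ∧
      |∫ x, stepDensity m η w x ∂(cubeMeasure d) - ∫ x, h x ∂(cubeMeasure d)| < ε ∧
      |densityCostLimit N r (stepDensity m η w) - densityCostLimit N r h| < ε := by
  have hp0 : 0 < p := by linarith
  obtain ⟨C, hC⟩ := exists_densityIntegrand_bound hd hr hpr
  obtain ⟨δ, hδ, hcont⟩ := Metric.continuousAt_iff.1
    ((continuous_costLimit hd hr (unitCoeff N r)).continuousAt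
      (x := (∫ x, h x ∂(cubeMeasure d), ∫ x, densityIntegrand d r (h x) ∂(cubeMeasure d)))) ε hε
  set κ := min (min ε δ) ((ε / (B + 1)) ^ p) with hκ
  have hκ0 : 0 < κ := by positivity
  obtain ⟨m, η, w, hm, hη, hη', hw, hint, h1, h2, h3⟩ := exists_stepDensity_approx hp hh h0 hi
    (continuous_densityIntegrand hd hr) hC hκ0
  have hκδ : κ ≤ δ := (min_le_left _ _).trans (min_le_right _ _)
  refine ⟨m, η, w, hm, hη, hη', hw, hint, ?_, h2.trans_le ((min_le_left _ _).trans
    (min_le_left _ _)), ?_⟩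
  · have h4 : (∫ x, |h x - stepDensity m η w x| ^ p ∂(cubeMeasure d)) ^ (1 / p) ≤ ε / (B + 1) := by
      calc _ ≤ ((ε / (B + 1)) ^ p) ^ (1 / p) :=
            Real.rpow_le_rpow (integral_nonneg fun x => Real.rpow_nonneg (abs_nonneg _) _)
              (h1.le.trans (min_le_right _ _)) (by positivity)
        _ = ε / (B + 1) := by
            rw [← Real.rpow_mul (by positivity), mul_one_div_cancel hp0.ne', Real.rpow_one]
    calc _ ≤ B * (ε / (B + 1)) := by gcongr
      _ ≤ ε := by
          rw [mul_div_assoc', div_le_iff₀ (by positivity)]; nlinarith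
  · have h5 := hcont (x := (∫ x, stepDensity m η w x ∂(cubeMeasure d),
      ∫ x, densityIntegrand d r (stepDensity m η w x) ∂(cubeMeasure d))) (by
        rw [Prod.dist_eq, max_lt_iff]
        exact ⟨by rw [Real.dist_eq]; exact h2.trans_le hκδ,
          by rw [Real.dist_eq]; exact h3.trans_le hκδ⟩)
    rwa [Real.dist_eq] at h5

/-- A scale factor slightly above `1` changes the transformed cost only slightly. -/
lemma exists_scale (r L H : ℝ) {ε : ℝ} (hε : 0 < ε) :
    ∃ a : ℝ, 1 < a ∧ a ^ r * L + boxCox r a * H < L + ε ∧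
      L - ε < (a ^ r)⁻¹ * (L - boxCox r a * H) := by
  have c1 : ContinuousAt (fun a : ℝ => a ^ r) 1 :=
    Real.continuousAt_rpow_const 1 r (Or.inl one_ne_zero)
  have c2 : ContinuousAt (boxCox r) 1 := continuousAt_boxCox r one_pos
  have t1 : ContinuousAt (fun a : ℝ => a ^ r * L + boxCox r a * H) 1 :=
    (c1.mul continuousAt_const).add (c2.mul continuousAt_const)
  have t2 : ContinuousAt (fun a : ℝ => (a ^ r)⁻¹ * (L - boxCox r a * H)) 1 :=
    (c1.inv₀ (by simp)).mul (continuousAt_const.sub (c2.mul continuousAt_const))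
  have e1 := t1.eventually_lt_const (u := L + ε) (by simp [boxCox_one, hε])
  have e2 := t2.eventually_const_lt (u := L - ε) (by simp [boxCox_one, hε])
  obtain ⟨a, ⟨ha1, ha2⟩, ha3⟩ := (((e1.and e2).filter_mono nhdsWithin_le_nhds).and
    (self_mem_nhdsWithin (s := Set.Ioi (1 : ℝ)))).exists
  exact ⟨a, ha3, ha1, ha2⟩

/-- Adding a covering grid to `A` makes its points local, as needed for step densities, and bounds the
rescaled distances from above, as needed to replace `h` by a step density. The grid enlarges `A` by
a factor `a ^ d` close to `1`, which is absorbed by rescaling the distances by `a`. -/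
lemma eventually_cost_ge (hd : 1 ≤ d) (hN : ∀ x, N x = 0 → x = 0) {r p : ℝ}
    (hr : -(d : ℝ) < r) (hp : 1 ≤ p) (hpr : (0 < r ∧ p = 1) ∨ (1 < p ∧ d / (d + r) < p))
    {h : (Fin d → ℝ) → ℝ} (hh : Measurable h) (h0 : ∀ x, 0 ≤ h x)
    (hi : Integrable (fun x => h x ^ p) (cubeMeasure d)) {ε : ℝ} (hε : 0 < ε) :
    ∀ᶠ n : ℕ in atTop, ∀ A : Finset (Fin d → ℝ), A.Nonempty → A.card ≤ n →
      densityCostLimit N r h - ε ≤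
        ∫ x, h x * boxCox r ((n : ℝ) ^ (1 / d : ℝ) * finDist N A x) ∂(cubeMeasure d) := by
  have hdpos : (0 : ℝ) < d := by exact_mod_cast hd
  obtain ⟨κ₁, κ₂, hκ₁, -, hnb⟩ := exists_norm_bounds hN
  set L := densityCostLimit N r h with hL
  set H := ∫ x, h x ∂(cubeMeasure d) with hH
  obtain ⟨a, ha1, -, haL⟩ := exists_scale r L H (show 0 < ε / 4 by positivity)
  have ha0 : 0 < a := by linarith
  have had : 1 < a ^ d := one_lt_pow₀ ha1 (by omega)
  obtain ⟨K, hK0, hcov⟩ := exists_covering (N := N) hd hN (show 0 < a ^ d - 1 by linarith)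
  obtain ⟨B, hB0, hB⟩ := exists_weighted_boxCox_bound (N := N) hd hN hr hpr (K := K)
    (R := a ^ d) (by positivity)
  have har : 0 < a ^ r := Real.rpow_pos_of_pos ha0 r
  -- closeness of the step density that survives the factor `(a ^ r)⁻¹`
  set ε' := min (ε / 4) (ε / 4 / ((a ^ r)⁻¹ * (1 + |boxCox r a|))) with hε'
  have hε'0 : 0 < ε' := by positivity
  obtain ⟨m, η, w, hm, hη, hη', hw, hsi, hsB, hsH, hsL⟩ :=
    exists_stepDensity_near (N := N) hd hr hp hpr hh h0 hi hB0 hε'0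
  set s := stepDensity m η w with hs
  have hm' : (0 : ℝ) < m := by exact_mod_cast hm
  have hsm : Measurable s := measurable_stepDensity m η w
  have hs0 : ∀ x, 0 ≤ s x := stepDensity_nonneg hw
  have hthin : ∀ᶠ n : ℕ in atTop, K < κ₁ * (η / m) * (n : ℝ) ^ (1 / d : ℝ) :=
    (((tendsto_rpow_atTop (by positivity)).comp tendsto_natCast_atTop_atTop).const_mul_atTop
      (by positivity)).eventually_gt_atTop K
  filter_upwards [hcov, hthin, eventually_gt_atTop 0] with n hn hthinn hn0 A hA hAn
  obtain ⟨G, hG, hGcard, hGcov⟩ := hn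
  have hn0' : (0 : ℝ) < n := by exact_mod_cast hn0
  have hlam : 0 < (n : ℝ) ^ (1 / d : ℝ) := Real.rpow_pos_of_pos hn0' _
  classical
  set A' := A ∪ G with hA'
  have hA'ne : A'.Nonempty := hA.mono Finset.subset_union_left
  have hA'card : (A'.card : ℝ) ≤ a ^ d * n := by
    have h1 : (A'.card : ℝ) ≤ A.card + G.card := by exact_mod_cast Finset.card_union_le A G
    have h2 : (A.card : ℝ) ≤ n := by exact_mod_cast hAn
    linarith
  have hA'cov : ∀ x ∈ unitCube d, (n : ℝ) ^ (1 / d : ℝ) * finDist N A' x ≤ K := fun x hx =>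
    (mul_le_mul_of_nonneg_left (finDist_anti hG Finset.subset_union_right x) hlam.le).trans
      (hGcov x hx)
  have hhA := integrable_mul_boxCox_finDist (N := N) hd hN hr hpr hA hlam hh h0 hi
  have hhA' := integrable_mul_boxCox_finDist (N := N) hd hN hr hpr hA'ne hlam hh h0 hi
  refine le_trans ?_ (cost_anti hd hN h0 hA Finset.subset_union_left hlam hhA hhA')
  obtain ⟨hdi, hdB⟩ := hB n hn0' A' hA'ne hA'card hA'cov (fun x => |h x - s x|)
    (hh.sub hsm).abs (fun x => abs_nonneg _) hsi
  have hsint : Integrable s (cubeMeasure d) := by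
    refine Integrable.of_bound hsm.aestronglyMeasurable (∑ j, w j) (ae_of_all _ fun x => ?_)
    rw [Real.norm_of_nonneg (hs0 x)]
    exact stepDensity_le_sum hw x
  have hsA' : Integrable (fun x => s x * boxCox r ((n : ℝ) ^ (1 / d : ℝ) * finDist N A' x))
      (cubeMeasure d) := by
    refine (integrable_boxCox_finDist (N := N) hd hN hr hA'ne hlam).bdd_mul (c := ∑ j, w j)
      hsm.aestronglyMeasurable (ae_of_all _ fun x => ?_)
    rw [Real.norm_of_nonneg (hs0 x)]
    exact stepDensity_le_sum hw x
  have hclose := abs_cost_sub_cost_le hhA' hsA' hdB hsB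
  have hlow := costLimit_le_integral_stepDensity (N := N) hd hN hr hκ₁ (fun x => (hnb x).1) hm hη
    hη' hw hA'ne hA'card (fun x hx => by
      have h1 := (hA'cov x hx).trans_lt hthinn
      rw [mul_comm] at h1
      exact lt_of_mul_lt_mul_right h1 hlam.le)
  have hTn : (a ^ d * n : ℝ) ^ (1 / d : ℝ) = a * (n : ℝ) ^ (1 / d : ℝ) := by
    rw [Real.mul_rpow (by positivity) hn0'.le, one_div, Real.pow_rpow_inv_natCast ha0.le (by omega)]
  rw [hTn, integral_mul_boxCox_scale hd hN hA'ne hlam ha0 hsint hsA'] at hlow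
  change densityCostLimit N r s ≤ _ at hlow
  set J := ∫ x, s x * boxCox r ((n : ℝ) ^ (1 / d : ℝ) * finDist N A' x) ∂(cubeMeasure d) with hJ
  have hJ1 : (a ^ r)⁻¹ * (densityCostLimit N r s
      - boxCox r a * ∫ x, s x ∂(cubeMeasure d)) ≤ J := by
    rw [inv_mul_le_iff₀ har]; linarith
  have hJ2 : (a ^ r)⁻¹ * (L - boxCox r a * H) - ε / 4 ≤ (a ^ r)⁻¹ * (densityCostLimit N r s
      - boxCox r a * ∫ x, s x ∂(cubeMeasure d)) := by
    have h1 : (a ^ r)⁻¹ * ((1 + |boxCox r a|) * ε') ≤ ε / 4 := by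
      have h2 : ε' ≤ ε / 4 / ((a ^ r)⁻¹ * (1 + |boxCox r a|)) := min_le_right _ _
      rw [le_div_iff₀ (by positivity)] at h2
      linarith
    have h2 : boxCox r a * (∫ x, s x ∂(cubeMeasure d) - H) ≤ |boxCox r a| * ε' := by
      refine (le_abs_self _).trans ?_
      rw [abs_mul]
      gcongr
    have h3 := (abs_lt.1 hsL).1
    have h4 : (L - boxCox r a * H) - (1 + |boxCox r a|) * ε' ≤
        densityCostLimit N r s - boxCox r a * ∫ x, s x ∂(cubeMeasure d) := by linarith
    have h5 := mul_le_mul_of_nonneg_left h4 (inv_pos.2 har).le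
    linarith
  have hε'4 : ε' ≤ ε / 4 := min_le_left _ _
  have := (abs_le.1 hclose).1
  linarith

/-- A fraction `τ` of the points is placed optimally for an approximating step density, and the
others form a covering grid, which keeps the error of the approximation small. -/
lemma eventually_exists_cost_le (hd : 1 ≤ d) (hN : ∀ x, N x = 0 → x = 0) {r p : ℝ}
    (hr : -(d : ℝ) < r) (hp : 1 ≤ p) (hpr : (0 < r ∧ p = 1) ∨ (1 < p ∧ d / (d + r) < p))
    {h : (Fin d → ℝ) → ℝ} (hh : Measurable h) (h0 : ∀ x, 0 ≤ h x)
    (hi : Integrable (fun x => h x ^ p) (cubeMeasure d)) {ε : ℝ} (hε : 0 < ε) :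
    ∀ᶠ n : ℕ in atTop, ∃ A : Finset (Fin d → ℝ), A.Nonempty ∧ A.card ≤ n ∧
      ∫ x, h x * boxCox r ((n : ℝ) ^ (1 / d : ℝ) * finDist N A x) ∂(cubeMeasure d) ≤
        densityCostLimit N r h + ε := by
  have hdpos : (0 : ℝ) < d := by exact_mod_cast hd
  set L := densityCostLimit N r h with hL
  set H := ∫ x, h x ∂(cubeMeasure d) with hH
  obtain ⟨a, ha1, haL, -⟩ := exists_scale r L H (show 0 < ε / 4 by positivity)
  have ha0 : 0 < a := by linarith
  have had : 1 < a ^ d := one_lt_pow₀ ha1 (by omega)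
  obtain ⟨τ, hτ1, hτ2⟩ := exists_between (inv_lt_one_of_one_lt₀ had)
  have hτ0 : 0 < τ := lt_trans (by positivity) hτ1
  have haτ : 1 < a ^ d * τ := by
    rw [inv_lt_iff_one_lt_mul₀ (by positivity)] at hτ1; linarith
  obtain ⟨K, hK0, hcov⟩ := exists_covering (N := N) hd hN (show 0 < 1 - τ by linarith)
  obtain ⟨B, hB0, hB⟩ := exists_weighted_boxCox_bound (N := N) hd hN hr hpr (K := K)
    (R := 1) one_pos
  have har : 0 < a ^ r := Real.rpow_pos_of_pos ha0 r
  set ε' := min (ε / 4) (ε / 4 / (a ^ r + |boxCox r a|)) with hε'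
  have hε'0 : 0 < ε' := by positivity
  obtain ⟨m, η, w, hm, hη, hη', hw, hsi, hsB, hsH, hsL⟩ :=
    exists_stepDensity_near (N := N) hd hr hp hpr hh h0 hi hB0 hε'0
  set s := stepDensity m η w with hs
  have hsm : Measurable s := measurable_stepDensity m η w
  have hs0 : ∀ x, 0 ≤ s x := stepDensity_nonneg hw
  filter_upwards [hcov, exists_integral_stepDensity_le (N := N) hd hN hr hm hη hη' hw ha0 hτ0 haτ,
    eventually_gt_atTop 0] with n hn hAn hn0
  obtain ⟨G, hG, hGcard, hGcov⟩ := hn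
  obtain ⟨A, hA, hAcard, hAint⟩ := hAn
  have hn0' : (0 : ℝ) < n := by exact_mod_cast hn0
  have hlam : 0 < (n : ℝ) ^ (1 / d : ℝ) := Real.rpow_pos_of_pos hn0' _
  classical
  have hA'ne : (A ∪ G).Nonempty := hA.mono Finset.subset_union_left
  have hA'card : ((A ∪ G).card : ℝ) ≤ n := by
    have h1 : ((A ∪ G).card : ℝ) ≤ A.card + G.card := by exact_mod_cast Finset.card_union_le A G
    linarith
  refine ⟨A ∪ G, hA'ne, by exact_mod_cast hA'card, ?_⟩
  have hup := hAint (A ∪ G) Finset.subset_union_left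
  set A' := A ∪ G with hA'
  have hA'cov : ∀ x ∈ unitCube d, (n : ℝ) ^ (1 / d : ℝ) * finDist N A' x ≤ K := fun x hx =>
    (mul_le_mul_of_nonneg_left (finDist_anti hG Finset.subset_union_right x) hlam.le).trans
      (hGcov x hx)
  have hhA' := integrable_mul_boxCox_finDist (N := N) hd hN hr hpr hA'ne hlam hh h0 hi
  obtain ⟨hdi, hdB⟩ := hB n hn0' A' hA'ne (by simpa using hA'card) hA'cov (fun x => |h x - s x|)
    (hh.sub hsm).abs (fun x => abs_nonneg _) hsi
  have hsA' : Integrable (fun x => s x * boxCox r ((n : ℝ) ^ (1 / d : ℝ) * finDist N A' x))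
      (cubeMeasure d) := by
    refine (integrable_boxCox_finDist (N := N) hd hN hr hA'ne hlam).bdd_mul (c := ∑ j, w j)
      hsm.aestronglyMeasurable (ae_of_all _ fun x => ?_)
    rw [Real.norm_of_nonneg (hs0 x)]
    exact stepDensity_le_sum hw x
  have hclose := abs_cost_sub_cost_le hhA' hsA' hdB hsB
  change _ ≤ a ^ r * densityCostLimit N r s + boxCox r a * ∫ x, s x ∂(cubeMeasure d) at hup
  have hJ2 : a ^ r * densityCostLimit N r s + boxCox r a * ∫ x, s x ∂(cubeMeasure d) ≤
      a ^ r * L + boxCox r a * H + ε / 4 := by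
    have h1 : (a ^ r + |boxCox r a|) * ε' ≤ ε / 4 := by
      have h2 : ε' ≤ ε / 4 / (a ^ r + |boxCox r a|) := min_le_right _ _
      rw [le_div_iff₀ (by positivity)] at h2
      linarith
    have h2 : boxCox r a * (∫ x, s x ∂(cubeMeasure d) - H) ≤ |boxCox r a| * ε' := by
      refine (le_abs_self _).trans ?_
      rw [abs_mul]
      gcongr
    have h3 := mul_le_mul_of_nonneg_left (abs_lt.1 hsL).2.le har.le
    linarith
  have hε'4 : ε' ≤ ε / 4 := min_le_left _ _
  have := (abs_le.1 hclose).2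
  linarith

end CostLimits

/-! ### From costs to quantization errors -/

section QuantizationErrors

variable {d : ℕ} {N : Seminorm ℝ (Fin d → ℝ)}

/-- The absolutely continuous measure on the unit cube with density `h`. -/
noncomputable def densityMeasure (h : (Fin d → ℝ) → ℝ) : Measure (Fin d → ℝ) :=
  (cubeMeasure d).withDensity fun x => ENNReal.ofReal (h x)

lemma lintegral_densityMeasure {h : (Fin d → ℝ) → ℝ} (hh : Measurable h)
    (f : (Fin d → ℝ) → ℝ≥0∞) :
    ∫⁻ x, f x ∂(densityMeasure h) = ∫⁻ x, ENNReal.ofReal (h x) * f x ∂(cubeMeasure d) := by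
  rw [densityMeasure, lintegral_withDensity_eq_lintegral_mul_non_measurable _
    hh.ennreal_ofReal (ae_of_all _ fun x => ENNReal.ofReal_lt_top)]
  rfl

lemma lintegral_sub_lintegral_eq {α : Type*} [MeasurableSpace α] {μ : Measure α} {u : α → ℝ}
    (hu : Integrable u μ) :
    ((∫⁻ x, ENNReal.ofReal (u x) ∂μ : ℝ≥0∞) : EReal)
      - ((∫⁻ x, ENNReal.ofReal (-u x) ∂μ : ℝ≥0∞) : EReal) = ((∫ x, u x ∂μ : ℝ) : EReal) := by
  have h1 : ∫⁻ x, ENNReal.ofReal (u x) ∂μ ≠ ∞ := hu.lintegral_lt_top.ne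
  have h2 : ∫⁻ x, ENNReal.ofReal (-u x) ∂μ ≠ ∞ := hu.neg.lintegral_lt_top.ne
  rw [integral_eq_lintegral_pos_part_sub_lintegral_neg_part hu, EReal.coe_sub,
    EReal.coe_ennreal_toReal h1, EReal.coe_ennreal_toReal h2]

lemma extIntegral_coe {α : Type*} [MeasurableSpace α] {μ : Measure α} {u : α → ℝ}
    (hu : Integrable u μ) :
    extIntegral μ (fun x => ((u x : ℝ) : EReal)) = ((∫ x, u x ∂μ : ℝ) : EReal) := by
  rw [← lintegral_sub_lintegral_eq hu, extIntegral]
  simp only [← EReal.coe_neg, EReal.toENNReal_of_ne_top (EReal.coe_ne_top _), EReal.toReal_coe]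

/-- The increasing function that turns a transformed cost, with respect to a measure of mass `H`,
back into a mean of order `r`. -/
noncomputable def meanOfCost (r H x : ℝ) : ℝ≥0∞ :=
  if r = 0 then ENNReal.ofReal (Real.exp x) else ENNReal.ofReal (H + r * x) ^ (1 / r)

lemma ennreal_rpow_le_rpow_of_nonpos {x y : ℝ≥0∞} {z : ℝ} (hxy : x ≤ y) (hz : z ≤ 0) :
    y ^ z ≤ x ^ z := by
  rw [← neg_neg z, ENNReal.rpow_neg, ENNReal.rpow_neg x]
  exact ENNReal.inv_le_inv.2 (ENNReal.rpow_le_rpow hxy (neg_nonneg.2 hz))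

lemma meanOfCost_mono (r H : ℝ) : Monotone (meanOfCost r H) := by
  intro x y hxy
  unfold meanOfCost
  split_ifs with h0
  · exact ENNReal.ofReal_le_ofReal (Real.exp_le_exp.2 hxy)
  · rcases lt_or_gt_of_ne h0 with hr | hr
    · refine ennreal_rpow_le_rpow_of_nonpos (ENNReal.ofReal_le_ofReal ?_) (one_div_neg.2 hr).le
      nlinarith
    · refine ENNReal.rpow_le_rpow (ENNReal.ofReal_le_ofReal ?_) (by positivity)
      nlinarith

lemma continuous_meanOfCost (r H : ℝ) : Continuous (meanOfCost r H) := by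
  unfold meanOfCost
  split_ifs
  · exact ENNReal.continuous_ofReal.comp Real.continuous_exp
  · exact ENNReal.continuous_rpow_const.comp
      (ENNReal.continuous_ofReal.comp (continuous_const.add (continuous_const.mul continuous_id)))

lemma mul_meanDist_eq (hd : 1 ≤ d) (hN : ∀ x, N x = 0 → x = 0) {r p : ℝ}
    (hr : -(d : ℝ) < r) (hp : 1 ≤ p) (hpr : (0 < r ∧ p = 1) ∨ (1 < p ∧ d / (d + r) < p))
    {h : (Fin d → ℝ) → ℝ} (hh : Measurable h) (h0 : ∀ x, 0 ≤ h x)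
    (hi : Integrable (fun x => h x ^ p) (cubeMeasure d))
    (hmass : r = 0 → ∫ x, h x ∂(cubeMeasure d) = 1)
    {A : Finset (Fin d → ℝ)} (hA : A.Nonempty) {lam : ℝ} (hlam : 0 < lam) :
    ENNReal.ofReal lam * meanDist N (densityMeasure h) r A =
      meanOfCost r (∫ x, h x ∂(cubeMeasure d))
        (∫ x, h x * boxCox r (lam * finDist N A x) ∂(cubeMeasure d)) := by
  have hhi := integrable_of_rpow hp hh h0 hi
  have hcost := integrable_mul_boxCox_finDist (N := N) hd hN hr hpr hA hlam hh h0 hi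
  unfold meanDist meanOfCost
  split_ifs with hr0
  · subst hr0
    have hcost1 := integrable_mul_boxCox_finDist (N := N) hd hN hr hpr hA one_pos hh h0 hi
    simp only [one_mul, boxCox_zero] at hcost1
    have hlog : ∀ᵐ x ∂(cubeMeasure d), ENNReal.log (distToSet N x A) =
        ((Real.log (finDist N A x) : ℝ) : EReal) := by
      filter_upwards [ae_notMem_finset hd A] with x hx
      rw [← ofReal_finDist hA, ENNReal.log_ofReal_of_pos (finDist_pos hN hA hx)]
    have hext : extIntegral (densityMeasure h) (fun x => ENNReal.log (distToSet N x A)) =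
        ((∫ x, h x * Real.log (finDist N A x) ∂(cubeMeasure d) : ℝ) : EReal) := by
      rw [← lintegral_sub_lintegral_eq hcost1, extIntegral, lintegral_densityMeasure hh,
        lintegral_densityMeasure hh]
      refine congrArg₂ (fun a b : ℝ≥0∞ => (a : EReal) - (b : EReal)) ?_ ?_
      · refine lintegral_congr_ae ?_
        filter_upwards [hlog] with x hx
        rw [hx, EReal.toENNReal_of_ne_top (EReal.coe_ne_top _), EReal.toReal_coe,
          ENNReal.ofReal_mul (h0 x)]
      · refine lintegral_congr_ae ?_
        filter_upwards [hlog] with x hx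
        rw [hx, ← EReal.coe_neg, EReal.toENNReal_of_ne_top (EReal.coe_ne_top _), EReal.toReal_coe,
          ← mul_neg, ENNReal.ofReal_mul (h0 x)]
    rw [hext, EReal.exp_coe, ← ENNReal.ofReal_mul hlam.le]
    congr 1
    have hsc := integral_mul_boxCox_scale (N := N) (r := 0) hd hN hA one_pos hlam hhi
      (by simpa [boxCox_zero] using hcost1)
    simp only [mul_one, one_mul, Real.rpow_zero, boxCox_zero, hmass rfl] at hsc ⊢
    rw [hsc, Real.exp_add, Real.exp_log hlam, mul_comm]
  · have hpt : ∀ᵐ x ∂(cubeMeasure d), h x * (lam * finDist N A x) ^ r =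
        h x + r * (h x * boxCox r (lam * finDist N A x)) := by
      refine ae_of_all _ fun x => ?_
      rw [boxCox_of_ne hr0]
      field_simp
      ring
    have hpi : Integrable (fun x => h x * (lam * finDist N A x) ^ r) (cubeMeasure d) :=
      (hhi.add (hcost.const_mul r)).congr (hpt.mono fun x hx => hx.symm)
    have hint : ∫ x, h x ∂(cubeMeasure d)
        + r * ∫ x, h x * boxCox r (lam * finDist N A x) ∂(cubeMeasure d) =
        ∫ x, h x * (lam * finDist N A x) ^ r ∂(cubeMeasure d) := by
      rw [integral_congr_ae hpt, integral_add hhi (hcost.const_mul r), integral_const_mul]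
    rw [hint, ofReal_integral_eq_lintegral_ofReal hpi (ae_of_all _ fun x => mul_nonneg (h0 x)
      (Real.rpow_nonneg (mul_nonneg hlam.le (finDist_nonneg A x)) _)),
      lintegral_densityMeasure hh]
    have heq : ∫⁻ x, ENNReal.ofReal (h x * (lam * finDist N A x) ^ r) ∂(cubeMeasure d) =
        ENNReal.ofReal lam ^ r *
          ∫⁻ x, ENNReal.ofReal (h x) * distToSet N x A ^ r ∂(cubeMeasure d) := by
      rw [← lintegral_const_mul' _ _ (by
        rw [ENNReal.ofReal_rpow_of_pos hlam]; exact ENNReal.ofReal_ne_top)]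
      refine lintegral_congr_ae ?_
      filter_upwards [ae_notMem_finset hd A] with x hx
      have hD := finDist_pos hN hA hx
      rw [← ofReal_finDist hA, ENNReal.ofReal_rpow_of_pos hlam, ENNReal.ofReal_rpow_of_pos hD,
        Real.mul_rpow hlam.le hD.le, ENNReal.ofReal_mul (h0 x),
        ENNReal.ofReal_mul (Real.rpow_nonneg hlam.le _)]
      ring
    have hfin : ∫⁻ x, ENNReal.ofReal (h x * (lam * finDist N A x) ^ r) ∂(cubeMeasure d) ≠ ∞ :=
      hpi.lintegral_lt_top.ne
    have hlr0 : ENNReal.ofReal lam ^ r ≠ 0 := by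
      rw [ENNReal.ofReal_rpow_of_pos hlam]
      simpa using Real.rpow_pos_of_pos hlam r
    have hlrT : ENNReal.ofReal lam ^ r ≠ ∞ := by
      rw [ENNReal.ofReal_rpow_of_pos hlam]; exact ENNReal.ofReal_ne_top
    rw [heq] at hfin ⊢
    have hIfin : ∫⁻ x, ENNReal.ofReal (h x) * distToSet N x A ^ r ∂(cubeMeasure d) ≠ ∞ := by
      intro htop
      rw [htop, ENNReal.mul_top hlr0] at hfin
      exact hfin rfl
    rw [ENNReal.mul_rpow_of_ne_top hlrT hIfin, ← ENNReal.rpow_mul, mul_one_div_cancel hr0,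
      ENNReal.rpow_one]

lemma integrable_densityIntegrand (hd : 1 ≤ d) {r p : ℝ}
    (hr : -(d : ℝ) < r) (hpr : (0 < r ∧ p = 1) ∨ (1 < p ∧ d / (d + r) < p))
    {h : (Fin d → ℝ) → ℝ} (hh : Measurable h) (h0 : ∀ x, 0 ≤ h x)
    (hi : Integrable (fun x => h x ^ p) (cubeMeasure d)) :
    Integrable (fun x => densityIntegrand d r (h x)) (cubeMeasure d) := by
  obtain ⟨C, hC⟩ := exists_densityIntegrand_bound hd hr hpr
  refine (((integrable_const 1).add hi).const_mul C).mono'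
    ((continuous_densityIntegrand hd hr).measurable.comp hh).aestronglyMeasurable
    (ae_of_all _ fun x => hC _ (h0 x))

lemma eLpNorm_eq_lintegral_ofReal {h : (Fin d → ℝ) → ℝ} (h0 : ∀ x, 0 ≤ h x) {s : ℝ}
    (hs : 0 < s) :
    eLpNorm h (ENNReal.ofReal s) (cubeMeasure d) =
      (∫⁻ x, ENNReal.ofReal (h x ^ s) ∂(cubeMeasure d)) ^ (1 / s) := by
  rw [eLpNorm_eq_lintegral_rpow_enorm_toReal (by simpa using hs) ENNReal.ofReal_ne_top,
    ENNReal.toReal_ofReal hs.le]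
  congr 1
  refine lintegral_congr fun x => ?_
  rw [Real.enorm_of_nonneg (h0 x), ENNReal.ofReal_rpow_of_nonneg (h0 x) hs.le]

/-- The predicted limit of the costs corresponds to the claimed quantization coefficient. -/
lemma meanOfCost_densityCostLimit (hd : 1 ≤ d) (hN : ∀ x, N x = 0 → x = 0) {r p : ℝ}
    (hr : -(d : ℝ) < r) (hpr : (0 < r ∧ p = 1) ∨ (1 < p ∧ d / (d + r) < p))
    {h : (Fin d → ℝ) → ℝ} (hh : Measurable h) (h0 : ∀ x, 0 ≤ h x)
    (hi : Integrable (fun x => h x ^ p) (cubeMeasure d))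
    (hmass : r = 0 → ∫ x, h x ∂(cubeMeasure d) = 1) :
    meanOfCost r (∫ x, h x ∂(cubeMeasure d)) (densityCostLimit N r h) =
      ENNReal.ofReal (unitCoeff N r) * densityFunctional r h := by
  have hdpos : (0 : ℝ) < d := by exact_mod_cast hd
  have hdr : 0 < d + r := by linarith
  have hc := unitCoeff_pos (N := N) hd hN hr
  have hUi := integrable_densityIntegrand hd hr hpr hh h0 hi
  unfold meanOfCost densityCostLimit costLimit densityFunctional
  rw [if_neg (not_le.2 hr)]
  split_ifs with hr0
  · subst hr0
    simp only [densityIntegrand, if_true] at hUi ⊢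
    rw [hmass rfl, extIntegral_coe hUi, ← EReal.coe_mul, ← EReal.coe_neg, EReal.exp_coe,
      ← ENNReal.ofReal_mul hc.le]
    congr 1
    rw [one_mul, Real.log_one, mul_zero, Real.exp_add, Real.exp_log hc]
    congr 2
    ring
  · simp only [densityIntegrand, if_neg hr0] at hUi ⊢
    have hs : 0 < (d : ℝ) / (d + r) := div_pos hdpos hdr
    set U := ∫ x, h x ^ ((d : ℝ) / (d + r)) ∂(cubeMeasure d) with hU
    have hU0 : 0 ≤ U := integral_nonneg fun x => Real.rpow_nonneg (h0 x) _
    rw [eLpNorm_eq_lintegral_ofReal h0 hs, ← ofReal_integral_eq_lintegral_ofReal hUi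
      (ae_of_all _ fun x => Real.rpow_nonneg (h0 x) _), ← hU, mul_div_cancel₀ _ hr0,
      add_sub_cancel, ENNReal.ofReal_mul (Real.rpow_nonneg hc.le _),
      ENNReal.mul_rpow_of_ne_top ENNReal.ofReal_ne_top ENNReal.ofReal_ne_top,
      ← ENNReal.ofReal_rpow_of_pos hc, ← ENNReal.rpow_mul, mul_one_div_cancel hr0,
      ENNReal.rpow_one]
    congr 2
    have hexp : 1 / ((d : ℝ) / (d + r)) = 1 + r / d := by field_simp
    rw [hexp, ENNReal.ofReal_rpow_of_nonneg hU0]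
    rw [← hexp]; positivity

/-- The exact asymptotics for a density in `L^p`. -/
theorem hasQuantizationCoeff_densityMeasure (hd : 1 ≤ d) (hN : ∀ x, N x = 0 → x = 0) {r p : ℝ}
    (hr : -(d : ℝ) < r) (hp : 1 ≤ p) (hpr : (0 < r ∧ p = 1) ∨ (1 < p ∧ d / (d + r) < p))
    {h : (Fin d → ℝ) → ℝ} (hh : Measurable h) (h0 : ∀ x, 0 ≤ h x)
    (hi : Integrable (fun x => h x ^ p) (cubeMeasure d))
    (hmass : r = 0 → ∫ x, h x ∂(cubeMeasure d) = 1) :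
    HasQuantizationCoeff N (densityMeasure h) d r
      (ENNReal.ofReal (unitCoeff N r) * densityFunctional r h) := by
  rw [← meanOfCost_densityCostLimit hd hN hr hpr hh h0 hi hmass]
  set L := densityCostLimit N r h with hL
  set H := ∫ x, h x ∂(cubeMeasure d) with hH
  have hscale : ∀ n : ℕ, 0 < n →
      ((n : ℝ≥0∞) ^ (1 / (d : ℝ))) = ENNReal.ofReal ((n : ℝ) ^ (1 / d : ℝ)) := by
    intro n hn
    rw [← ENNReal.ofReal_rpow_of_pos (by exact_mod_cast hn), ENNReal.ofReal_natCast]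
  have hlower : ∀ ε : ℝ, 0 < ε → ∀ᶠ n : ℕ in atTop, meanOfCost r H (L - ε) ≤
      (n : ℝ≥0∞) ^ (1 / (d : ℝ)) * quantizationError N (densityMeasure h) r n := by
    intro ε hε
    filter_upwards [eventually_cost_ge (N := N) hd hN hr hp hpr hh h0 hi hε,
      eventually_gt_atTop 0] with n hn hn0
    have hlam : 0 < (n : ℝ) ^ (1 / d : ℝ) := Real.rpow_pos_of_pos (by exact_mod_cast hn0) _
    rw [hscale n hn0, mul_comm, ← ENNReal.div_le_iff (by simpa using hlam) ENNReal.ofReal_ne_top]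
    refine le_iInf fun A => le_iInf fun hA => le_iInf fun hAn => ?_
    rw [ENNReal.div_le_iff (by simpa using hlam) ENNReal.ofReal_ne_top, mul_comm,
      mul_meanDist_eq hd hN hr hp hpr hh h0 hi hmass hA hlam]
    exact meanOfCost_mono r H (hn A hA hAn)
  have hupper : ∀ ε : ℝ, 0 < ε → ∀ᶠ n : ℕ in atTop,
      (n : ℝ≥0∞) ^ (1 / (d : ℝ)) * quantizationError N (densityMeasure h) r n ≤
        meanOfCost r H (L + ε) := by
    intro ε hε
    filter_upwards [eventually_exists_cost_le (N := N) hd hN hr hp hpr hh h0 hi hε,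
      eventually_gt_atTop 0] with n hn hn0
    have hlam : 0 < (n : ℝ) ^ (1 / d : ℝ) := Real.rpow_pos_of_pos (by exact_mod_cast hn0) _
    obtain ⟨A, hA, hAn, hcost⟩ := hn
    have h1 : quantizationError N (densityMeasure h) r n ≤ meanDist N (densityMeasure h) r A :=
      iInf_le_of_le A (iInf₂_le hA hAn)
    refine (mul_le_mul_right h1 _).trans ?_
    rw [hscale n hn0, mul_meanDist_eq hd hN hr hp hpr hh h0 hi hmass hA hlam]
    exact meanOfCost_mono r H hcost
  have hcont := (continuous_meanOfCost r H).tendsto L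
  refine tendsto_order.2 ⟨fun b hb => ?_, fun b hb => ?_⟩
  · obtain ⟨ε, hε, hball⟩ := Metric.eventually_nhds_iff.1 (hcont.eventually_const_lt hb)
    filter_upwards [hlower (ε / 2) (half_pos hε)] with n hn
    refine lt_of_lt_of_le (hball ?_) hn
    rw [Real.dist_eq, sub_sub_cancel_left, abs_neg, abs_of_pos (half_pos hε)]
    linarith
  · obtain ⟨ε, hε, hball⟩ := Metric.eventually_nhds_iff.1 (hcont.eventually_lt_const hb)
    filter_upwards [hupper (ε / 2) (half_pos hε)] with n hn
    refine lt_of_le_of_lt hn (hball ?_)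
    rw [Real.dist_eq, add_sub_cancel_left, abs_of_pos (half_pos hε)]
    linarith

lemma densityMeasure_one : densityMeasure (fun _ => 1) = cubeMeasure d := by
  simp [densityMeasure]

lemma densityFunctional_one (hd : 1 ≤ d) {r : ℝ} (hr : -(d : ℝ) < r) :
    densityFunctional (d := d) r (fun _ => 1) = 1 := by
  unfold densityFunctional
  rw [if_neg (not_le.2 hr)]
  split_ifs with hr0
  · simp [extIntegral]
  · have hdr : 0 < d + r := by linarith
    have hdpos : (0 : ℝ) < d := by exact_mod_cast hd
    rw [eLpNorm_const _ (by simpa using div_pos hdpos hdr) (NeZero.ne _)]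
    simp

theorem hasQuantizationCoeff_cubeMeasure (hd : 1 ≤ d) (hN : ∀ x, N x = 0 → x = 0) {r : ℝ}
    (hr : -(d : ℝ) < r) :
    HasQuantizationCoeff N (cubeMeasure d) d r (ENNReal.ofReal (unitCoeff N r)) := by
  obtain ⟨p, hp⟩ := exists_exponent d r
  have := hasQuantizationCoeff_densityMeasure (N := N) hd hN hr hp.1.le (Or.inr hp)
    (h := fun _ => 1) measurable_const (fun _ => zero_le_one) (by simp) (by simp)
  rwa [densityMeasure_one, densityFunctional_one hd hr, mul_one] at this

end QuantizationErrors

/-! ### Orders with coefficient zero -/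

section DegenerateOrders

variable {d : ℕ} {N : Seminorm ℝ (Fin d → ℝ)}

lemma hasQuantizationCoeff_zero_of_eq_top {ν : Measure (Fin d → ℝ)} {r : ℝ} (hr : r < 0)
    {a : Fin d → ℝ} (ha : ∫⁻ x, distToSet N x {a} ^ r ∂ν = ∞) (κ : ℝ) :
    HasQuantizationCoeff N ν κ r 0 := by
  refine tendsto_const_nhds.congr' ?_
  filter_upwards [eventually_ge_atTop 1] with n hn
  have h1 : quantizationError N ν r n ≤ meanDist N ν r {a} :=
    iInf_le_of_le {a} (iInf₂_le (Finset.singleton_nonempty a) (by simpa using hn))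
  have h2 : meanDist N ν r {a} = 0 := by
    unfold meanDist
    rw [if_neg hr.ne, ha, ENNReal.top_rpow_of_neg (one_div_neg.2 hr)]
  rw [nonpos_iff_eq_zero.1 (h1.trans h2.le), mul_zero]

/-- For `r ≤ -d` a single point suffices: at a density point of a superlevel set of `h`, the mass of
the ball of radius `ρ` is of order `ρ ^ d`, too much for `N (x - a) ^ r` to be integrable. -/
lemma exists_lintegral_distToSet_eq_top (hd : 1 ≤ d) (hN : ∀ x, N x = 0 → x = 0) {r : ℝ}
    (hr : r < 0) (hrd : r ≤ -(d : ℝ)) {h : (Fin d → ℝ) → ℝ} (hh : Measurable h)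
    (hne : densityMeasure (d := d) h ≠ 0) :
    ∃ a : Fin d → ℝ, ∫⁻ x, distToSet N x {a} ^ r ∂(densityMeasure h) = ∞ := by
  obtain ⟨κ₁, κ₂, -, hκ₂, hnb⟩ := exists_norm_bounds hN
  have hE : ∃ k : ℕ, volume (unitCube d ∩ {x | 1 / ((k : ℝ) + 1) < h x}) ≠ 0 := by
    by_contra! hall
    apply hne
    have hnull : volume (⋃ k : ℕ, unitCube d ∩ {x | 1 / ((k : ℝ) + 1) < h x}) = 0 :=
      measure_iUnion_null hall
    have hae : (fun x => ENNReal.ofReal (h x)) =ᵐ[cubeMeasure d] 0 := by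
      filter_upwards [ae_restrict_mem measurableSet_unitCube,
        ae_restrict_of_ae (measure_eq_zero_iff_ae_notMem.1 hnull)] with x hx hx'
      by_contra hpos
      simp only [Pi.zero_apply, ENNReal.ofReal_eq_zero, not_le] at hpos
      obtain ⟨k, hk⟩ := exists_nat_one_div_lt hpos
      exact hx' (Set.mem_iUnion.2 ⟨k, hx, hk⟩)
    rw [densityMeasure, withDensity_congr_ae hae, withDensity_zero]
  obtain ⟨k, hk⟩ := hE
  set ε : ℝ := 1 / ((k : ℝ) + 1) with hε
  have hε0 : 0 < ε := by positivity
  set E := unitCube d ∩ {x | ε < h x} with hEdef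
  have hEm : MeasurableSet E :=
    measurableSet_unitCube.inter (measurableSet_lt measurable_const hh)
  have hne' : NeBot (ae (volume.restrict E)) := by
    rw [ae_neBot, Ne, Measure.restrict_eq_zero]; exact hk
  obtain ⟨a, ha⟩ := (Besicovitch.ae_tendsto_measure_inter_div volume E).exists
  refine ⟨a, ?_⟩
  by_contra hfin
  set f : (Fin d → ℝ) → ℝ≥0∞ := E.indicator fun x => ENNReal.ofReal ε * distToSet N x {a} ^ r
    with hf
  have hf_fin : ∫⁻ x, f x ≠ ∞ := by
    refine ne_top_of_le_ne_top hfin ?_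
    rw [lintegral_densityMeasure hh, cubeMeasure, ← lintegral_indicator measurableSet_unitCube]
    refine lintegral_mono fun x => ?_
    by_cases hx : x ∈ E
    · rw [hf, Set.indicator_of_mem hx, Set.indicator_of_mem hx.1]
      exact mul_le_mul_left (ENNReal.ofReal_le_ofReal (le_of_lt hx.2)) _
    · rw [hf, Set.indicator_of_notMem hx]; exact bot_le
  have hvol : ∀ ρ : ℝ, 0 ≤ ρ → volume (Metric.closedBall a ρ) = ENNReal.ofReal ((2 * ρ) ^ d) :=
    fun ρ hρ => by rw [Real.volume_pi_closedBall a hρ, Fintype.card_fin]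
  have hd0 : d ≠ 0 := by omega
  have hvol0 : Tendsto (fun ρ : ℝ => volume (Metric.closedBall a ρ)) (𝓝[>] 0) (𝓝 0) := by
    have h1 : Tendsto (fun ρ : ℝ => ENNReal.ofReal ((2 * ρ) ^ d)) (𝓝[>] 0) (𝓝 0) := by
      have : Continuous fun ρ : ℝ => ENNReal.ofReal ((2 * ρ) ^ d) :=
        ENNReal.continuous_ofReal.comp (by fun_prop)
      have h2 := this.tendsto 0
      simp only [mul_zero, zero_pow hd0, ENNReal.ofReal_zero] at h2
      exact h2.mono_left nhdsWithin_le_nhds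
    refine h1.congr' ?_
    filter_upwards [self_mem_nhdsWithin] with ρ hρ using (hvol ρ (le_of_lt hρ)).symm
  have hlim := tendsto_setLIntegral_zero hf_fin hvol0
  set b : ℝ := ε * κ₂ ^ r * 2 ^ d / 2 with hb
  have hb0 : 0 < b := by positivity
  have hlow : ∀ᶠ ρ : ℝ in 𝓝[>] 0, ENNReal.ofReal b ≤ ∫⁻ x in Metric.closedBall a ρ, f x := by
    have hhalf : ENNReal.ofReal (1 / 2) < 1 := by
      rw [ENNReal.ofReal_lt_one]; norm_num
    filter_upwards [ha.eventually_const_lt hhalf, Ioo_mem_nhdsGT one_pos] with ρ hdens hρ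
    obtain ⟨hρ0, hρ1⟩ := hρ
    rw [hvol ρ hρ0.le, ENNReal.lt_div_iff_mul_lt (by left; simp; positivity) (by simp),
      ← ENNReal.ofReal_mul (by norm_num)] at hdens
    have hpt : ∀ x ∈ E ∩ Metric.closedBall a ρ, ENNReal.ofReal (ε * (κ₂ * ρ) ^ r) ≤ f x := by
      intro x hx
      rw [hf, Set.indicator_of_mem hx.1, ENNReal.ofReal_mul hε0.le]
      gcongr
      rw [← ENNReal.ofReal_rpow_of_pos (by positivity)]
      refine ennreal_rpow_le_rpow_of_nonpos ?_ hr.le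
      rw [← ofReal_finDist (Finset.singleton_nonempty a)]
      refine ENNReal.ofReal_le_ofReal ((finDist_le (Finset.mem_singleton_self a) x).trans
        ((hnb _).2.trans ?_))
      rw [← dist_eq_norm]
      exact mul_le_mul_of_nonneg_left hx.2 hκ₂.le
    calc ENNReal.ofReal b ≤ ENNReal.ofReal (ε * (κ₂ * ρ) ^ r) * ENNReal.ofReal
          (1 / 2 * (2 * ρ) ^ d) := by
          rw [← ENNReal.ofReal_mul (by positivity)]
          refine ENNReal.ofReal_le_ofReal ?_
          rw [Real.mul_rpow hκ₂.le hρ0.le, mul_pow, hb]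
          have h1 : 1 ≤ ρ ^ r * ρ ^ d := by
            rw [← Real.rpow_natCast, ← Real.rpow_add hρ0]
            exact Real.one_le_rpow_of_pos_of_le_one_of_nonpos hρ0 hρ1.le (by linarith)
          have h2 : ε * (κ₂ ^ r * ρ ^ r) * (1 / 2 * (2 ^ d * ρ ^ d))
            = ε * κ₂ ^ r * 2 ^ d / 2 * (ρ ^ r * ρ ^ d) := by ring
          rw [h2]
          exact le_mul_of_one_le_right hb0.le h1
      _ ≤ ENNReal.ofReal (ε * (κ₂ * ρ) ^ r) * volume (E ∩ Metric.closedBall a ρ) := by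
          gcongr
      _ = ∫⁻ _ in E ∩ Metric.closedBall a ρ, ENNReal.ofReal (ε * (κ₂ * ρ) ^ r) := by
          rw [setLIntegral_const]
      _ ≤ ∫⁻ x in E ∩ Metric.closedBall a ρ, f x :=
          setLIntegral_mono' (hEm.inter Metric.isClosed_closedBall.measurableSet) hpt
      _ ≤ ∫⁻ x in Metric.closedBall a ρ, f x :=
          lintegral_mono_set Set.inter_subset_right
  have := ge_of_tendsto hlim hlow
  simp only [nonpos_iff_eq_zero, ENNReal.ofReal_eq_zero] at this
  linarith

/-- If the functional of the density is infinite at a negative order, the errors are of smaller order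
than `n ^ (-1/d)`: compare with the truncated densities. -/
lemma hasQuantizationCoeff_zero_of_eLpNorm_eq_top (hd : 1 ≤ d) (hN : ∀ x, N x = 0 → x = 0)
    {r : ℝ} (hr : -(d : ℝ) < r) (hr0 : r < 0) {h : (Fin d → ℝ) → ℝ} (hh : Measurable h)
    (h0 : ∀ x, 0 ≤ h x)
    (htop : eLpNorm h (ENNReal.ofReal (d / (d + r))) (cubeMeasure d) = ∞) :
    HasQuantizationCoeff N (densityMeasure h) d r 0 := by
  have hdpos : (0 : ℝ) < d := by exact_mod_cast hd
  have hdr : 0 < d + r := by linarith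
  set s := (d : ℝ) / (d + r) with hs
  have hs0 : 0 < s := div_pos hdpos hdr
  obtain ⟨p, hp⟩ := exists_exponent d r
  set g : ℕ → (Fin d → ℝ) → ℝ := fun M x => min (h x) M with hg
  have hgm : ∀ M, Measurable (g M) := fun M => hh.min measurable_const
  have hg0 : ∀ M x, 0 ≤ g M x := fun M x => le_min (h0 x) (Nat.cast_nonneg M)
  have hgi : ∀ M, Integrable (fun x => g M x ^ p) (cubeMeasure d) := fun M =>
    Integrable.of_bound ((hgm M).pow_const p).aestronglyMeasurable ((M : ℝ) ^ p)
      (ae_of_all _ fun x => by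
        rw [Real.norm_of_nonneg (Real.rpow_nonneg (hg0 M x) _)]
        exact Real.rpow_le_rpow (hg0 M x) (min_le_right _ _) (by linarith [hp.1]))
  have hcoeff : ∀ M, HasQuantizationCoeff N (densityMeasure (g M)) d r
      (ENNReal.ofReal (unitCoeff N r) * densityFunctional r (g M)) := fun M =>
    hasQuantizationCoeff_densityMeasure hd hN hr hp.1.le (Or.inr hp) (hgm M) (hg0 M) (hgi M)
      fun h => absurd h hr0.ne
  have hle : ∀ M n, quantizationError N (densityMeasure h) r n ≤
      quantizationError N (densityMeasure (g M)) r n := by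
    intro M n
    refine iInf_mono fun A => iInf_mono fun _ => iInf_mono fun _ => ?_
    unfold meanDist
    rw [if_neg hr0.ne, if_neg hr0.ne]
    refine ennreal_rpow_le_rpow_of_nonpos (lintegral_mono' ?_ le_rfl) (one_div_neg.2 hr0).le
    exact withDensity_mono (ae_of_all _ fun x => ENNReal.ofReal_le_ofReal (min_le_left _ _))
  have hnorm : Tendsto (fun M => eLpNorm (g M) (ENNReal.ofReal s) (cubeMeasure d)) atTop
      (𝓝 ∞) := by
    rw [← htop, eLpNorm_eq_lintegral_ofReal h0 hs0]
    simp_rw [eLpNorm_eq_lintegral_ofReal (hg0 _) hs0]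
    refine (ENNReal.continuous_rpow_const.tendsto _).comp
      (lintegral_tendsto_of_tendsto_of_monotone (fun M => ?_) (ae_of_all _ fun x => ?_)
        (ae_of_all _ fun x => ?_))
    · exact ((hgm M).pow_const s).ennreal_ofReal.aemeasurable
    · intro M M' hMM'
      refine ENNReal.ofReal_le_ofReal (Real.rpow_le_rpow (hg0 M x) ?_ hs0.le)
      exact min_le_min_left _ (by exact_mod_cast hMM')
    · refine tendsto_const_nhds.congr' ?_
      filter_upwards [eventually_ge_atTop ⌈h x⌉₊] with M hM
      rw [hg]
      simp only
      rw [min_eq_left ((Nat.le_ceil (h x)).trans (by exact_mod_cast hM))]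
  have hlim : Tendsto (fun M => ENNReal.ofReal (unitCoeff N r) * densityFunctional r (g M)) atTop
      (𝓝 0) := by
    have h1 : ∀ M, densityFunctional r (g M) =
        eLpNorm (g M) (ENNReal.ofReal s) (cubeMeasure d) ^ (1 / r) := fun M => by
      unfold densityFunctional
      rw [if_neg (not_le.2 hr), if_neg hr0.ne]
    simp_rw [h1]
    have h2 := (ENNReal.continuous_rpow_const (y := 1 / r)).tendsto ∞ |>.comp hnorm
    rw [ENNReal.top_rpow_of_neg (one_div_neg.2 hr0)] at h2
    simpa using ENNReal.Tendsto.const_mul h2 (Or.inr ENNReal.ofReal_ne_top)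
  refine tendsto_order.2 ⟨fun b hb => absurd hb not_lt_bot, fun b hb => ?_⟩
  obtain ⟨M, hM⟩ := (hlim.eventually_lt_const hb).exists
  filter_upwards [(hcoeff M).eventually_lt_const hM] with n hn
  exact (mul_le_mul_right (hle M n) _).trans_lt hn

end DegenerateOrders

/-! ### The critical order -/

section CriticalOrder

variable {d : ℕ} {h : (Fin d → ℝ) → ℝ}

lemma one_le_integrabilityExponent (h1 : eLpNorm h 1 (cubeMeasure d) = 1) :
    1 ≤ integrabilityExponent h :=
  le_sSup ⟨one_pos, ENNReal.one_ne_top, by rw [h1]; exact ENNReal.one_lt_top⟩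

lemma neg_le_criticalOrder : -(d : ℝ) ≤ criticalOrder h := by
  have : 0 ≤ ((d : ℝ≥0∞) / integrabilityExponent h).toReal := ENNReal.toReal_nonneg
  unfold criticalOrder
  linarith

lemma criticalOrder_eq :
    criticalOrder h = d / (integrabilityExponent h).toReal - d := by
  unfold criticalOrder
  rw [ENNReal.toReal_div, ENNReal.toReal_natCast]

/-- Above the critical order, and only there, the exponent `d / (d + r)` is less than `s_h`. -/
lemma criticalOrder_lt_iff (hd : 1 ≤ d) (hs : 1 ≤ integrabilityExponent h) {r : ℝ}
    (hr : -(d : ℝ) < r) :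
    criticalOrder h < r ↔ ENNReal.ofReal (d / (d + r)) < integrabilityExponent h := by
  have hdpos : (0 : ℝ) < d := by exact_mod_cast hd
  have hdr : 0 < d + r := by linarith
  rcases eq_or_ne (integrabilityExponent h) ∞ with htop | htop
  · rw [criticalOrder_eq, htop]
    simp [hr]
  · have hS : 0 < (integrabilityExponent h).toReal :=
      ENNReal.toReal_pos (zero_lt_one.trans_le hs).ne' htop
    rw [criticalOrder_eq, ENNReal.ofReal_lt_iff_lt_toReal (by positivity) htop, sub_lt_iff_lt_add,
      div_lt_iff₀ hS, div_lt_iff₀ hdr, add_comm r, mul_comm]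

lemma criticalOrder_nonpos (hs : 1 ≤ integrabilityExponent h) : criticalOrder h ≤ 0 := by
  rw [criticalOrder_eq, sub_nonpos]
  rcases eq_or_ne (integrabilityExponent h) ∞ with htop | htop
  · rw [htop]; simp
  · have hS : 1 ≤ (integrabilityExponent h).toReal := by
      simpa using ENNReal.toReal_mono htop hs
    exact div_le_self (Nat.cast_nonneg d) hS

/-- Above the critical order the density lies in `L^p` for an admissible exponent `p`. -/
lemma exists_admissible_exponent (hd : 1 ≤ d) (hh : Measurable h) (h0 : ∀ x, 0 ≤ h x)
    (h1 : eLpNorm h 1 (cubeMeasure d) = 1) {r : ℝ} (hr : criticalOrder h < r) :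
    ∃ p : ℝ, 1 ≤ p ∧ ((0 < r ∧ p = 1) ∨ (1 < p ∧ d / (d + r) < p)) ∧
      Integrable (fun x => h x ^ p) (cubeMeasure d) := by
  have hdpos : (0 : ℝ) < d := by exact_mod_cast hd
  have hrd : -(d : ℝ) < r := neg_le_criticalOrder.trans_lt hr
  have hdr : 0 < d + r := by linarith
  have hint : ∀ q : ℝ≥0∞, 0 < q → q ≠ ∞ → eLpNorm h q (cubeMeasure d) < ∞ →
      Integrable (fun x => h x ^ q.toReal) (cubeMeasure d) := by
    intro q hq0 hqT hq
    refine ((integrable_norm_rpow_iff hh.aestronglyMeasurable hq0.ne' hqT).2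
      ⟨hh.aestronglyMeasurable, hq⟩).congr (ae_of_all _ fun x => ?_)
    simp only [Real.norm_of_nonneg (h0 x)]
  rcases lt_or_ge 0 r with hr0 | hr0
  · refine ⟨1, le_rfl, Or.inl ⟨hr0, rfl⟩, ?_⟩
    simpa using hint 1 one_pos ENNReal.one_ne_top (by rw [h1]; exact ENNReal.one_lt_top)
  · have hlt := (criticalOrder_lt_iff hd (one_le_integrabilityExponent h1) hrd).1 hr
    obtain ⟨q, ⟨hq0, hqT, hqfin⟩, hsq⟩ := lt_sSup_iff.1 hlt
    have hsq' : (d : ℝ) / (d + r) < q.toReal :=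
      (ENNReal.ofReal_lt_iff_lt_toReal (by positivity) hqT).1 hsq
    have hs1 : 1 ≤ (d : ℝ) / (d + r) := by
      rw [one_le_div hdr]; linarith
    exact ⟨q.toReal, hs1.trans hsq'.le, Or.inr ⟨hs1.trans_lt hsq', hsq'⟩, hint q hq0 hqT hqfin⟩

/-- Below the critical order, and at it if `‖h‖_{s_h} = ∞`, the norm in `Φ_r` is infinite. -/
lemma eLpNorm_eq_top_of_le_criticalOrder (hd : 1 ≤ d) (h1 : eLpNorm h 1 (cubeMeasure d) = 1)
    {r : ℝ} (hrd : -(d : ℝ) < r) (hr : r < criticalOrder h ∨ (r = criticalOrder h ∧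
      eLpNorm h (integrabilityExponent h) (cubeMeasure d) = ∞)) :
    r < 0 ∧ eLpNorm h (ENNReal.ofReal (d / (d + r))) (cubeMeasure d) = ∞ := by
  have hdpos : (0 : ℝ) < d := by exact_mod_cast hd
  have hdr : 0 < d + r := by linarith
  have hs := one_le_integrabilityExponent h1
  have hcrit := criticalOrder_nonpos hs
  have hle : r ≤ criticalOrder h := hr.elim le_of_lt fun h => h.1.le
  have hge : integrabilityExponent h ≤ ENNReal.ofReal (d / (d + r)) :=
    not_lt.1 (mt (criticalOrder_lt_iff hd hs hrd).2 (not_lt.2 hle))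
  have hfin : integrabilityExponent h ≠ ∞ := ne_top_of_le_ne_top ENNReal.ofReal_ne_top hge
  have hS : 0 < (integrabilityExponent h).toReal :=
    ENNReal.toReal_pos (zero_lt_one.trans_le hs).ne' hfin
  rcases hr with hr | ⟨hr, htop⟩
  · refine ⟨hr.trans_le hcrit, ?_⟩
    have hlt : integrabilityExponent h < ENNReal.ofReal (d / (d + r)) := by
      rw [ENNReal.lt_ofReal_iff_toReal_lt hfin, lt_div_iff₀ hdr]
      rw [criticalOrder_eq, lt_sub_iff_add_lt, lt_div_iff₀ hS] at hr
      linarith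
    by_contra hne
    have hle' : ENNReal.ofReal (d / (d + r)) ≤ integrabilityExponent h :=
      le_sSup ⟨by simpa using div_pos hdpos hdr, ENNReal.ofReal_ne_top, lt_top_iff_ne_top.2 hne⟩
    exact absurd hle' (not_le.2 hlt)
  · have heq : integrabilityExponent h = ENNReal.ofReal (d / (d + r)) := by
      have h2 : (integrabilityExponent h).toReal = d / (d + r) := by
        rw [hr, criticalOrder_eq]; field_simp; ring
      rw [← h2, ENNReal.ofReal_toReal hfin]
    refine ⟨lt_of_le_of_ne (hle.trans hcrit) fun hr0 => ?_, heq ▸ htop⟩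
    have h2 : integrabilityExponent h = 1 := by
      rw [heq, hr0, add_zero, div_self hdpos.ne', ENNReal.ofReal_one]
    rw [h2, h1] at htop
    exact ENNReal.one_ne_top htop

lemma densityFunctional_pos_lt_top (hd : 1 ≤ d) {r p : ℝ}
    (hr : -(d : ℝ) < r) (hpr : (0 < r ∧ p = 1) ∨ (1 < p ∧ d / (d + r) < p))
    (hh : Measurable h) (h0 : ∀ x, 0 ≤ h x) (h1 : eLpNorm h 1 (cubeMeasure d) = 1)
    (hi : Integrable (fun x => h x ^ p) (cubeMeasure d)) :
    0 < densityFunctional r h ∧ densityFunctional r h < ∞ := by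
  have hdpos : (0 : ℝ) < d := by exact_mod_cast hd
  have hdr : 0 < d + r := by linarith
  have hUi := integrable_densityIntegrand hd hr hpr hh h0 hi
  unfold densityFunctional
  rw [if_neg (not_le.2 hr)]
  split_ifs with hr0
  · subst hr0
    simp only [densityIntegrand, if_true] at hUi
    rw [extIntegral_coe hUi, ← EReal.coe_mul, ← EReal.coe_neg, EReal.exp_coe]
    exact ⟨ENNReal.ofReal_pos.2 (Real.exp_pos _), ENNReal.ofReal_lt_top⟩
  · have hs : 0 < (d : ℝ) / (d + r) := div_pos hdpos hdr
    simp only [densityIntegrand, if_neg hr0] at hUi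
    have hne0 : eLpNorm h (ENNReal.ofReal (d / (d + r))) (cubeMeasure d) ≠ 0 := by
      intro hz
      rw [eLpNorm_eq_zero_iff hh.aestronglyMeasurable (by simpa using hs)] at hz
      rw [eLpNorm_congr_ae hz, eLpNorm_zero] at h1
      exact zero_ne_one h1
    have hneT : eLpNorm h (ENNReal.ofReal (d / (d + r))) (cubeMeasure d) ≠ ∞ := by
      rw [eLpNorm_eq_lintegral_ofReal h0 hs]
      exact ENNReal.rpow_ne_top_of_nonneg (by positivity) hUi.lintegral_lt_top.ne
    exact ⟨ENNReal.rpow_pos (pos_iff_ne_zero.2 hne0) hneT,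
      lt_top_iff_ne_top.2 (ENNReal.rpow_ne_top_of_ne_zero hne0 hneT)⟩

end CriticalOrder

/-- Exact asymptotics of the quantization errors of all real orders `r` for an absolutely
continuous probability measure `ν = h Λ` on the unit cube, for an arbitrary norm `N` on `ℝ^d`. -/
theorem theorem1p3 (d : ℕ) (hd : 1 ≤ d)
    (N : Seminorm ℝ (Fin d → ℝ)) (hN : ∀ x, N x = 0 → x = 0)
    (h : (Fin d → ℝ) → ℝ) (h_meas : Measurable h) (h_nonneg : ∀ x, 0 ≤ h x)
    (ν : Measure (Fin d → ℝ)) (hν_prob : IsProbabilityMeasure ν)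
    (hν : ν = (cubeMeasure d).withDensity fun x => ENNReal.ofReal (h x)) :
    (∀ r : ℝ,
      (r ≠ criticalOrder h ∨ eLpNorm h (integrabilityExponent h) (cubeMeasure d) = ∞) →
      ∃ cΛ cν : ℝ≥0∞,
        HasQuantizationCoeff N (cubeMeasure d) d r cΛ ∧
        HasQuantizationCoeff N ν d r cν ∧
        cΛ < ∞ ∧ cν < ∞ ∧
        cν = cΛ * densityFunctional r h ∧
        (criticalOrder h < r → 0 < cν) ∧
        (r < criticalOrder h ∨
          (r = criticalOrder h ∧ eLpNorm h (integrabilityExponent h) (cubeMeasure d) = ∞) →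
          cν = 0)) ∧
    (1 < integrabilityExponent h →
      ∃ cΛ : ℝ≥0∞, HasQuantizationCoeff N (cubeMeasure d) d 0 cΛ ∧
        HasQuantizationCoeff N ν d 0 (cΛ * densityFunctional 0 h)) := by
  have hdpos : (0 : ℝ) < d := by exact_mod_cast hd
  have hνd : ν = densityMeasure h := hν
  have hmass' : ∫⁻ x, ENNReal.ofReal (h x) ∂(cubeMeasure d) = 1 := by
    have := hν_prob.measure_univ
    rwa [hν, withDensity_apply _ MeasurableSet.univ, Measure.restrict_univ] at this
  have hnorm : eLpNorm h 1 (cubeMeasure d) = 1 := by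
    rw [eLpNorm_one_eq_lintegral_enorm, ← hmass']
    exact lintegral_congr fun x => Real.enorm_of_nonneg (h_nonneg x)
  have hmass : ∫ x, h x ∂(cubeMeasure d) = 1 := by
    rw [integral_eq_lintegral_of_nonneg_ae (ae_of_all _ h_nonneg) h_meas.aestronglyMeasurable,
      hmass', ENNReal.toReal_one]
  have habove : ∀ r : ℝ, criticalOrder h < r →
      HasQuantizationCoeff N (cubeMeasure d) d r (ENNReal.ofReal (unitCoeff N r)) ∧
      HasQuantizationCoeff N ν d r (ENNReal.ofReal (unitCoeff N r) * densityFunctional r h) ∧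
      0 < densityFunctional r h ∧ densityFunctional r h < ∞ := by
    intro r hr
    have hrd : -(d : ℝ) < r := neg_le_criticalOrder.trans_lt hr
    obtain ⟨p, hp, hpr, hi⟩ := exists_admissible_exponent hd h_meas h_nonneg hnorm hr
    refine ⟨hasQuantizationCoeff_cubeMeasure hd hN hrd, ?_,
      densityFunctional_pos_lt_top hd hrd hpr h_meas h_nonneg hnorm hi⟩
    rw [hνd]
    exact hasQuantizationCoeff_densityMeasure hd hN hrd hp hpr h_meas h_nonneg hi fun _ => hmass
  refine ⟨fun r hr => ?_, fun hs => ?_⟩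
  · rcases lt_or_ge (criticalOrder h) r with hcr | hcr
    · obtain ⟨hΛ, hνc, hpos, hfin⟩ := habove r hcr
      have hrd : -(d : ℝ) < r := neg_le_criticalOrder.trans_lt hcr
      refine ⟨_, _, hΛ, hνc, ENNReal.ofReal_lt_top, ENNReal.mul_lt_top ENNReal.ofReal_lt_top hfin,
        rfl, fun _ => ENNReal.mul_pos ?_ hpos.ne', fun hle => ?_⟩
      · exact (ENNReal.ofReal_pos.2 (unitCoeff_pos hd hN hrd)).ne'
      · exact absurd hcr (not_lt.2 (hle.elim le_of_lt fun h => h.1.le))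
    · have hbelow : r < criticalOrder h ∨ (r = criticalOrder h ∧
          eLpNorm h (integrabilityExponent h) (cubeMeasure d) = ∞) :=
        hcr.lt_or_eq.imp_right fun heq => ⟨heq, hr.resolve_left (not_not.2 heq)⟩
      rcases le_or_gt r (-(d : ℝ)) with hrd | hrd
      · have hr0 : r < 0 := by linarith
        have hν0 : densityMeasure (d := d) h ≠ 0 := hνd ▸ IsProbabilityMeasure.ne_zero ν
        have hΛ0 : densityMeasure (d := d) (fun _ => 1) ≠ 0 := by
          rw [densityMeasure_one]; exact IsProbabilityMeasure.ne_zero _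
        obtain ⟨a, ha⟩ := exists_lintegral_distToSet_eq_top hd hN hr0 hrd h_meas hν0
        obtain ⟨b, hb⟩ := exists_lintegral_distToSet_eq_top hd hN hr0 hrd measurable_const hΛ0
        rw [densityMeasure_one] at hb
        rw [← hνd] at ha
        exact ⟨0, 0, hasQuantizationCoeff_zero_of_eq_top hr0 hb d,
          hasQuantizationCoeff_zero_of_eq_top hr0 ha d, ENNReal.zero_lt_top, ENNReal.zero_lt_top,
          by rw [zero_mul], fun h => absurd h (not_lt.2 hcr), fun _ => rfl⟩
      · obtain ⟨hr0, htop⟩ := eLpNorm_eq_top_of_le_criticalOrder hd hnorm hrd hbelow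
        have hΦ : densityFunctional r h = 0 := by
          unfold densityFunctional
          rw [if_neg (not_le.2 hrd), if_neg hr0.ne, htop,
            ENNReal.top_rpow_of_neg (one_div_neg.2 hr0)]
        refine ⟨_, 0, hasQuantizationCoeff_cubeMeasure hd hN hrd, ?_, ENNReal.ofReal_lt_top,
          ENNReal.zero_lt_top, by rw [hΦ, mul_zero], fun h => absurd h (not_lt.2 hcr),
          fun _ => rfl⟩
        rw [hνd]
        exact hasQuantizationCoeff_zero_of_eLpNorm_eq_top hd hN hrd hr0 h_meas h_nonneg htop
  · have hcrit : criticalOrder h < 0 := by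
      rw [criticalOrder_lt_iff hd hs.le (by linarith), add_zero, div_self hdpos.ne',
        ENNReal.ofReal_one]
      exact hs
    obtain ⟨hΛ, hνc, -⟩ := habove 0 hcrit
    exact ⟨_, hΛ, hνc⟩
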